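/- Let $D\ge 2$, $N\ge 1$ be integers and $\beta>0$. Consider $D$ complex fermions $\psi^c_a(\tau)$ ($1\le c\le D$, $1\le a\le N$, $\tau\in[-\beta/2,\beta/2]$) with action $$S=\int d\tau\Big[\sum_{c,a}\bar\psi^c_{a}\partial_\tau\psi^c_{a}-J\sum_{a^1,\dots,a^D}T_{a^1\dots a^D}\psi^1_{a^1}\cdots\psi^D_{a^D}-\bar J\sum_{a^1,\dots,a^D}\bar\psi^D_{a^D}\cdots\bar\psi^1_{a^1}\bar T_{a^1\dots a^D}\Big],$$ propagator $C(\tau,\tau')=\tfrac12\,\mathrm{sgn}(\tau-\tau')$, and normalized free fermionic integral. Here $T$ is a random tensor with normalized Gaussian weight $e^{-N^{D-1}\sum \bar T T}$, a complex (bosonic) tensor for $D$ even and a Grassmann (fermionic) tensor for $D$ odd; $\langle\cdot\rangle$ is the average over $T$. Put $Z^T=\int[d\bar\psi d\psi]\,e^{-S}$. All identities below are identities of formal power series in $J$ and $\bar J$, averages and time integrals being taken order by order; for $D$ even every coefficient of $Z^T$ and of $\ln Z^T$ is integrable for the Gaussian measure of $T$. Let $\mathfrak S(k)$ be the group of permutations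 of $k$ elements. An $m$-tuple $\sigma=(\sigma^{(c)})_c\in\mathfrak S(k)^m$ encodes the bipartite edge $m$-colored graph with $k$ white and $k$ black vertices, in which the white vertex $i$ is joined to the black vertex $\sigma^{(c)}(i)$ by an edge of color $c$. Let $C(\sigma)$ be its number of connected components and $F^{cc'}(\sigma)$ the number of cycles of $\sigma^{(c)}[\sigma^{(c')}]^{-1}$. For a cyclic permutation $\pi$ of the $m$ colors, the jacket of $\sigma$ along $\pi$ is the ribbon graph with $2k$ vertices, $mk$ edges and $\sum_c F^{c\,\pi(c)}(\sigma)$ faces, with genus $g_\pi(\sigma)$ (summed over components) given by $2k-mk+\sum_cF^{c\,\pi(c)}(\sigma)=2C(\sigma)-2g_\pi(\sigma)$. The degree is $\omega(\sigma)=\frac12\sum_\pi g_\pi(\sigma)$, over the $(m-1)!$ cyclic permutations $\pi$ of the colors. For $\sigma^{\mathcal D}=(\sigma^{(1)},\dots,\sigma^{(D)})\in\mathfrak S(k)^D$ and $\sigma^{(0)}\in\mathfrak S(k)$ let $\sigma^{(0)}\sigma^{\mathcal D}$ be the $(D+1)$-tuple with colors $0,\dots,D$, let $\epsilon$ be the signature,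 and let $$A_{\sigma^{\mathcal D}}=(J\bar J)^k\Big(\prod_{c=1}^D\epsilon(\sigma^{(c)})\Big)\int_{[-\beta/2,\beta/2]^{2k}}\prod_{i=1}^kd\tau_i\,d\tau'_i\ \prod_{c=1}^D\prod_{i=1}^kC(\tau_i,\tau'_{\sigma^{(c)}(i)}).$$ Then $$\langle\ln Z^T\rangle=\sum_{k\ge1}\frac1{k!\,k!}\sum_{\substack{\sigma^{(0)}\sigma^{\mathcal D}\in\mathfrak S(k)^{D+1}\\ \sigma^{\mathcal D}\text{ connected}}}A_{\sigma^{\mathcal D}}\,[\epsilon(\sigma^{(0)})]^D\,N^{\,1-\frac2{D!}\omega(\sigma^{(0)}\sigma^{\mathcal D})-\frac2{D(D-2)!}\left(\omega(\sigma^{(0)}\sigma^{\mathcal D})-D\omega(\sigma^{\mathcal D})\right)},$$ $$\ln\langle Z^T\rangle=\sum_{k\ge1}\frac1{k!\,k!}\sum_{\substack{\sigma^{(0)}\sigma^{\mathcal D}\in\mathfrak S(k)^{D+1}\\ \sigma^{(0)}\sigma^{\mathcal D}\text{ connected}}}A_{\sigma^{\mathcal D}}\,[\epsilon(\sigma^{(0)})]^D\,N^{\,1-(D-1)[C(\sigma^{\mathcal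 D})-1]-\frac2{D!}\omega(\sigma^{(0)}\sigma^{\mathcal D})-\frac2{D(D-2)!}\left(\omega(\sigma^{(0)}\sigma^{\mathcal D})-D\omega(\sigma^{\mathcal D})\right)}.$$ Moreover, for all $k\ge1$ and all $\sigma^{(0)}\sigma^{\mathcal D}\in\mathfrak S(k)^{D+1}$ one has $\omega(\sigma^{\mathcal D})\ge0$, $\omega(\sigma^{(0)}\sigma^{\mathcal D})\ge0$ and $\omega(\sigma^{(0)}\sigma^{\mathcal D})\ge D\,\omega(\sigma^{\mathcal D})$, and both exponents of $N$ above are at most $1$: every term scales at most like $N$. -/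

import Mathlib

open MeasureTheory

noncomputable section

namespace SYK

/-! ### Edge colored graphs encoded by tuples of permutations -/

/-- The bipartite edge `m`-colored graph of an `m`-tuple of permutations of `k` elements: the white
vertices are `Sum.inl i`, the black vertices are `Sum.inr j`, and for every color `c` the white
vertex `i` is joined to the black vertex `σ c i`. Parallel edges are merged, which does not affect
connectivity. -/
def coloredGraph {m k : ℕ} (σ : Fin m → Equiv.Perm (Fin k)) : SimpleGraph (Fin k ⊕ Fin k) :=
  SimpleGraph.fromRel fun x y => ∃ (c : Fin m) (i : Fin k), x = Sum.inl i ∧ y = Sum.inr (σ c i)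

/-- The number `C(σ)` of connected components of the colored graph. -/
def numComponents {m k : ℕ} (σ : Fin m → Equiv.Perm (Fin k)) : ℕ :=
  Nat.card (coloredGraph σ).ConnectedComponent

/-- The number of faces with colors `c₁ c₂`, that is the number of cycles (fixed points included)
of the permutation `σ c₁ * (σ c₂)⁻¹`. -/
def numFaces {m k : ℕ} (σ : Fin m → Equiv.Perm (Fin k)) (c₁ c₂ : Fin m) : ℕ :=
  Nat.card (Quotient (Equiv.Perm.SameCycle.setoid (σ c₁ * (σ c₂)⁻¹)))

/-- The genus `g` (summed over the connected components) of the jacket of an `m`-colored graph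
associated with a cyclic permutation `π` of its colors. The jacket is the ribbon graph in which
the edges are arranged in the cyclic order `π` around the white vertices and in the reverse order
around the black ones; it has `2 k` vertices, `m k` edges, and its faces are the faces of the
colored graph with colors `c, π c`. Hence `V - E + F = 2 C - 2 g`. -/
def jacketGenus {m k : ℕ} (σ : Fin m → Equiv.Perm (Fin k)) (π : Equiv.Perm (Fin m)) : ℚ :=
  (numComponents σ : ℚ)
    - ((2 * k : ℚ) - (m * k : ℚ) + ∑ c : Fin m, (numFaces σ c (π c) : ℚ)) / 2

open Classical in
/-- The degree `ω` of an `m`-colored graph: half the sum of the genera of its jackets, the sum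
being over all `(m - 1)!` cyclic permutations of the `m` colors. -/
def degree {m k : ℕ} (σ : Fin m → Equiv.Perm (Fin k)) : ℚ :=
  (1 / 2) * ∑ π : Equiv.Perm (Fin m) with π.IsCycle ∧ π.support = Finset.univ, jacketGenus σ π

/-- The `(D+1)`-tuple `σ⁽⁰⁾ σ^D`; color `0` carries `σ⁽⁰⁾`. -/
def withColorZero {D k : ℕ} (σ₀ : Equiv.Perm (Fin k)) (σ : Fin D → Equiv.Perm (Fin k)) :
    Fin (D + 1) → Equiv.Perm (Fin k) :=
  Fin.cons σ₀ σ

/-! ### Grassmann algebras -/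

/-- The complex Grassmann algebra generated by anticommuting variables indexed by `X`. -/
abbrev Grassmann (X : Type) : Type := ExteriorAlgebra ℂ (X →₀ ℂ)

/-- The generator of the Grassmann algebra with index `x`. -/
def gen {X : Type} (x : X) : Grassmann X := ExteriorAlgebra.ι ℂ (Finsupp.single x 1)

/-- The scalar part (body) of an element of the Grassmann algebra. -/
def body {X : Type} (F : Grassmann X) : ℂ := ExteriorAlgebra.algebraMapInv F

/-- The left derivative `∂ / ∂ x` on the Grassmann algebra. -/
def leftDeriv {X : Type} (x : X) : Module.End ℂ (Grassmann X) :=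
  CliffordAlgebra.contractLeft (Finsupp.lapply x : (X →₀ ℂ) →ₗ[ℂ] ℂ)

/-- The integral of a family of elements of a complex vector space `V` (in the applications a
Grassmann algebra) against a measure: the vector whose image under every linear form is the
integral of the image of the family. It is unique when it exists. -/
def IsWeakIntegral {Ω V : Type} [MeasurableSpace Ω] [AddCommGroup V] [Module ℂ V]
    (μ : Measure Ω) (f : Ω → V) (v : V) : Prop :=
  ∀ l : Module.Dual ℂ V, Integrable (fun x => l (f x)) μ ∧ l v = ∫ x, l (f x) ∂μ

open Classical in
/-- The weak integral, with the value `0` when it does not exist. -/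
def weakIntegral {Ω V : Type} [MeasurableSpace Ω] [AddCommGroup V] [Module ℂ V]
    (μ : Measure Ω) (f : Ω → V) : V :=
  if h : ∃ v, IsWeakIntegral μ f v then h.choose else 0

/-- The bilinear form `(x, y) ↦ - G x y` on the span of the generators. -/
def covForm {X : Type} (G : X → X → ℂ) : LinearMap.BilinForm ℂ (X →₀ ℂ) :=
  Finsupp.linearCombination ℂ fun x => Finsupp.linearCombination ℂ fun y => -G x y

theorem covForm_toQuadraticMap {X : Type} (G : X → X → ℂ) (hG : ∀ x y, G y x = -G x y) :
    (covForm G).toQuadraticMap = (0 : QuadraticForm ℂ (X →₀ ℂ)) - 0 := by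
  have hflip : (covForm G).flip = -covForm G := by
    refine Finsupp.lhom_ext' fun x => LinearMap.ext_ring ?_
    refine Finsupp.lhom_ext' fun y => LinearMap.ext_ring ?_
    simp [covForm, hG x y]
  ext v
  have h := congrArg (fun B : LinearMap.BilinForm ℂ (X →₀ ℂ) => B v v) hflip
  simp only [LinearMap.neg_apply] at h
  simpa using self_eq_neg.mp h

/-- `exp (½ ∂ G ∂)` on the Grassmann algebra, for an antisymmetric covariance `G`. It is the
linear map `W` with `W 1 = 1` and
`W (x * F) = x * W F + ∑ y, G x y • ∂ (W F) / ∂ y` for generators `x`. -/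
def wick {X : Type} (G : X → X → ℂ) (hG : ∀ x y, G y x = -G x y) :
    Grassmann X →ₗ[ℂ] Grassmann X :=
  CliffordAlgebra.changeForm (covForm_toQuadraticMap G hG)

/-! ### The fermions -/

/-- The generators `ψ^c_a(τ)` and `ψ̄^c_a(τ)`. -/
inductive Fermion (D N : ℕ) : Type
  | psi (c : Fin D) (a : Fin N) (τ : ℝ)
  | psiBar (c : Fin D) (a : Fin N) (τ : ℝ)

/-- The propagator `C(τ, τ') = ½ sgn(τ - τ')`, the kernel inverse to `∂_τ`. -/
def propagator (τ τ' : ℝ) : ℝ := Real.sign (τ - τ') / 2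

/-- The index set of the random tensor: `D` indices with `N` values each. -/
abbrev Idx (D N : ℕ) : Type := Fin D → Fin N

/-- The covariance of the fermions, extended by zero to further generators `Y`:
`⟨ψ^c_a(τ) ψ̄^c'_b(τ')⟩ = δ_{cc'} δ_{ab} C(τ, τ') = - ⟨ψ̄^c'_b(τ') ψ^c_a(τ)⟩`. -/
def fermionCov {D N : ℕ} {Y : Type} : Fermion D N ⊕ Y → Fermion D N ⊕ Y → ℂ
  | .inl (.psi c a τ), .inl (.psiBar c' b τ') =>
      if c = c' ∧ a = b then (propagator τ τ' : ℂ) else 0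
  | .inl (.psiBar c' b τ'), .inl (.psi c a τ) =>
      if c = c' ∧ a = b then -(propagator τ τ' : ℂ) else 0
  | _, _ => 0

theorem fermionCov_antisymm {D N : ℕ} {Y : Type} (x y : Fermion D N ⊕ Y) :
    fermionCov y x = -fermionCov x y := by
  rcases x with (_ | _) | _ <;> rcases y with (_ | _) | _ <;> simp only [fermionCov] <;>
    first
    | (split_ifs <;> simp)
    | simp

/-- The normalized Grassmann Gaussian integral
`∫ [dψ̄ dψ] exp(- ∑_c ∫∫ ψ̄^c C⁻¹ ψ^c) F` over the fermions. The variables `Y` are spectators: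
the result is an element of the Grassmann algebra that they generate. -/
def fermionIntegral (D N : ℕ) (Y : Type) : Grassmann (Fermion D N ⊕ Y) →ₗ[ℂ] Grassmann Y :=
  (ExteriorAlgebra.map (Finsupp.linearCombination ℂ
      (Sum.elim (fun _ => 0) (fun y => Finsupp.single y (1 : ℂ))))).toLinearMap
    ∘ₗ wick fermionCov fermionCov_antisymm

/-- The inclusion of the Grassmann algebra of the spectators. -/
def spectator (D N : ℕ) (Y : Type) : Grassmann Y →ₐ[ℂ] Grassmann (Fermion D N ⊕ Y) :=
  ExteriorAlgebra.map (Finsupp.lmapDomain ℂ ℂ Sum.inr)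

/-- The interaction term `∑_a T_{a¹…a^D} ψ¹_{a¹}(τ) ⋯ ψ^D_{a^D}(τ)`. -/
def vertex {D N : ℕ} {Y : Type} (T : Idx D N → Grassmann Y) (τ : ℝ) :
    Grassmann (Fermion D N ⊕ Y) :=
  ∑ a : Idx D N, spectator D N Y (T a)
    * (List.ofFn fun c : Fin D => gen (.inl (.psi c (a c) τ))).prod

/-- The interaction term `∑_a ψ̄^D_{a^D}(τ) ⋯ ψ̄¹_{a¹}(τ) T̄_{a¹…a^D}`. -/
def vertexBar {D N : ℕ} {Y : Type} (Tbar : Idx D N → Grassmann Y) (τ : ℝ) :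
    Grassmann (Fermion D N ⊕ Y) :=
  ∑ a : Idx D N,
    (List.ofFn fun c : Fin D => gen (.inl (.psiBar c.rev (a c.rev) τ))).prod
      * spectator D N Y (Tbar a)

/-- Lebesgue measure on `[-β/2, β/2]^m × [-β/2, β/2]^n`. -/
def timeMeasure (β : ℝ) (m n : ℕ) : Measure ((Fin m → ℝ) × (Fin n → ℝ)) :=
  (Measure.pi fun _ : Fin m => volume.restrict (Set.Icc (-β / 2) (β / 2))).prod
    (Measure.pi fun _ : Fin n => volume.restrict (Set.Icc (-β / 2) (β / 2)))

/-- The thermal partition function `Z^T = ∫ [dψ̄ dψ] e^{-S}` in the background `(T, T̄)`, as a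
formal power series in the couplings `J` (variable `0`) and `J̄` (variable `1`): the coefficient of
`J^m J̄^n` is `1 / (m! n!)` times the time integral of the fermionic Gaussian integral of a
product of `m` vertices `T ψ¹ ⋯ ψ^D` and `n` vertices `ψ̄^D ⋯ ψ̄¹ T̄`. -/
def partitionFunction {D N : ℕ} {Y : Type} (β : ℝ) (T Tbar : Idx D N → Grassmann Y) :
    MvPowerSeries (Fin 2) (Grassmann Y) :=
  fun d => (1 / ((d 0).factorial * (d 1).factorial : ℂ)) •
    weakIntegral (timeMeasure β (d 0) (d 1)) fun t =>
      fermionIntegral D N Y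
        ((List.ofFn fun i => vertex T (t.1 i)).prod
          * (List.ofFn fun j => vertexBar Tbar (t.2 j)).prod)

/-- The logarithm `ln Z = ∑_{m ≥ 1} (-1)^{m+1} (Z - 1)^m / m` of a formal power series with
constant coefficient `1`. Only the powers `m ≤ deg d` contribute to the monomial `d`. -/
def formalLog {A : Type} [Ring A] [Algebra ℂ A] (Z : MvPowerSeries (Fin 2) A) :
    MvPowerSeries (Fin 2) A :=
  fun d => ∑ m ∈ Finset.Icc 1 (d 0 + d 1),
    ((-1 : ℂ) ^ (m + 1) / (m : ℂ)) • MvPowerSeries.coeff d ((Z - 1) ^ m)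

/-! ### The disorder average, `D` even: complex Gaussian tensor -/

/-- The Gaussian measure `∏_a (N^{D-1} dT̄_a dT_a / 2πi) exp(- N^{D-1} ∑_a T_a T̄_a)` on complex
tensors, where `dT̄ dT / 2i` is Lebesgue measure on `ℂ`. -/
def tensorMeasure (D N : ℕ) : Measure (Idx D N → ℂ) :=
  volume.withDensity fun T =>
    ENNReal.ofReal (∏ a, (N : ℝ) ^ (D - 1) / Real.pi * Real.exp (-(N : ℝ) ^ (D - 1) * ‖T a‖ ^ 2))

/-- `Z^T` for a complex tensor `T`. -/
def partitionBosonic (D N : ℕ) (β : ℝ) (T : Idx D N → ℂ) : MvPowerSeries (Fin 2) ℂ :=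
  fun d => body (partitionFunction (Y := Empty) β (fun a => algebraMap ℂ _ (T a))
    (fun a => algebraMap ℂ _ (starRingEnd ℂ (T a))) d)

/-- Order by order average over the complex Gaussian tensor. -/
def averageBosonic (D N : ℕ) (F : (Idx D N → ℂ) → MvPowerSeries (Fin 2) ℂ) :
    MvPowerSeries (Fin 2) ℂ :=
  fun d => ∫ T, MvPowerSeries.coeff d (F T) ∂tensorMeasure D N

/-! ### The disorder average, `D` odd: Grassmann tensor -/

/-- The Grassmann variable `T_a`. -/
def genT {D N : ℕ} (a : Idx D N) : Grassmann (Idx D N ⊕ Idx D N) := gen (.inl a)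

/-- The Grassmann variable `T̄_a`. -/
def genTbar {D N : ℕ} (a : Idx D N) : Grassmann (Idx D N ⊕ Idx D N) := gen (.inr a)

/-- The Berezin integral `∫ ∏_a dT̄_a dT_a F` (the order of the commuting pairs `dT̄_a dT_a` is
immaterial). -/
def berezin (D N : ℕ) (F : Grassmann (Idx D N ⊕ Idx D N)) : ℂ :=
  body ((((Finset.univ : Finset (Idx D N)).toList.map fun a =>
    (leftDeriv (Sum.inr a) * leftDeriv (Sum.inl a) :
      Module.End ℂ (Grassmann (Idx D N ⊕ Idx D N)))).prod) F)

/-- The Gaussian weight `exp(- N^{D-1} ∑_a T̄_a T_a)` in the Grassmann algebra. -/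
def berezinWeight (D N : ℕ) : Grassmann (Idx D N ⊕ Idx D N) :=
  IsNilpotent.exp (-((N : ℂ) ^ (D - 1)) • ∑ a : Idx D N, genTbar a * genT a)

/-- The normalized Gaussian Berezin integral over the Grassmann tensor. -/
def berezinAverage (D N : ℕ) (F : Grassmann (Idx D N ⊕ Idx D N)) : ℂ :=
  berezin D N (berezinWeight D N * F) / berezin D N (berezinWeight D N)

/-- `Z^T` for a Grassmann tensor `T`. -/
def partitionFermionic (D N : ℕ) (β : ℝ) :
    MvPowerSeries (Fin 2) (Grassmann (Idx D N ⊕ Idx D N)) :=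
  partitionFunction β genT genTbar

/-- Order by order average over the Grassmann Gaussian tensor. -/
def averageFermionic (D N : ℕ) (F : MvPowerSeries (Fin 2) (Grassmann (Idx D N ⊕ Idx D N))) :
    MvPowerSeries (Fin 2) ℂ :=
  fun d => berezinAverage D N (MvPowerSeries.coeff d F)

/-! ### The two free energies and the terms of their expansions -/

open Classical in
/-- The quenched free energy `⟨ln Z^T⟩`; `T` is bosonic for `D` even and fermionic for `D` odd. -/
def quenchedFreeEnergy (D N : ℕ) (β : ℝ) : MvPowerSeries (Fin 2) ℂ :=
  if Even D then averageBosonic D N fun T => formalLog (partitionBosonic D N β T)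
  else averageFermionic D N (formalLog (partitionFermionic D N β))

open Classical in
/-- The averaged partition function `⟨Z^T⟩`. -/
def averagedPartitionFunction (D N : ℕ) (β : ℝ) : MvPowerSeries (Fin 2) ℂ :=
  if Even D then averageBosonic D N fun T => partitionBosonic D N β T
  else averageFermionic D N (partitionFermionic D N β)

/-- The annealed free energy `ln ⟨Z^T⟩`. -/
def annealedFreeEnergy (D N : ℕ) (β : ℝ) : MvPowerSeries (Fin 2) ℂ :=
  formalLog (averagedPartitionFunction D N β)

/-- The partial amplitude of the graph `σ^D`, as the coefficient of `(J J̄)^k`. -/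
def amplitude {D k : ℕ} (β : ℝ) (σ : Fin D → Equiv.Perm (Fin k)) : ℝ :=
  (∏ c, (((Equiv.Perm.sign (σ c) : ℤˣ) : ℤ) : ℝ)) *
    ∫ t, ∏ c : Fin D, ∏ i : Fin k, propagator (t.1 i) (t.2 (σ c i)) ∂timeMeasure β k k

/-- The formal power series `∑_{k ≥ 1} (J J̄)^k u k`. -/
def couplingSeries (u : ℕ → ℂ) : MvPowerSeries (Fin 2) ℂ :=
  fun d => if d 0 = d 1 ∧ 1 ≤ d 0 then u (d 0) else 0

/-- The exponent of `N` in the quenched expansion. -/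
def quenchedExponent {D k : ℕ} (σ₀ : Equiv.Perm (Fin k)) (σ : Fin D → Equiv.Perm (Fin k)) : ℚ :=
  1 - 2 / (D.factorial : ℚ) * degree (withColorZero σ₀ σ)
    - 2 / ((D : ℚ) * ((D - 2).factorial : ℚ)) * (degree (withColorZero σ₀ σ) - D * degree σ)

/-- The exponent of `N` in the annealed expansion. -/
def annealedExponent {D k : ℕ} (σ₀ : Equiv.Perm (Fin k)) (σ : Fin D → Equiv.Perm (Fin k)) : ℚ :=
  1 - ((D : ℚ) - 1) * ((numComponents σ : ℚ) - 1)
    - 2 / (D.factorial : ℚ) * degree (withColorZero σ₀ σ)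
    - 2 / ((D : ℚ) * ((D - 2).factorial : ℚ)) * (degree (withColorZero σ₀ σ) - D * degree σ)

/-- The contribution `A_{σ^D} ε(σ⁽⁰⁾)^D N^e` of the graph `σ⁽⁰⁾ σ^D`, without `(J J̄)^k`. -/
def graphTerm {D k : ℕ} (N : ℕ) (β : ℝ) (σ₀ : Equiv.Perm (Fin k))
    (σ : Fin D → Equiv.Perm (Fin k)) (e : ℚ) : ℝ :=
  amplitude β σ * (((Equiv.Perm.sign σ₀ : ℤˣ) : ℤ) : ℝ) ^ D * (N : ℝ) ^ (e : ℝ)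

end SYK

end

open scoped Classical

noncomputable section

set_option linter.unusedSectionVars false

namespace SYK

open Equiv.Perm

/-! ### Counting the classes of setoids and the cycles of permutations -/

/-! Wick's theorem turns every coefficient into a sum over tuples of permutations, the exponential
formula identifies the logarithm with the connected part of that sum, and the exponents of `N` come
from counting faces.

Expansion. The fermionic integral of `k` vertices and `k` conjugate vertices is a `kD × kD`
determinant of propagators, block diagonal in the color; expanding the blocks gives a sum over `σ ∈
𝔖(k)^D` of signs times propagators, and the pairings contract the tensors into a trace invariant
(`partitionFunction_eq`). Unequal numbers of the two kinds of vertices give zero. The average over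
`T` adds a permutation `σ⁽⁰⁾` with weight `ε(σ⁽⁰⁾)^D N^{-(D-1)k}` (`integral_prod_tensor` for `D`
even, `berezinAverage_prod` for `D` odd), and each cycle of colors `0c` leaves one free index: the
total power is `N^{-(D-1)k + ∑ F^{0c}}`.

Logarithm. Multiplying all the permutations by `ρ` relabels the black vertices and leaves the weight
of a graph unchanged, the signs `ε(ρ)^D` cancelling. One permutation can therefore be fixed to be
`1`, which replaces `1/k!²` by `1/k!`. What remains are tuples of permutations of a single labelled
set, whose orbits are the components of the graph and whose weight is multiplicative over orbits;
`MultiplicativeWeight.formalLog_total` is the exponential formula for them. In the quenched case it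
is applied before averaging, with `D` colors; for a Grassmann tensor this takes place in the
commutative subalgebra generated by the products `T_a T̄_b`. In the annealed case it is applied
after averaging, with `D + 1` colors and `σ⁽⁰⁾ = 1`, so that `T_a T̄_b` is replaced by its
covariance.

Exponents. An ordered pair of distinct colors among `m` is consecutive in `(m-2)!` cyclic
permutations, so the degree is an affine function of the number of components and the total number
of faces (`degree_eq`). Writing this for `σ` and for `σ⁽⁰⁾σ` and solving for `∑ F^{0c}` yields both
exponents (`sum_numFaces_eq`).

Bounds. The key is `F^{0c} + F^{0c'} + 2 C(σ) ≤ k + F^{cc'} + 2 C(σ⁽⁰⁾σ)`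
(`numFaces_withColorZero_le`), a genus inequality obtained by multiplying by transpositions one at a
time. Summed over `c ≠ c'` it says `ω(σ⁽⁰⁾σ) ≥ D ω(σ)`, and non-negativity of the degree follows by
induction on the number of colors, starting from two. -/

/-- The number of classes of a setoid. -/
def numClasses {α : Type*} (S : Setoid α) : ℕ := Nat.card (Quotient S)

/-- The number of cycles of a permutation, fixed points included. -/
def cycleCount {α : Type*} (p : Equiv.Perm α) : ℕ := numClasses (SameCycle.setoid p)

section Classes

variable {α : Type*} [Finite α]

theorem numClasses_anti {S T : Setoid α} (h : S ≤ T) : numClasses T ≤ numClasses S := by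
  refine Nat.card_le_card_of_surjective (Quotient.map id fun a b hab => h hab) ?_
  rintro ⟨a⟩
  exact ⟨⟦a⟧, rfl⟩

theorem numClasses_lt {S T : Setoid α} (h : S ≤ T) {x y : α} (hT : T x y) (hS : ¬S x y) :
    numClasses T < numClasses S := by
  refine lt_of_le_of_ne (numClasses_anti h) fun hcard => hS ?_
  have hsurj : Function.Surjective (Quotient.map id fun a b hab => h hab :
      Quotient S → Quotient T) := by
    rintro ⟨a⟩
    exact ⟨⟦a⟧, rfl⟩
  have hinj := ((Nat.bijective_iff_surjective_and_card _).mpr ⟨hsurj, hcard.symm⟩).injective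
  exact Quotient.exact (hinj (a₁ := ⟦x⟧) (a₂ := ⟦y⟧) (Quotient.sound hT))

theorem numClasses_le_card (S : Setoid α) : numClasses S ≤ Nat.card α :=
  Nat.card_le_card_of_surjective (Quotient.mk S) Quotient.mk_surjective

theorem numClasses_bot : numClasses (⊥ : Setoid α) = Nat.card α := by
  refine (Nat.card_eq_of_bijective (Quotient.mk ⊥) ⟨fun a b h => ?_, Quotient.mk_surjective⟩).symm
  exact Quotient.exact h

/-- The setoid obtained by merging the classes of two points. -/
def mergeClasses {α : Type*} (S : Setoid α) (x y : α) : Setoid α where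
  r a b := S a b ∨ (S a x ∧ S b y) ∨ (S a y ∧ S b x)
  iseqv :=
    { refl := fun a => Or.inl (S.refl a)
      symm := by
        rintro a b (h | ⟨h, h'⟩ | ⟨h, h'⟩)
        exacts [Or.inl (S.symm h), Or.inr (Or.inr ⟨h', h⟩), Or.inr (Or.inl ⟨h', h⟩)]
      trans := by
        rintro a b c (h | ⟨h, h'⟩ | ⟨h, h'⟩) (g | ⟨g, g'⟩ | ⟨g, g'⟩)
        · exact Or.inl (S.trans h g)
        · exact Or.inr (Or.inl ⟨S.trans h g, g'⟩)
        · exact Or.inr (Or.inr ⟨S.trans h g, g'⟩)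
        · exact Or.inr (Or.inl ⟨h, S.trans (S.symm g) h'⟩)
        · exact Or.inl (S.trans h (S.trans (S.symm g) (S.trans h' (S.symm g'))))
        · exact Or.inl (S.trans h (S.symm g'))
        · exact Or.inr (Or.inr ⟨h, S.trans (S.symm g) h'⟩)
        · exact Or.inl (S.trans h (S.symm g'))
        · exact Or.inl (S.trans h (S.trans (S.symm g) (S.trans h' (S.symm g')))) }

theorem le_mergeClasses (S : Setoid α) (x y : α) : S ≤ mergeClasses S x y := fun _ _ h => Or.inl h

theorem mergeClasses_rel (S : Setoid α) (x y : α) : mergeClasses S x y x y :=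
  Or.inr (Or.inl ⟨S.refl x, S.refl y⟩)

theorem mergeClasses_le {S T : Setoid α} {x y : α} (h : S ≤ T) (hxy : T x y) :
    mergeClasses S x y ≤ T := by
  rintro a b (g | ⟨g, g'⟩ | ⟨g, g'⟩)
  · exact h g
  · exact T.trans (h g) (T.trans hxy (T.symm (h g')))
  · exact T.trans (h g) (T.trans (T.symm hxy) (T.symm (h g')))

/-- Merging loses at most one class: away from the class of `x` the quotient map is injective, and
the class of `x` is sent to `none`. -/
theorem numClasses_le_mergeClasses (S : Setoid α) (x y : α) :
    numClasses S ≤ numClasses (mergeClasses S x y) + 1 := by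
  let f : Quotient S → Option (Quotient (mergeClasses S x y)) := fun q =>
    if q = ⟦x⟧ then none else some (Quotient.map id (fun a b h => le_mergeClasses S x y h) q)
  have hf : Function.Injective f := by
    intro qa qb
    induction qa, qb using Quotient.inductionOn₂ with
    | _ a b =>
    intro h
    by_cases ha : (Quotient.mk S a) = ⟦x⟧ <;> by_cases hb : (Quotient.mk S b) = ⟦x⟧
    · exact ha.trans hb.symm
    · simp [f, ha, hb] at h
    · simp [f, ha, hb] at h
    · simp only [f, ha, hb, if_false, Option.some.injEq] at h
      have h' : mergeClasses S x y a b := Quotient.exact h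
      rcases h' with h | ⟨h, _⟩ | ⟨_, h⟩
      · exact Quotient.sound h
      · exact absurd (Quotient.sound h) ha
      · exact absurd (Quotient.sound h) hb
  calc numClasses S ≤ Nat.card (Option (Quotient (mergeClasses S x y))) :=
        Nat.card_le_card_of_injective f hf
    _ = numClasses (mergeClasses S x y) + 1 := Finite.card_option

/-- The cycles form the finest equivalence relation containing all pairs `z, p z`; by finiteness
non-negative powers suffice. Most comparisons of partitions below go through this. -/
theorem sameCycle_le {p : Equiv.Perm α} {S : Setoid α} (h : ∀ z, S z (p z)) :
    SameCycle.setoid p ≤ S := by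
  intro x y hxy
  obtain ⟨n, rfl⟩ := SameCycle.exists_nat_pow_eq hxy
  clear hxy
  induction n with
  | zero => exact S.refl x
  | succ n ih =>
    rw [pow_succ', mul_apply]
    exact S.trans ih (h _)

theorem sameCycle_rel (p : Equiv.Perm α) (z : α) : SameCycle.setoid p z (p z) :=
  sameCycle_apply_right.mpr (SameCycle.refl p z)

theorem cycleCount_one : cycleCount (1 : Equiv.Perm α) = Nat.card α := by
  rw [cycleCount, ← numClasses_bot]
  exact le_antisymm (numClasses_anti bot_le) (numClasses_anti (sameCycle_le fun z => by simp))

theorem cycleCount_inv (p : Equiv.Perm α) : cycleCount p⁻¹ = cycleCount p := by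
  have : SameCycle.setoid p⁻¹ = SameCycle.setoid p := by
    ext x y
    exact sameCycle_inv
  rw [cycleCount, cycleCount, this]

theorem cycleCount_conj {β : Type*} [Finite β] (e : α ≃ β) (p : Equiv.Perm α) :
    cycleCount ((e.symm.trans p).trans e) = cycleCount p := by
  have key : ∀ n : ℕ, ∀ x, (((e.symm.trans p).trans e) ^ n) x = e ((p ^ n) (e.symm x)) := by
    intro n
    induction n with
    | zero => simp
    | succ n ih =>
      intro x
      rw [pow_succ', pow_succ', mul_apply, mul_apply, ih]
      simp
  refine (Nat.card_congr (Quotient.congr e ?_)).symm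
  intro a b
  constructor
  · intro h
    obtain ⟨n, rfl⟩ := SameCycle.exists_nat_pow_eq h
    exact ⟨n, by rw [zpow_natCast, key]; simp⟩
  · intro h
    obtain ⟨n, hn⟩ := SameCycle.exists_nat_pow_eq h
    exact ⟨n, by rw [zpow_natCast]; rw [key] at hn; simpa using hn⟩

theorem cycleCount_mul_comm (p q : Equiv.Perm α) : cycleCount (p * q) = cycleCount (q * p) := by
  rw [← cycleCount_conj q (p * q)]
  congr 1
  ext x
  simp

variable [DecidableEq α]

/-- Two distinct cycles are joined: `q` sends `x` to `p y` and then follows the `p`-cycle of `y`,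
which avoids `x`, so that `q` and `p` differ on it only at `y`. -/
theorem sameCycle_mul_swap {p : Equiv.Perm α} {x y : α} (h : ¬SameCycle p x y) :
    SameCycle (p * Equiv.swap x y) x y := by
  set q := p * Equiv.swap x y with hq
  have key : ∀ n : ℕ, SameCycle q x ((p ^ (n + 1)) y) := by
    intro n
    induction n with
    | zero =>
      have : (p ^ (0 + 1)) y = q x := by simp [hq]
      rw [this]
      exact sameCycle_apply_right.mpr (SameCycle.refl q x)
    | succ n ih =>
      by_cases hy : (p ^ (n + 1)) y = y
      · have : (p ^ (n + 1 + 1)) y = q x := by rw [pow_succ', mul_apply, hy]; simp [hq]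
        rw [this]
        exact sameCycle_apply_right.mpr (SameCycle.refl q x)
      · have hx : (p ^ (n + 1)) y ≠ x := fun hx => h (SameCycle.symm ⟨(n + 1 : ℕ), by
          rw [zpow_natCast, hx]⟩)
        have : (p ^ (n + 1 + 1)) y = q ((p ^ (n + 1)) y) := by
          rw [pow_succ', mul_apply, hq, mul_apply, Equiv.swap_apply_of_ne_of_ne hx hy]
        rw [this]
        exact sameCycle_apply_right.mpr ih
  obtain ⟨n, hn⟩ : ∃ n, orderOf p = n + 1 :=
    Nat.exists_eq_succ_of_ne_zero (orderOf_pos p).ne'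
  have := key n
  rwa [← hn, pow_orderOf_eq_one, one_apply] at this

theorem sameCycle_le_mergeClasses (p : Equiv.Perm α) (x y : α) :
    SameCycle.setoid p ≤ mergeClasses (SameCycle.setoid (p * Equiv.swap x y)) x y := by
  refine sameCycle_le fun z => ?_
  set S := mergeClasses (SameCycle.setoid (p * Equiv.swap x y)) x y
  have h1 : ∀ z, S z (p (Equiv.swap x y z)) := fun z =>
    le_mergeClasses _ x y (sameCycle_rel (p * Equiv.swap x y) z)
  have h2 : S x y := mergeClasses_rel _ x y
  by_cases hx : z = x
  · subst hx
    exact S.trans h2 (by simpa using h1 y)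
  by_cases hy : z = y
  · subst hy
    exact S.trans (S.symm h2) (by simpa using h1 x)
  simpa [Equiv.swap_apply_of_ne_of_ne hx hy] using h1 z

theorem cycleCount_mul_swap_le (p : Equiv.Perm α) (x y : α) :
    cycleCount (p * Equiv.swap x y) ≤ cycleCount p + 1 :=
  (numClasses_le_mergeClasses _ x y).trans
    (Nat.succ_le_succ (numClasses_anti (sameCycle_le_mergeClasses p x y)))

theorem cycleCount_mul_swap_lt {p : Equiv.Perm α} {x y : α} (h : ¬SameCycle p x y) :
    cycleCount (p * Equiv.swap x y) + 1 ≤ cycleCount p := by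
  refine numClasses_lt ?_ (sameCycle_mul_swap h) h
  exact (sameCycle_le_mergeClasses p x y).trans
    (mergeClasses_le le_rfl (sameCycle_mul_swap h))

/-- The product of a list of transpositions. -/
def swapProd (l : List (α × α)) : Equiv.Perm α := (l.map fun z => Equiv.swap z.1 z.2).prod

/-- Minimal factorization: one transposition splits a moved point off its cycle and raises the
number of cycles by one, until the identity is reached. -/
theorem exists_swapProd (p : Equiv.Perm α) :
    ∃ l : List (α × α), swapProd l = p ∧ l.length + cycleCount p = Nat.card α := by
  obtain ⟨n, hn⟩ : ∃ n, n + cycleCount p = Nat.card α :=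
    ⟨_, Nat.sub_add_cancel (numClasses_le_card _)⟩
  induction n using Nat.strong_induction_on generalizing p with
  | _ n ih =>
  by_cases h1 : p = 1
  · subst h1
    exact ⟨[], rfl, by simp [cycleCount_one]⟩
  · obtain ⟨x, hx⟩ : ∃ x, p x ≠ x := by
      by_contra! h
      exact h1 (Equiv.ext h)
    -- This choice makes `x` a fixed point of `q`, hence not in the `q`-cycle of `y`.
    set y := p⁻¹ x with hy
    have hxy : x ≠ y := fun h => hx (by
      conv_lhs => rw [h]
      simp [hy])
    set q := p * Equiv.swap x y with hq
    have hpq : p = q * Equiv.swap x y := by simp [hq, mul_assoc]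
    have hqx : q x = x := by simp [hq, hy]
    have hnot : ¬SameCycle q x y := fun h => hxy ((h.eq_of_left hqx))
    have h2 := cycleCount_mul_swap_lt hnot
    have h3 := cycleCount_mul_swap_le p x y
    rw [← hpq] at h2
    rw [← hq] at h3
    have h4 : cycleCount q ≤ Nat.card α := numClasses_le_card _
    obtain ⟨l, hl, hlen⟩ := ih (n - 1) (by omega) q (by omega)
    refine ⟨l ++ [(x, y)], ?_, ?_⟩
    · simp only [swapProd, List.map_append, List.prod_append] at hl ⊢
      rw [hl, hpq]
      simp
    · simp only [List.length_append, List.length_singleton]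
      omega

theorem swapProd_rel {T : Setoid α} : ∀ {l : List (α × α)}, (∀ z ∈ l, T z.1 z.2) →
    ∀ x, T x (swapProd l x)
  | [], _, x => T.refl x
  | z :: l, h, x => by
    have h1 := swapProd_rel (fun w hw => h w (List.mem_cons_of_mem z hw)) x
    have h2 : T z.1 z.2 := h z List.mem_cons_self
    have h3 : swapProd (z :: l) x = Equiv.swap z.1 z.2 (swapProd l x) := by
      simp [swapProd]
    rw [h3]
    refine T.trans h1 ?_
    by_cases ha : swapProd l x = z.1
    · rw [ha, Equiv.swap_apply_left]; exact h2
    by_cases hb : swapProd l x = z.2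
    · rw [hb, Equiv.swap_apply_right]; exact T.symm h2
    rw [Equiv.swap_apply_of_ne_of_ne ha hb]

/-- Each transposition either has both points in one class of `S`, and then adds at most one cycle,
or joins two cycles lying in different classes, and then removes one cycle while the merger costs at
most one class. In both cases `cycles - 2 * classes` grows by at most one. The partition `S` is
carried along by merging and stays coarser than the cycles. -/
theorem cycleCount_mul_swapProd (l : List (α × α)) : ∀ (p : Equiv.Perm α) (S S' : Setoid α),
    SameCycle.setoid p ≤ S → (∀ T, S ≤ T → (∀ z ∈ l, T z.1 z.2) → S' ≤ T) →
    cycleCount (p * swapProd l) + 2 * numClasses S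
      ≤ cycleCount p + 2 * numClasses S' + l.length := by
  induction l with
  | nil =>
    intro p S S' _ h
    have := numClasses_anti (h S le_rfl (by simp))
    simp [swapProd]
    omega
  | cons z l ih =>
    intro p S S' hp h
    have h1 := ih (p * Equiv.swap z.1 z.2) (mergeClasses S z.1 z.2) S' (by
      have h2 := sameCycle_le_mergeClasses (p * Equiv.swap z.1 z.2) z.1 z.2
      rw [mul_assoc, Equiv.swap_mul_self, mul_one] at h2
      exact h2.trans (mergeClasses_le (hp.trans (le_mergeClasses _ _ _)) (mergeClasses_rel _ _ _)))
      (fun T hT hl => h T ((le_mergeClasses _ _ _).trans hT) (by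
        intro w hw
        rcases List.mem_cons.mp hw with rfl | hw
        · exact hT (mergeClasses_rel _ _ _)
        · exact hl w hw))
    have h3 : p * swapProd (z :: l) = p * Equiv.swap z.1 z.2 * swapProd l := by
      simp [swapProd, mul_assoc]
    rw [h3, List.length_cons]
    have h4 := numClasses_le_mergeClasses S z.1 z.2
    by_cases hS : S z.1 z.2
    · have h5 := cycleCount_mul_swap_le p z.1 z.2
      have h6 := numClasses_anti (mergeClasses_le le_rfl hS)
      omega
    · have h5 := cycleCount_mul_swap_lt (p := p) (x := z.1) (y := z.2) fun h => hS (hp h)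
      omega

/-- When `S` is the cycle partition of `p`, this is the non-negativity of the genus attached to `p`,
`q` and `p * q`. A coarser `S` is needed because the components of a graph with many colors are
larger than its two-colored faces. -/
theorem cycleCount_mul_le {p : Equiv.Perm α} {S : Setoid α} (hp : SameCycle.setoid p ≤ S)
    (q : Equiv.Perm α) :
    cycleCount (p * q) + 2 * numClasses S + cycleCount q
      ≤ cycleCount p + 2 * numClasses (S ⊔ SameCycle.setoid q) + Nat.card α := by
  obtain ⟨l, rfl, hl⟩ := exists_swapProd q
  have := cycleCount_mul_swapProd l p S (S ⊔ SameCycle.setoid (swapProd l)) hp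
    fun T hS hT => sup_le hS (sameCycle_le (swapProd_rel hT))
  omega

end Classes

/-! ### Connectivity of colored graphs -/

section Graph

variable {m k : ℕ}

theorem coloredGraph_reachable (σ : Fin m → Equiv.Perm (Fin k)) (c : Fin m) (i : Fin k) :
    (coloredGraph σ).Reachable (Sum.inl i) (Sum.inr (σ c i)) := by
  refine SimpleGraph.Adj.reachable ?_
  rw [coloredGraph, SimpleGraph.fromRel_adj]
  exact ⟨by simp, Or.inl ⟨c, i, rfl, rfl⟩⟩

/-- The partition of the white vertices by the connected components of a colored graph. -/
def whiteSetoid (σ : Fin m → Equiv.Perm (Fin k)) : Setoid (Fin k) :=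
  (coloredGraph σ).reachableSetoid.comap Sum.inl

theorem whiteSetoid_rel (σ : Fin m → Equiv.Perm (Fin k)) (c c' : Fin m) (i : Fin k) :
    whiteSetoid σ i ((σ c)⁻¹ (σ c' i)) := by
  have h := coloredGraph_reachable σ c ((σ c)⁻¹ (σ c' i))
  rw [show σ c ((σ c)⁻¹ (σ c' i)) = σ c' i by simp] at h
  exact (coloredGraph_reachable σ c' i).trans h.symm

/-- The edges of the reference color `c₀` attach each black vertex to a white one, so the classes of
`S` extend to a function on all vertices that is constant along edges. -/
theorem whiteSetoid_le {σ : Fin m → Equiv.Perm (Fin k)} {S : Setoid (Fin k)} (c₀ : Fin m)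
    (h : ∀ c i, S i ((σ c₀)⁻¹ (σ c i))) : whiteSetoid σ ≤ S := by
  let f : Fin k ⊕ Fin k → Quotient S := Sum.elim (fun i => ⟦i⟧) fun j => ⟦(σ c₀)⁻¹ j⟧
  have hadj : ∀ x y, (coloredGraph σ).Adj x y → f x = f y := by
    intro x y hxy
    rw [coloredGraph, SimpleGraph.fromRel_adj] at hxy
    rcases hxy.2 with ⟨c, i, rfl, rfl⟩ | ⟨c, i, rfl, rfl⟩
    · exact Quotient.sound (h c i)
    · exact (Quotient.sound (h c i)).symm
  intro i j hij
  have key : ∀ x y, (coloredGraph σ).Reachable x y → f x = f y := by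
    rintro x y ⟨w⟩
    induction w with
    | nil => rfl
    | cons hadj' _ ih => exact (hadj _ _ hadj').trans ih
  exact Quotient.exact (key (Sum.inl i) (Sum.inl j) hij)

/-- Every component contains a white vertex. This requires at least one color, hence the argument
`c₀`. -/
theorem numComponents_eq (σ : Fin m → Equiv.Perm (Fin k)) (c₀ : Fin m) :
    numComponents σ = numClasses (whiteSetoid σ) := by
  symm
  refine Nat.card_eq_of_bijective (Quotient.lift
    (fun i => (coloredGraph σ).connectedComponentMk (Sum.inl i)) fun i j h => ?_) ⟨?_, ?_⟩
  · exact SimpleGraph.ConnectedComponent.sound h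
  · rintro ⟨i⟩ ⟨j⟩ h
    exact Quotient.sound (SimpleGraph.ConnectedComponent.exact h)
  · intro C
    induction C using SimpleGraph.ConnectedComponent.ind with
    | _ v =>
    rcases v with i | j
    · exact ⟨⟦i⟧, rfl⟩
    · refine ⟨⟦(σ c₀)⁻¹ j⟧, SimpleGraph.ConnectedComponent.sound ?_⟩
      simpa using coloredGraph_reachable σ c₀ ((σ c₀)⁻¹ j)

theorem coloredGraph_connected_iff (σ : Fin m → Equiv.Perm (Fin k)) (c₀ : Fin m) :
    (coloredGraph σ).Connected ↔ 1 ≤ k ∧ ∀ i j, whiteSetoid σ i j := by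
  constructor
  · intro h
    refine ⟨?_, fun i j => h.preconnected _ _⟩
    obtain ⟨i | i⟩ := h.nonempty <;> exact i.pos
  · rintro ⟨hk, h⟩
    have : Nonempty (Fin k ⊕ Fin k) := ⟨Sum.inl ⟨0, hk⟩⟩
    have hr : ∀ v, ∃ i, (coloredGraph σ).Reachable v (Sum.inl i) := by
      rintro (i | j)
      · exact ⟨i, SimpleGraph.Reachable.refl _⟩
      · refine ⟨(σ c₀)⁻¹ j, ?_⟩
        simpa using (coloredGraph_reachable σ c₀ ((σ c₀)⁻¹ j)).symm
    refine ⟨fun u v => ?_⟩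
    obtain ⟨i, hi⟩ := hr u
    obtain ⟨j, hj⟩ := hr v
    exact hi.trans ((h i j : (coloredGraph σ).Reachable _ _).trans hj.symm)

theorem numFaces_eq (σ : Fin m → Equiv.Perm (Fin k)) (c₁ c₂ : Fin m) :
    numFaces σ c₁ c₂ = cycleCount (σ c₁ * (σ c₂)⁻¹) := rfl

theorem numFaces_eq' (σ : Fin m → Equiv.Perm (Fin k)) (c₁ c₂ : Fin m) :
    numFaces σ c₁ c₂ = cycleCount ((σ c₁)⁻¹ * σ c₂) := by
  rw [numFaces_eq, ← cycleCount_inv, mul_inv_rev, inv_inv, cycleCount_mul_comm]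

theorem numFaces_comm (σ : Fin m → Equiv.Perm (Fin k)) (c₁ c₂ : Fin m) :
    numFaces σ c₁ c₂ = numFaces σ c₂ c₁ := by
  rw [numFaces_eq, numFaces_eq, ← cycleCount_inv]
  simp

/-- The effect on components and faces of adding the edges of color `0` to a colored graph. -/
theorem numFaces_withColorZero_le (σ₀ : Equiv.Perm (Fin k)) (σ : Fin m → Equiv.Perm (Fin k))
    (c c' : Fin m) :
    numFaces (withColorZero σ₀ σ) 0 c.succ + numFaces (withColorZero σ₀ σ) 0 c'.succ
        + 2 * numComponents σ
      ≤ k + numFaces σ c c' + 2 * numComponents (withColorZero σ₀ σ) := by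
  have e0 : withColorZero σ₀ σ 0 = σ₀ := rfl
  have es : ∀ d : Fin m, withColorZero σ₀ σ d.succ = σ d := fun d => rfl
  rw [numFaces_comm _ 0 c.succ, numFaces_eq', numFaces_eq', numFaces_comm σ, numFaces_eq',
    numComponents_eq σ c, numComponents_eq _ 0, e0, es, es]
  set S := whiteSetoid σ
  -- The product `(σ c')⁻¹ σ_c · σ_c⁻¹ σ₀ · σ₀⁻¹ σ_c'` is the identity, with `k` cycles. The
  -- inequality is applied to its two successive multiplications, and the cycle count of the
  -- intermediate product cancels in the sum.
  have h1 := cycleCount_mul_le (p := (σ c')⁻¹ * σ c) (S := S)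
    (sameCycle_le fun z => whiteSetoid_rel σ c' c z) ((σ c)⁻¹ * σ₀)
  have hp : SameCycle.setoid ((σ c')⁻¹ * σ c * ((σ c)⁻¹ * σ₀))
      ≤ S ⊔ SameCycle.setoid ((σ c)⁻¹ * σ₀) := by
    refine sameCycle_le fun z => ?_
    set T := S ⊔ SameCycle.setoid ((σ c)⁻¹ * σ₀)
    have hS : S ≤ T := le_sup_left
    have hq : SameCycle.setoid ((σ c)⁻¹ * σ₀) ≤ T := le_sup_right
    exact T.trans (hq (sameCycle_rel _ z)) (hS (whiteSetoid_rel σ c' c _))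
  have h2 := cycleCount_mul_le hp (σ₀⁻¹ * σ c')
  have e1 : (σ c')⁻¹ * σ c * ((σ c)⁻¹ * σ₀) * (σ₀⁻¹ * σ c') = 1 := by group
  rw [e1, cycleCount_one, Nat.card_fin] at h2
  rw [Nat.card_fin] at h1
  have h3 : numClasses (S ⊔ SameCycle.setoid ((σ c)⁻¹ * σ₀) ⊔ SameCycle.setoid (σ₀⁻¹ * σ c'))
      ≤ numClasses (whiteSetoid (withColorZero σ₀ σ)) := by
    refine numClasses_anti (whiteSetoid_le c.succ fun d z => ?_)
    set T := S ⊔ SameCycle.setoid ((σ c)⁻¹ * σ₀) ⊔ SameCycle.setoid (σ₀⁻¹ * σ c')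
    have hS : S ≤ T := le_sup_left.trans le_sup_left
    have hq : SameCycle.setoid ((σ c)⁻¹ * σ₀) ≤ T := le_sup_right.trans le_sup_left
    refine Fin.cases ?_ (fun d => ?_) d
    · exact hq (sameCycle_rel _ z)
    · exact hS (whiteSetoid_rel σ c d z)
  omega

end Graph

open Equiv.Perm

/-! ### The degree in terms of faces and components -/

/-- The cyclic permutations of `m` colors. -/
def cyclicPerms (m : ℕ) : Finset (Equiv.Perm (Fin m)) :=
  Finset.univ.filter fun π => π.IsCycle ∧ π.support = Finset.univ

theorem mem_cyclicPerms {m : ℕ} {π : Equiv.Perm (Fin m)} :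
    π ∈ cyclicPerms m ↔ π.IsCycle ∧ π.support = Finset.univ := by
  simp [cyclicPerms]

theorem card_cyclicPerms (n : ℕ) : (cyclicPerms (n + 2)).card = (n + 1).factorial := by
  have h := Equiv.Perm.card_of_cycleType_singleton (α := Fin (n + 2)) (n := n + 2) (by omega)
    (by simp)
  rw [Fintype.card_fin, Nat.choose_self, mul_one, Nat.add_sub_cancel_left (n := n + 1) (m := 1) |>
    fun _ => show n + 2 - 1 = n + 1 by omega] at h
  rw [← h]
  congr 1
  ext π
  rw [mem_cyclicPerms, Finset.mem_filter]
  constructor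
  · rintro ⟨h1, h2⟩
    exact ⟨Finset.mem_univ _, by rw [h1.cycleType, h2]; simp⟩
  · rintro ⟨-, h⟩
    refine ⟨card_cycleType_eq_one.mp (by rw [h]; simp), ?_⟩
    rw [← Finset.card_eq_iff_eq_univ, ← sum_cycleType, h]
    simp

/-- Conjugation by the transposition of `c'` and `d`, which fixes `c`, exchanges the fibers `π c =
c'` and `π c = d`. The `n + 1` possible values thus share the `(n + 1)!` cyclic permutations
equally. -/
theorem card_cyclicPerms_apply (n : ℕ) {c c' : Fin (n + 2)} (h : c' ≠ c) :
    ((cyclicPerms (n + 2)).filter fun π => π c = c').card = n.factorial := by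
  have hconst : ∀ d ∈ Finset.univ.erase c,
      ((cyclicPerms (n + 2)).filter fun π => π c = d).card
        = ((cyclicPerms (n + 2)).filter fun π => π c = c').card := by
    intro d hd
    have hd : d ≠ c := (Finset.mem_erase.mp hd).1
    set s := Equiv.swap c' d with hs
    have hsc : s c = c := Equiv.swap_apply_of_ne_of_ne h.symm hd.symm
    have hconj : ∀ π ∈ cyclicPerms (n + 2), s * π * s⁻¹ ∈ cyclicPerms (n + 2) := by
      intro π hπ
      rw [mem_cyclicPerms] at hπ ⊢
      refine ⟨hπ.1.conj, ?_⟩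
      rw [support_conj, hπ.2]
      simp
    have hinv : s⁻¹ = s := Equiv.swap_inv _ _
    refine Finset.card_bij' (fun π _ => s * π * s⁻¹) (fun π _ => s * π * s⁻¹) ?_ ?_ ?_ ?_
    · intro π hπ
      rw [Finset.mem_filter] at hπ ⊢
      refine ⟨hconj π hπ.1, ?_⟩
      rw [hinv, mul_apply, mul_apply, hsc, hπ.2, hs, Equiv.swap_apply_right]
    · intro π hπ
      rw [Finset.mem_filter] at hπ ⊢
      refine ⟨hconj π hπ.1, ?_⟩
      rw [hinv, mul_apply, mul_apply, hsc, hπ.2, hs, Equiv.swap_apply_left]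
    · intro π _
      rw [hinv]
      simp [← mul_assoc, hs]
    · intro π _
      rw [hinv]
      simp [← mul_assoc, hs]
  have hsum := Finset.card_eq_sum_card_fiberwise (f := fun π : Equiv.Perm (Fin (n + 2)) => π c)
    (s := cyclicPerms (n + 2)) (t := Finset.univ.erase c) (by
      intro π hπ
      have hπ := mem_cyclicPerms.mp hπ
      have : c ∈ π.support := by rw [hπ.2]; exact Finset.mem_univ c
      simpa using mem_support.mp this)
  rw [card_cyclicPerms, Finset.sum_congr rfl hconst, Finset.sum_const,
    Finset.card_erase_of_mem (Finset.mem_univ c), Finset.card_univ, Fintype.card_fin, smul_eq_mul,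
    show n + 2 - 1 = n + 1 by omega, Nat.factorial_succ] at hsum
  exact (Nat.eq_of_mul_eq_mul_left (Nat.succ_pos n) hsum).symm

variable {k : ℕ}

theorem numFaces_self {m : ℕ} (σ : Fin m → Equiv.Perm (Fin k)) (c : Fin m) :
    numFaces σ c c = k := by
  rw [numFaces_eq, mul_inv_cancel, cycleCount_one, Nat.card_fin]

/-- The sum of the numbers of faces over all ordered pairs of colors. -/
def totalFaces {m : ℕ} (σ : Fin m → Equiv.Perm (Fin k)) : ℚ :=
  ∑ c, ∑ c', (numFaces σ c c' : ℚ)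

/-- Each ordered pair of distinct colors is consecutive in `n!` of the jackets. The subtracted `(n +
2) * k` is the diagonal part of `totalFaces`. -/
theorem degree_eq {n : ℕ} (σ : Fin (n + 2) → Equiv.Perm (Fin k)) :
    degree σ = 1 / 2 * (((n + 1).factorial : ℚ) * (numComponents σ + n * k / 2)
      - 1 / 2 * n.factorial * (totalFaces σ - (n + 2) * k)) := by
  have h1 : degree σ = 1 / 2 * ∑ π ∈ cyclicPerms (n + 2), jacketGenus σ π := rfl
  have h2 : ∑ π ∈ cyclicPerms (n + 2), ∑ c, (numFaces σ c (π c) : ℚ)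
      = n.factorial * (totalFaces σ - (n + 2) * k) := by
    rw [Finset.sum_comm]
    have h3 : ∀ c, ∑ π ∈ cyclicPerms (n + 2), (numFaces σ c (π c) : ℚ)
        = n.factorial * (∑ c', (numFaces σ c c' : ℚ) - k) := by
      intro c
      rw [← Finset.sum_fiberwise_of_maps_to (s := cyclicPerms (n + 2))
        (t := Finset.univ.erase c) (g := fun π : Equiv.Perm (Fin (n + 2)) => π c) (by
          intro π hπ
          have hπ := mem_cyclicPerms.mp hπ
          have : c ∈ π.support := by rw [hπ.2]; exact Finset.mem_univ c
          simpa using mem_support.mp this)]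
      have h4 : ∀ c' ∈ Finset.univ.erase c,
          ∑ π ∈ (cyclicPerms (n + 2)).filter fun π => π c = c', (numFaces σ c (π c) : ℚ)
            = n.factorial * numFaces σ c c' := by
        intro c' hc'
        rw [← card_cyclicPerms_apply n (Finset.mem_erase.mp hc').1, ← nsmul_eq_mul,
          ← Finset.sum_const]
        refine Finset.sum_congr rfl fun π hπ => ?_
        rw [(Finset.mem_filter.mp hπ).2]
      rw [Finset.sum_congr rfl h4, ← Finset.mul_sum,
        Finset.sum_erase_eq_sub (Finset.mem_univ c), numFaces_self]
    rw [Finset.sum_congr rfl fun c _ => h3 c, ← Finset.mul_sum, Finset.sum_sub_distrib, totalFaces]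
    simp
  rw [h1]
  have h5 : ∀ π, jacketGenus σ π = (numComponents σ + n * k / 2)
      - 1 / 2 * ∑ c, (numFaces σ c (π c) : ℚ) := by
    intro π
    rw [jacketGenus]
    push_cast
    ring
  rw [Finset.sum_congr rfl fun π _ => h5 π, Finset.sum_sub_distrib, ← Finset.mul_sum, h2,
    Finset.sum_const, card_cyclicPerms, nsmul_eq_mul]
  ring

theorem totalFaces_withColorZero {m : ℕ} (σ₀ : Equiv.Perm (Fin k))
    (σ : Fin m → Equiv.Perm (Fin k)) :
    totalFaces (withColorZero σ₀ σ)
      = totalFaces σ + 2 * ∑ c : Fin m, (numFaces (withColorZero σ₀ σ) 0 c.succ : ℚ) + k := by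
  rw [totalFaces, Fin.sum_univ_succ]
  simp only [Fin.sum_univ_succ, numFaces_self, numFaces_comm _ (Fin.succ _) 0]
  rw [Finset.sum_add_distrib]
  have : ∀ c c' : Fin m, numFaces (withColorZero σ₀ σ) c.succ c'.succ = numFaces σ c c' :=
    fun c c' => rfl
  simp only [this, totalFaces]
  ring

/-- The inequality of `numFaces_withColorZero_le` is summed over the `(n + 2)(n + 1)` ordered pairs
of distinct colors; each `F^{0c}` occurs `2(n + 1)` times. -/
theorem sum_numFaces_withColorZero_le {n : ℕ} (σ₀ : Equiv.Perm (Fin k))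
    (σ : Fin (n + 2) → Equiv.Perm (Fin k)) :
    2 * (n + 1) * ∑ c : Fin (n + 2), (numFaces (withColorZero σ₀ σ) 0 c.succ : ℚ)
      ≤ (n + 2) * (n + 1) * (k + 2 * numComponents (withColorZero σ₀ σ) - 2 * numComponents σ)
        + (totalFaces σ - (n + 2) * k) := by
  have h : ∀ c c' : Fin (n + 2), (numFaces (withColorZero σ₀ σ) 0 c.succ : ℚ)
      + numFaces (withColorZero σ₀ σ) 0 c'.succ
      ≤ (k + 2 * numComponents (withColorZero σ₀ σ) - 2 * numComponents σ) + numFaces σ c c' := by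
    intro c c'
    have := numFaces_withColorZero_le σ₀ σ c c'
    have : ((numFaces (withColorZero σ₀ σ) 0 c.succ + numFaces (withColorZero σ₀ σ) 0 c'.succ
        + 2 * numComponents σ : ℕ) : ℚ)
      ≤ ((k + numFaces σ c c' + 2 * numComponents (withColorZero σ₀ σ) : ℕ) : ℚ) := by
      exact_mod_cast this
    push_cast at this
    linarith
  have hs := Finset.sum_le_sum fun (c : Fin (n + 2)) (_ : c ∈ Finset.univ) =>
    Finset.sum_le_sum fun (c' : Fin (n + 2)) (_ : c' ∈ Finset.univ.erase c) => h c c'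
  simp only [Finset.sum_add_distrib, Finset.sum_const, Finset.sum_erase_eq_sub (Finset.mem_univ _),
    Finset.card_univ, Fintype.card_fin,
    Finset.sum_sub_distrib, numFaces_self, nsmul_eq_mul, ← Finset.mul_sum] at hs
  push_cast at hs
  rw [totalFaces]
  linarith

/-- Once both degrees are written through faces and components, this is a positive multiple of the
summed face inequality. -/
theorem mul_degree_le {n : ℕ} (σ₀ : Equiv.Perm (Fin k)) (σ : Fin (n + 2) → Equiv.Perm (Fin k)) :
    ((n : ℚ) + 2) * degree σ ≤ degree (withColorZero σ₀ σ) := by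
  rw [degree_eq, degree_eq (n := n + 1), totalFaces_withColorZero]
  have h := sum_numFaces_withColorZero_le σ₀ σ
  set B := ∑ c : Fin (n + 2), (numFaces (withColorZero σ₀ σ) 0 c.succ : ℚ)
  have hf : (0 : ℚ) < n.factorial := by exact_mod_cast n.factorial_pos
  rw [Nat.factorial_succ (n + 1), Nat.factorial_succ n]
  push_cast
  have := mul_le_mul_of_nonneg_left h hf.le
  linarith

/-- With two colors the only jacket has genus `C - F^{01}`, and distinct components contain distinct
faces and are no finer than them: the white vertices of a component lie in a single face. -/
theorem degree_nonneg_two (σ : Fin 2 → Equiv.Perm (Fin k)) : 0 ≤ degree σ := by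
  rw [degree_eq (n := 0)]
  have hA : totalFaces σ = 2 * k + 2 * numFaces σ 0 1 := by
    rw [totalFaces]
    simp only [Fin.sum_univ_two, numFaces_self, numFaces_comm σ 1 0]
    ring
  have hF : (numFaces σ 0 1 : ℚ) ≤ numComponents σ := by
    rw [numComponents_eq σ 0, numFaces_eq']
    have : numClasses (SameCycle.setoid ((σ 0)⁻¹ * σ 1)) ≤ numClasses (whiteSetoid σ) := by
      refine numClasses_anti (whiteSetoid_le 0 fun c i => ?_)
      fin_cases c
      · simp
      · exact sameCycle_rel ((σ 0)⁻¹ * σ 1) i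
    exact_mod_cast this
  rw [hA]
  simp
  exact_mod_cast hF

/-- Removing color `0` bounds the degree below by a positive multiple of a degree with one color
less. -/
theorem degree_nonneg : ∀ {n : ℕ} (σ : Fin (n + 2) → Equiv.Perm (Fin k)), 0 ≤ degree σ
  | 0, σ => degree_nonneg_two σ
  | n + 1, σ => by
    have h := mul_degree_le (σ 0) (Fin.tail σ)
    rw [show withColorZero (σ 0) (Fin.tail σ) = σ from Fin.cons_self_tail σ] at h
    exact le_trans (mul_nonneg (by positivity) (degree_nonneg (Fin.tail σ))) h

/-- The number of faces containing the color `0`, in terms of degrees and components. -/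
theorem sum_numFaces_eq {n : ℕ} (σ₀ : Equiv.Perm (Fin k)) (σ : Fin (n + 2) → Equiv.Perm (Fin k)) :
    ∑ c : Fin (n + 2), (numFaces (withColorZero σ₀ σ) 0 c.succ : ℚ)
      = (n + 1) * k + ((n + 2) * numComponents (withColorZero σ₀ σ) - (n + 1) * numComponents σ
        - 2 / ((n + 2).factorial : ℚ) * degree (withColorZero σ₀ σ)
        - 2 / (((n : ℚ) + 2) * (n.factorial : ℚ))
          * (degree (withColorZero σ₀ σ) - (n + 2) * degree σ)) := by
  have hf : (n.factorial : ℚ) ≠ 0 := by exact_mod_cast n.factorial_ne_zero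
  have h1 : (n : ℚ) + 1 ≠ 0 := by positivity
  have h2 : (n : ℚ) + 2 ≠ 0 := by positivity
  rw [degree_eq σ, degree_eq (n := n + 1), totalFaces_withColorZero]
  set B := ∑ c : Fin (n + 2), (numFaces (withColorZero σ₀ σ) 0 c.succ : ℚ)
  rw [show (n + 1 + 1).factorial = (n + 2).factorial from rfl, Nat.factorial_succ (n + 1), Nat.factorial_succ n]
  push_cast
  field_simp
  ring

theorem numComponents_eq_one {m : ℕ} {σ : Fin m → Equiv.Perm (Fin k)}
    (h : (coloredGraph σ).Connected) : numComponents σ = 1 := by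
  have := h.nonempty
  have := h.preconnected.subsingleton_connectedComponent
  exact Nat.card_eq_one_iff_unique.mpr ⟨this, ⟨(coloredGraph σ).connectedComponentMk
    h.nonempty.some⟩⟩

theorem one_le_numComponents {m : ℕ} (σ : Fin m → Equiv.Perm (Fin k)) (hk : 1 ≤ k) :
    1 ≤ numComponents σ := by
  have : Nonempty (coloredGraph σ).ConnectedComponent :=
    ⟨(coloredGraph σ).connectedComponentMk (Sum.inl ⟨0, hk⟩)⟩
  exact Nat.card_pos

theorem connected_withColorZero {m : ℕ} {σ₀ : Equiv.Perm (Fin k)}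
    {σ : Fin m → Equiv.Perm (Fin k)} (h : (coloredGraph σ).Connected) :
    (coloredGraph (withColorZero σ₀ σ)).Connected := by
  refine h.mono ?_
  intro x y hxy
  rw [coloredGraph, SimpleGraph.fromRel_adj] at hxy ⊢
  refine ⟨hxy.1, hxy.2.imp ?_ ?_⟩ <;> exact fun ⟨c, i, hi⟩ => ⟨c.succ, i, hi⟩

theorem rpow_quenchedExponent {D N : ℕ} (hD : 2 ≤ D) (hN : 1 ≤ N) (σ₀ : Equiv.Perm (Fin k))
    (σ : Fin D → Equiv.Perm (Fin k)) (h : (coloredGraph σ).Connected) :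
    (N : ℝ) ^ ((quenchedExponent σ₀ σ : ℚ) : ℝ) = (((N : ℝ) ^ (D - 1)) ^ k)⁻¹
      * ∏ c : Fin D, (N : ℝ) ^ numFaces (withColorZero σ₀ σ) 0 c.succ := by
  obtain ⟨n, rfl⟩ := Nat.exists_eq_add_of_le' hD
  have hN' : (0 : ℝ) < N := by exact_mod_cast hN
  have hs := sum_numFaces_eq σ₀ σ
  rw [numComponents_eq_one h, numComponents_eq_one (connected_withColorZero h)] at hs
  -- Connectedness of `σ` also gives connectedness with color `0`, so the components contribute `(n
  -- + 2) - (n + 1) = 1`.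
  have he : quenchedExponent σ₀ σ
      = ∑ c : Fin (n + 2), (numFaces (withColorZero σ₀ σ) 0 c.succ : ℚ) - (n + 1) * k := by
    rw [hs, quenchedExponent, show n + 2 - 2 = n by omega]
    push_cast
    ring
  rw [he, Finset.prod_pow_eq_pow_sum, ← pow_mul, show n + 2 - 1 = n + 1 by omega]
  push_cast
  rw [Real.rpow_sub hN', inv_mul_eq_div]
  congr 1
  · rw [← Real.rpow_natCast]; push_cast; rfl
  · rw [← Real.rpow_natCast]; push_cast; rfl

theorem rpow_annealedExponent {D N : ℕ} (hD : 2 ≤ D) (hN : 1 ≤ N) (σ₀ : Equiv.Perm (Fin k))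
    (σ : Fin D → Equiv.Perm (Fin k)) (h : (coloredGraph (withColorZero σ₀ σ)).Connected) :
    (N : ℝ) ^ ((annealedExponent σ₀ σ : ℚ) : ℝ) = (((N : ℝ) ^ (D - 1)) ^ k)⁻¹
      * ∏ c : Fin D, (N : ℝ) ^ numFaces (withColorZero σ₀ σ) 0 c.succ := by
  obtain ⟨n, rfl⟩ := Nat.exists_eq_add_of_le' hD
  have hN' : (0 : ℝ) < N := by exact_mod_cast hN
  have hs := sum_numFaces_eq σ₀ σ
  rw [numComponents_eq_one h] at hs
  -- Here only the full graph is connected: `(n + 2) - (n + 1) C = 1 - (n + 1)(C - 1)` produces the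
  -- extra term of the annealed exponent.
  have he : annealedExponent σ₀ σ
      = ∑ c : Fin (n + 2), (numFaces (withColorZero σ₀ σ) 0 c.succ : ℚ) - (n + 1) * k := by
    rw [hs, annealedExponent, show n + 2 - 2 = n by omega]
    push_cast
    ring
  rw [he, Finset.prod_pow_eq_pow_sum, ← pow_mul, show n + 2 - 1 = n + 1 by omega]
  push_cast
  rw [Real.rpow_sub hN', inv_mul_eq_div]
  congr 1
  · rw [← Real.rpow_natCast]; push_cast; rfl
  · rw [← Real.rpow_natCast]; push_cast; rfl

theorem degree_bounds {D : ℕ} (hD : 2 ≤ D) (hk : 1 ≤ k) (σ₀ : Equiv.Perm (Fin k))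
    (σ : Fin D → Equiv.Perm (Fin k)) :
    0 ≤ degree σ ∧ 0 ≤ degree (withColorZero σ₀ σ) ∧
      (D : ℚ) * degree σ ≤ degree (withColorZero σ₀ σ) ∧
      quenchedExponent σ₀ σ ≤ 1 ∧ annealedExponent σ₀ σ ≤ 1 := by
  obtain ⟨n, rfl⟩ := Nat.exists_eq_add_of_le' hD
  have h1 := degree_nonneg σ
  have h2 : 0 ≤ degree (withColorZero σ₀ σ) := degree_nonneg (n := n + 1) _
  have h3 : ((n + 2 : ℕ) : ℚ) * degree σ ≤ degree (withColorZero σ₀ σ) := by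
    have := mul_degree_le σ₀ σ
    push_cast
    exact this
  have h4 : 0 ≤ 2 / ((n + 2).factorial : ℚ) * degree (withColorZero σ₀ σ) :=
    mul_nonneg (by positivity) h2
  have h5 : 0 ≤ 2 / (((n + 2 : ℕ) : ℚ) * ((n + 2 - 2).factorial : ℚ))
      * (degree (withColorZero σ₀ σ) - (n + 2 : ℕ) * degree σ) :=
    mul_nonneg (by positivity) (sub_nonneg.mpr h3)
  have h6 : 0 ≤ (((n + 2 : ℕ) : ℚ) - 1) * ((numComponents σ : ℚ) - 1) := by
    have : (1 : ℚ) ≤ numComponents σ := by exact_mod_cast one_le_numComponents σ hk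
    refine mul_nonneg ?_ (by linarith)
    push_cast
    linarith [Nat.cast_nonneg (α := ℚ) n]
  refine ⟨h1, h2, h3, ?_, ?_⟩
  · rw [quenchedExponent]; linarith
  · rw [annealedExponent]; linarith

/-! ### The formal logarithm -/

theorem coeff_formalLog {A : Type} [Ring A] [Algebra ℂ A] (Z : MvPowerSeries (Fin 2) A)
    (d : Fin 2 →₀ ℕ) :
    MvPowerSeries.coeff d (formalLog Z) = ∑ m ∈ Finset.Icc 1 (d 0 + d 1),
      ((-1 : ℂ) ^ (m + 1) / (m : ℂ)) • MvPowerSeries.coeff d ((Z - 1) ^ m) := rfl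

section FormalLog

variable {E : Type} [CommRing E] [Algebra ℂ E]

/-- The Euler operator, multiplying the coefficients by their total degree, as a derivation. -/
def euler : Derivation E (MvPowerSeries (Fin 2) E) (MvPowerSeries (Fin 2) E) :=
  Derivation.mk'
    { toFun := fun f d => ((d 0 + d 1 : ℕ) : E) * MvPowerSeries.coeff d f
      map_add' := fun f g => by
        ext d
        exact mul_add _ _ _
      map_smul' := fun a f => by
        ext d
        exact mul_left_comm _ _ _ }
    (by
      intro f g
      ext d
      change ((d 0 + d 1 : ℕ) : E) * MvPowerSeries.coeff d (f * g)
        = MvPowerSeries.coeff d (f * _) + MvPowerSeries.coeff d (g * _)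
      rw [mul_comm g, MvPowerSeries.coeff_mul, MvPowerSeries.coeff_mul, MvPowerSeries.coeff_mul,
        Finset.mul_sum, ← Finset.sum_add_distrib]
      refine Finset.sum_congr rfl fun p hp => ?_
      rw [← Finset.HasAntidiagonal.mem_antidiagonal.mp hp]
      change ((p.1 0 + p.2 0 + (p.1 1 + p.2 1) : ℕ) : E) * (MvPowerSeries.coeff p.1 f * MvPowerSeries.coeff p.2 g)
        = MvPowerSeries.coeff p.1 f * (((p.2 0 + p.2 1 : ℕ) : E) * MvPowerSeries.coeff p.2 g)
          + (((p.1 0 + p.1 1 : ℕ) : E) * MvPowerSeries.coeff p.1 f) * MvPowerSeries.coeff p.2 g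
      push_cast
      ring)

theorem coeff_euler (f : MvPowerSeries (Fin 2) E) (d : Fin 2 →₀ ℕ) :
    MvPowerSeries.coeff d (euler f) = ((d 0 + d 1 : ℕ) : E) * MvPowerSeries.coeff d f := rfl

/-- The partial sums of the logarithmic series. -/
def logPartialSum (M : ℕ) (f : MvPowerSeries (Fin 2) E) : MvPowerSeries (Fin 2) E :=
  ∑ m ∈ Finset.Icc 1 M, ((-1 : ℂ) ^ (m + 1) / (m : ℂ)) • f ^ m

theorem degree_fin_two (d : Fin 2 →₀ ℕ) : Finsupp.degree d = d 0 + d 1 := by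
  rw [Finsupp.degree_eq_sum, Fin.sum_univ_two]

theorem coeff_pow_of_lt {f : MvPowerSeries (Fin 2) E} (hf : f.constantCoeff = 0) {m : ℕ}
    {d : Fin 2 →₀ ℕ} (h : d 0 + d 1 < m) : MvPowerSeries.coeff d (f ^ m) = 0 := by
  refine MvPowerSeries.coeff_of_lt_order ?_
  refine lt_of_lt_of_le ?_ (MvPowerSeries.le_order_pow_of_constantCoeff_eq_zero m hf)
  rw [degree_fin_two]
  exact_mod_cast h

/-- Without constant term, `f ^ m` starts in total degree `m`, so terms beyond the degree of the
monomial do not matter and the cutoff may be taken independent of it. -/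
theorem coeff_logPartialSum {f : MvPowerSeries (Fin 2) E} (hf : f.constantCoeff = 0) {M : ℕ}
    {d : Fin 2 →₀ ℕ} (h : d 0 + d 1 ≤ M) :
    MvPowerSeries.coeff d (logPartialSum M f) = MvPowerSeries.coeff d (formalLog (1 + f)) := by
  rw [coeff_formalLog, logPartialSum, map_sum]
  symm
  refine (Finset.sum_subset (Finset.Icc_subset_Icc_right h) fun m hm hm' => ?_).trans ?_
  · rw [add_sub_cancel_left, coeff_pow_of_lt hf, smul_zero]
    simp only [Finset.mem_Icc] at hm hm'
    omega
  · refine Finset.sum_congr rfl fun m _ => ?_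
    rw [add_sub_cancel_left]
    rfl

/-- Applying the derivation to the logarithmic sum leaves a geometric sum in `-f`, which telescopes
against `1 + f`. -/
theorem mul_euler_logPartialSum (M : ℕ) (f : MvPowerSeries (Fin 2) E) :
    (1 + f) * euler (logPartialSum M f) = euler f * (1 - (-f) ^ M) := by
  induction M with
  | zero => simp [logPartialSum]
  | succ M ih =>
    have h1 : logPartialSum (M + 1) f = logPartialSum M f
        + ((-1 : ℂ) ^ (M + 1 + 1) / ((M + 1 : ℕ) : ℂ)) • f ^ (M + 1) := by
      rw [logPartialSum, Finset.sum_Icc_succ_top (by omega)]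
      rfl
    have h2 : euler (((-1 : ℂ) ^ (M + 1 + 1) / ((M + 1 : ℕ) : ℂ)) • f ^ (M + 1))
        = (-f) ^ M * euler f := by
      have hM : ((M + 1 : ℕ) : ℂ) ≠ 0 := by exact_mod_cast Nat.succ_ne_zero M
      have h3 : euler (((-1 : ℂ) ^ (M + 1 + 1) / ((M + 1 : ℕ) : ℂ)) • f ^ (M + 1))
          = ((-1 : ℂ) ^ (M + 1 + 1) / ((M + 1 : ℕ) : ℂ)) • euler (f ^ (M + 1)) := by
        ext d
        exact mul_smul_comm _ _ _
      rw [h3, Derivation.leibniz_pow, ← Nat.cast_smul_eq_nsmul ℂ, smul_smul,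
        div_mul_cancel₀ _ hM, Nat.add_sub_cancel, smul_eq_mul, neg_pow f M, ← smul_mul_assoc]
      congr 1
      rw [pow_add, pow_add]
      rcases Nat.even_or_odd M with hM' | hM' <;> simp [hM'.neg_one_pow]
    rw [h1, map_add, mul_add, ih, h2, pow_succ]
    ring

theorem mul_euler_formalLog {f : MvPowerSeries (Fin 2) E} (hf : f.constantCoeff = 0) :
    (1 + f) * euler (formalLog (1 + f)) = euler f := by
  ext d
  set M := d 0 + d 1
  have h1 : MvPowerSeries.coeff d ((1 + f) * euler (formalLog (1 + f)))
      = MvPowerSeries.coeff d ((1 + f) * euler (logPartialSum M f)) := by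
    rw [MvPowerSeries.coeff_mul, MvPowerSeries.coeff_mul]
    refine Finset.sum_congr rfl fun p hp => ?_
    have hp := Finset.HasAntidiagonal.mem_antidiagonal.mp hp
    rw [coeff_euler, coeff_euler, coeff_logPartialSum hf]
    simp only [M, ← hp, Finsupp.add_apply]
    omega
  rw [h1, mul_euler_logPartialSum, mul_sub, mul_one, map_sub, sub_eq_self, MvPowerSeries.coeff_mul]
  refine Finset.sum_eq_zero fun p hp => ?_
  have hp := Finset.HasAntidiagonal.mem_antidiagonal.mp hp
  by_cases h0 : p.1 0 + p.1 1 = 0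
  · rw [coeff_euler, h0]
    simp
  · have hneg : (-f).constantCoeff = 0 := by rw [map_neg, hf, neg_zero]
    rw [coeff_pow_of_lt hneg, mul_zero]
    simp only [M, ← hp, Finsupp.add_apply]
    omega

/-- The logarithmic derivative determines the logarithm: `Z` is invertible, and the Euler operator
is injective on series without constant term because positive integers are units in a `ℂ`-algebra.
This avoids any manipulation of exponentials. -/
theorem formalLog_unique {Z L : MvPowerSeries (Fin 2) E} (hZ : Z.constantCoeff = 1)
    (hL : L.constantCoeff = 0) (h : Z * euler L = euler Z) : formalLog Z = L := by
  set f := Z - 1 with hf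
  have hf0 : f.constantCoeff = 0 := by rw [hf, map_sub, hZ, map_one, sub_self]
  have hZf : Z = 1 + f := by rw [hf]; ring
  have h1 := mul_euler_formalLog hf0
  rw [← hZf] at h1
  have h2 : euler f = euler Z := by rw [hZf, map_add, Derivation.map_one_eq_zero, zero_add]
  have hu : IsUnit Z := MvPowerSeries.isUnit_iff_constantCoeff.mpr (by rw [hZ]; exact isUnit_one)
  have h3 : euler (formalLog Z) = euler L := hu.mul_left_cancel (by rw [h1, h2, h])
  ext d
  by_cases hd : d 0 + d 1 = 0
  · have hd0 : d = 0 := by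
      ext i
      fin_cases i
      · change d 0 = 0; omega
      · change d 1 = 0; omega
    subst hd0
    have : MvPowerSeries.coeff 0 (formalLog Z) = 0 := by
      rw [coeff_formalLog]
      simp
    rw [this]
    exact hL.symm
  · have h4 := congrArg (MvPowerSeries.coeff d) h3
    rw [coeff_euler, coeff_euler] at h4
    have hu : IsUnit ((d 0 + d 1 : ℕ) : E) := by
      have : IsUnit ((d 0 + d 1 : ℕ) : ℂ) := (Nat.cast_ne_zero.mpr hd).isUnit
      simpa using this.map (algebraMap ℂ E)
    exact hu.mul_left_cancel h4

/-- The power series `∑_k (J J̄)^k u k`. -/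
def diagSeries {R : Type} [Zero R] (u : ℕ → R) : MvPowerSeries (Fin 2) R :=
  fun d => if d 0 = d 1 then u (d 0) else 0

theorem coeff_diagSeries {R : Type} [Semiring R] (u : ℕ → R) (d : Fin 2 →₀ ℕ) :
    MvPowerSeries.coeff d (diagSeries u) = if d 0 = d 1 then u (d 0) else 0 := rfl

theorem diagSeries_mul (u v : ℕ → E) :
    diagSeries u * diagSeries v
      = diagSeries fun k => ∑ p ∈ Finset.HasAntidiagonal.antidiagonal k, u p.1 * v p.2 := by
  ext d
  rw [MvPowerSeries.coeff_mul, coeff_diagSeries]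
  simp only [coeff_diagSeries]
  split_ifs with hd
  · let pt : ℕ → Fin 2 →₀ ℕ := fun i => Finsupp.equivFunOnFinite.symm fun _ => i
    have hpt : ∀ i j, pt i j = i := fun i j => rfl
    symm
    refine Finset.sum_of_injOn (fun q : ℕ × ℕ => (pt q.1, pt q.2)) ?_ ?_ ?_ ?_
    · rintro ⟨a, b⟩ _ ⟨a', b'⟩ _ h
      simp only [Prod.mk.injEq] at h
      have h1 := DFunLike.congr_fun h.1 0
      have h2 := DFunLike.congr_fun h.2 0
      simp only [hpt] at h1 h2
      rw [h1, h2]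
    · rintro ⟨a, b⟩ h
      simp only [Finset.mem_coe, Finset.HasAntidiagonal.mem_antidiagonal] at h ⊢
      ext j
      fin_cases j
      · exact h
      · exact h.trans hd
    · rintro ⟨p, q⟩ h h'
      dsimp only
      by_cases hp : p 0 = p 1
      · by_cases hq : q 0 = q 1
        · refine absurd ⟨(p 0, q 0), ?_, ?_⟩ h'
          · simp only [Finset.mem_coe, Finset.HasAntidiagonal.mem_antidiagonal] at h ⊢
            rw [← h]
            rfl
          · have : ∀ r : Fin 2 →₀ ℕ, r 0 = r 1 → pt (r 0) = r := by
              intro r hr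
              ext j
              fin_cases j
              · rfl
              · exact hr
            simp only [this p hp, this q hq]
        · rw [if_neg hq, mul_zero]
      · rw [if_neg hp, zero_mul]
    · rintro ⟨a, b⟩ _
      simp [hpt]
  · refine Finset.sum_eq_zero ?_
    rintro ⟨p, q⟩ h
    rw [Finset.HasAntidiagonal.mem_antidiagonal] at h
    have h0 : d 0 = p 0 + q 0 := by rw [← h]; rfl
    have h1 : d 1 = p 1 + q 1 := by rw [← h]; rfl
    dsimp only
    by_cases hp : p 0 = p 1
    · have hq : q 0 ≠ q 1 := by omega
      rw [if_neg hq, mul_zero]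
    · rw [if_neg hp, zero_mul]

theorem euler_diagSeries (u : ℕ → E) :
    euler (diagSeries u) = diagSeries fun k => (2 * k : E) * u k := by
  ext d
  rw [coeff_euler, coeff_diagSeries, coeff_diagSeries]
  split_ifs with hd
  · rw [← hd]
    push_cast
    ring
  · rw [mul_zero]

/-- The hypothesis is the coefficient form of `Z · euler L = euler Z`. The Euler operator multiplies
`(J J̄)^k` by `2 k`, and the factor `2` is common to both sides. -/
theorem formalLog_diagSeries {z w : ℕ → E} (hz : z 0 = 1) (hw : w 0 = 0)
    (h : ∀ k : ℕ, (k : E) * z k = ∑ p ∈ Finset.HasAntidiagonal.antidiagonal k, (p.1 : E) * w p.1 * z p.2) :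
    formalLog (diagSeries z) = diagSeries w := by
  refine formalLog_unique ?_ ?_ ?_
  · exact hz
  · exact hw
  · rw [euler_diagSeries, euler_diagSeries, mul_comm, diagSeries_mul]
    congr 1
    ext k
    rw [mul_assoc, h, Finset.mul_sum]
    refine Finset.sum_congr rfl fun p _ => ?_
    ring

end FormalLog

/-- This transports a logarithm computed in a commutative algebra to a noncommutative one, as needed
for the Grassmann tensor. -/
theorem formalLog_map {E A : Type} [Ring E] [Algebra ℂ E] [Ring A] [Algebra ℂ A] (φ : E →ₐ[ℂ] A)
    (Z : MvPowerSeries (Fin 2) E) :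
    formalLog (MvPowerSeries.map (σ := Fin 2) φ.toRingHom Z)
      = MvPowerSeries.map φ.toRingHom (formalLog Z) := by
  ext d
  change ∑ m ∈ Finset.Icc 1 (d 0 + d 1), _ = φ (∑ m ∈ Finset.Icc 1 (d 0 + d 1), _)
  rw [map_sum]
  refine Finset.sum_congr rfl fun m _ => ?_
  rw [map_smul, ← map_one (MvPowerSeries.map (σ := Fin 2) φ.toRingHom), ← map_sub, ← map_pow]
  rfl

/-! ### The exponential formula for tuples of permutations -/

section Exponential

variable {ι : Type}

/-- The orbits of the group generated by a tuple of permutations. -/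
def orbitSetoid {α : Type} (τ : ι → Equiv.Perm α) : Setoid α :=
  ⨆ c, Equiv.Perm.SameCycle.setoid (τ c)

theorem orbitSetoid_rel {α : Type} (τ : ι → Equiv.Perm α) (c : ι) (x : α) :
    orbitSetoid τ x (τ c x) :=
  le_iSup (fun c => Equiv.Perm.SameCycle.setoid (τ c)) c
    (Equiv.Perm.sameCycle_apply_right.mpr (Equiv.Perm.SameCycle.refl (τ c) x))

theorem orbitSetoid_le {α : Type} [Finite α] {τ : ι → Equiv.Perm α} {T : Setoid α}
    (h : ∀ c x, T x (τ c x)) : orbitSetoid τ ≤ T :=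
  iSup_le fun c => sameCycle_le (h c)

/-- The group generated by a tuple of permutations acts transitively on a nonempty set. -/
def IsTransitive {α : Type} (τ : ι → Equiv.Perm α) : Prop :=
  Nonempty α ∧ ∀ x y, orbitSetoid τ x y

/-- A weight on tuples of permutations of finite sets which is invariant under relabelling and
multiplicative on disjoint unions. -/
structure MultiplicativeWeight (ι E : Type) [CommRing E] where
  /-- the weight of a tuple -/
  toFun : ∀ (α : Type) [Fintype α], (ι → Equiv.Perm α) → E
  map_permCongr : ∀ (α β : Type) [Fintype α] [Fintype β] (e : α ≃ β) (τ : ι → Equiv.Perm α),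
    toFun β (fun c => e.permCongr (τ c)) = toFun α τ
  map_sumCongr : ∀ (α β : Type) [Fintype α] [Fintype β] (τ : ι → Equiv.Perm α)
    (τ' : ι → Equiv.Perm β),
    toFun (α ⊕ β) (fun c => Equiv.Perm.sumCongr (τ c) (τ' c)) = toFun α τ * toFun β τ'

variable {E : Type} [CommRing E] [Fintype ι] (W : MultiplicativeWeight ι E)

namespace MultiplicativeWeight

/-- The sum of the weights of all tuples. -/
def total (α : Type) [Fintype α] : E := ∑ τ : ι → Equiv.Perm α, W.toFun α τ

/-- The sum of the weights of the transitive tuples. -/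
def transitiveTotal (α : Type) [Fintype α] : E :=
  ∑ τ : ι → Equiv.Perm α with IsTransitive τ, W.toFun α τ

/-- Relabelling of tuples of permutations. -/
def relabel {α β : Type} (e : α ≃ β) : (ι → Equiv.Perm α) ≃ (ι → Equiv.Perm β) :=
  Equiv.piCongrRight fun _ => e.permCongr

theorem total_congr {α β : Type} [Fintype α] [Fintype β] (e : α ≃ β) : W.total α = W.total β :=
  Fintype.sum_equiv (relabel e) _ _ fun τ => (W.map_permCongr α β e τ).symm

theorem isTransitive_relabel {α β : Type} [Finite α] (e : α ≃ β) {τ : ι → Equiv.Perm α}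
    (h : IsTransitive τ) : IsTransitive (relabel e τ) := by
  obtain ⟨⟨a⟩, h⟩ := h
  refine ⟨⟨e a⟩, fun x y => ?_⟩
  have hle : orbitSetoid τ ≤ (orbitSetoid (relabel e τ)).comap e := by
    refine orbitSetoid_le fun c x => ?_
    have := orbitSetoid_rel (relabel e τ) c (e x)
    simpa [relabel, Setoid.comap_rel] using this
  have := hle (h (e.symm x) (e.symm y))
  simpa [Setoid.comap_rel] using this

theorem transitiveTotal_congr {α β : Type} [Fintype α] [Fintype β] (e : α ≃ β) :
    W.transitiveTotal α = W.transitiveTotal β := by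
  refine Finset.sum_equiv (relabel e) (fun τ => ?_) fun τ _ => (W.map_permCongr α β e τ).symm
  simp only [Finset.mem_filter, Finset.mem_univ, true_and]
  refine ⟨isTransitive_relabel e, fun h => ?_⟩
  have := isTransitive_relabel e.symm h
  convert this
  ext c x
  simp [relabel]

theorem map_subtypeCongr {α : Type} [Fintype α] (p : α → Prop)
    (τ₁ : ι → Equiv.Perm {x // p x}) (τ₂ : ι → Equiv.Perm {x // ¬p x}) :
    W.toFun α (fun c => Equiv.Perm.subtypeCongr (τ₁ c) (τ₂ c))
      = W.toFun _ τ₁ * W.toFun _ τ₂ := by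
  rw [← W.map_sumCongr, ← W.map_permCongr _ _ (Equiv.sumCompl p)]
  rfl

/-- The kernel of `p` is preserved by the glued tuple, so the orbit of `a` stays inside `p`;
transitivity of `τ₁` makes it fill `p`. -/
theorem orbitSetoid_subtypeCongr {α : Type} [Fintype α] {p : α → Prop}
    {τ₁ : ι → Equiv.Perm {x // p x}} (h : IsTransitive τ₁) (τ₂ : ι → Equiv.Perm {x // ¬p x})
    {a : α} (ha : p a) (x : α) :
    orbitSetoid (fun c => Equiv.Perm.subtypeCongr (τ₁ c) (τ₂ c)) a x ↔ p x := by
  set τ : ι → Equiv.Perm α := fun c => Equiv.Perm.subtypeCongr (τ₁ c) (τ₂ c) with hτ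
  constructor
  · intro hx
    have hle : orbitSetoid τ ≤ Setoid.ker p := by
      refine orbitSetoid_le fun c x => ?_
      rw [Setoid.ker_def, eq_iff_iff]
      by_cases hx : p x
      · simp only [hτ, Equiv.Perm.subtypeCongr.left_apply _ _ hx, hx]
        simp [(τ₁ c ⟨x, hx⟩).2]
      · simp only [hτ, Equiv.Perm.subtypeCongr.right_apply _ _ hx, hx]
        simp [(τ₂ c ⟨x, hx⟩).2]
    have := hle hx
    rw [Setoid.ker_def] at this
    rwa [← this]
  · intro hx
    have hle : orbitSetoid τ₁ ≤ (orbitSetoid τ).comap Subtype.val := by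
      refine orbitSetoid_le fun c x => ?_
      have := orbitSetoid_rel τ c x
      rwa [hτ, Equiv.Perm.subtypeCongr.left_apply_subtype] at this
    exact hle (h.2 ⟨a, ha⟩ ⟨x, hx⟩)

theorem isTransitive_subtypePerm {α : Type} [Fintype α] {τ : ι → Equiv.Perm α} {p : α → Prop}
    {a : α} (ha : p a) (h : ∀ x, orbitSetoid τ a x ↔ p x) (hp : ∀ c x, p (τ c x) ↔ p x) :
    IsTransitive fun c => (τ c).subtypePerm (hp c) := by
  set τ₁ : ι → Equiv.Perm {x // p x} := fun c => (τ c).subtypePerm (hp c) with hτ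
  -- The orbit relation of the restricted tuple is extended to all of `α`, so that minimality of
  -- `orbitSetoid τ` applies to it.
  let T : Setoid α :=
    { r := fun x y => (p x ↔ p y) ∧ ∀ (hx : p x) (hy : p y), orbitSetoid τ₁ ⟨x, hx⟩ ⟨y, hy⟩
      iseqv :=
        { refl := fun x => ⟨Iff.rfl, fun _ _ => (orbitSetoid τ₁).refl _⟩
          symm := fun h => ⟨h.1.symm, fun hx hy => (orbitSetoid τ₁).symm (h.2 hy hx)⟩
          trans := fun h g => ⟨h.1.trans g.1, fun hx hz =>
            (orbitSetoid τ₁).trans (h.2 hx (h.1.mp hx)) (g.2 (h.1.mp hx) hz)⟩ } }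
  have hle : orbitSetoid τ ≤ T := orbitSetoid_le fun c x =>
    ⟨(hp c x).symm, fun hx _ => orbitSetoid_rel τ₁ c ⟨x, hx⟩⟩
  have key : ∀ x : {x // p x}, orbitSetoid τ₁ ⟨a, ha⟩ x := fun x =>
    (hle ((h x).mpr x.2)).2 ha x.2
  exact ⟨⟨⟨a, ha⟩⟩, fun x y => (orbitSetoid τ₁).trans ((orbitSetoid τ₁).symm (key x)) (key y)⟩

/-- The tuples for which the orbit of `a` is prescribed. -/
theorem sum_orbit_eq {α : Type} [Fintype α] (p : α → Prop) {a : α} (ha : p a) :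
    ∑ τ : ι → Equiv.Perm α with ∀ x, orbitSetoid τ a x ↔ p x, W.toFun α τ
      = W.transitiveTotal {x // p x} * W.total {x // ¬p x} := by
  rw [transitiveTotal, total, Finset.sum_mul_sum, ← Finset.sum_product']
  symm
  refine Finset.sum_bij
    (fun q _ => fun c => Equiv.Perm.subtypeCongr (q.1 c) (q.2 c)) ?_ ?_ ?_ ?_
  · rintro ⟨τ₁, τ₂⟩ h
    simp only [Finset.mem_product, Finset.mem_filter, Finset.mem_univ, true_and, and_true] at h ⊢
    exact orbitSetoid_subtypeCongr h τ₂ ha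
  · rintro ⟨τ₁, τ₂⟩ _ ⟨τ₁', τ₂'⟩ _ h
    have h' : ∀ c, (τ₁ c, τ₂ c) = (τ₁' c, τ₂' c) := fun c =>
      Equiv.Perm.subtypeCongrHom_injective p (congrFun h c)
    refine Prod.ext (funext fun c => ?_) (funext fun c => ?_)
    · exact congrArg Prod.fst (h' c)
    · exact congrArg Prod.snd (h' c)
  · intro τ h
    simp only [Finset.mem_filter, Finset.mem_univ, true_and] at h
    have hp : ∀ c x, p (τ c x) ↔ p x := by
      intro c x
      rw [← h, ← h]
      have := orbitSetoid_rel τ c x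
      exact ⟨fun g => (orbitSetoid τ).trans g ((orbitSetoid τ).symm this),
        fun g => (orbitSetoid τ).trans g this⟩
    refine ⟨(fun c => (τ c).subtypePerm (hp c),
      fun c => (τ c).subtypePerm fun x => not_congr (hp c x)), ?_, ?_⟩
    · simp only [Finset.mem_product, Finset.mem_filter, Finset.mem_univ, true_and, and_true]
      exact isTransitive_subtypePerm ha h hp
    · ext c x
      by_cases hx : p x
      · simp [Equiv.Perm.subtypeCongr.left_apply _ _ hx]
      · simp [Equiv.Perm.subtypeCongr.right_apply _ _ hx]
  · rintro ⟨τ₁, τ₂⟩ _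
    exact (W.map_subtypeCongr p τ₁ τ₂).symm

/-- Tuples are classified by the orbit `A` of the marked point: transitive on `A`, arbitrary on the
complement. -/
theorem total_eq_sum_orbit {α : Type} [Fintype α] (a : α) :
    W.total α = ∑ A : Finset α with a ∈ A,
      W.transitiveTotal {x // x ∈ A} * W.total {x // x ∉ A} := by
  rw [total, ← Finset.sum_fiberwise_of_maps_to (t := Finset.univ.filter fun A : Finset α => a ∈ A)
    (g := fun τ => Finset.univ.filter fun x => orbitSetoid τ a x) (by
      intro τ _
      simp)]
  refine Finset.sum_congr rfl fun A hA => ?_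
  refine (Finset.sum_congr ?_ fun _ _ => rfl).trans
    ((W.sum_orbit_eq (fun x => x ∈ A) (Finset.mem_filter.mp hA).2).trans
      (by congr!))
  ext τ
  simp [Finset.ext_iff]

/-- In the sum over marked points, a subset with `m` elements is counted `m` times, once for each of
its points. -/
theorem card_mul_total (α : Type) [Fintype α] :
    (Fintype.card α : E) * W.total α = ∑ m ∈ Finset.range (Fintype.card α + 1),
      ((Fintype.card α).choose m) •
        ((m : E) * W.transitiveTotal (Fin m) * W.total (Fin (Fintype.card α - m))) := by
  have h1 : (Fintype.card α : E) * W.total α = ∑ _a : α, W.total α := by simp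
  rw [h1, Finset.sum_congr rfl fun a _ => W.total_eq_sum_orbit a]
  simp only [Finset.sum_filter]
  rw [Finset.sum_comm]
  have h2 := Finset.sum_powerset_apply_card
    (fun m => (m : E) * W.transitiveTotal (Fin m) * W.total (Fin (Fintype.card α - m)))
    (x := (Finset.univ : Finset α))
  rw [Finset.card_univ, Finset.powerset_univ] at h2
  rw [← h2]
  refine Finset.sum_congr rfl fun A _ => ?_
  rw [Finset.sum_ite_mem, Finset.univ_inter, Finset.sum_const, nsmul_eq_mul, mul_assoc]
  congr 2
  · refine W.transitiveTotal_congr (Fintype.equivFinOfCardEq ?_)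
    simp
  · refine W.total_congr (Fintype.equivFinOfCardEq ?_)
    rw [Fintype.card_subtype_compl]
    simp

/-- The exponential formula: after division by `k!` the binomial coefficients of `card_mul_total`
disappear, and it becomes the recursion characterizing the logarithm. -/
theorem formalLog_total [Algebra ℂ E] (h0 : W.total (Fin 0) = 1) :
    formalLog (diagSeries fun k => (1 / (k.factorial : ℂ)) • W.total (Fin k))
      = diagSeries fun k => (1 / (k.factorial : ℂ)) • W.transitiveTotal (Fin k) := by
  refine formalLog_diagSeries ?_ ?_ fun k => ?_
  · simp [h0]
  · have : W.transitiveTotal (Fin 0) = 0 := by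
      rw [transitiveTotal]
      refine Finset.sum_eq_zero fun τ hτ => ?_
      obtain ⟨a⟩ := (Finset.mem_filter.mp hτ).2.1
      exact a.elim0
    rw [this, smul_zero]
  · have hk := W.card_mul_total (Fin k)
    rw [Fintype.card_fin] at hk
    rw [mul_smul_comm, hk, Finset.Nat.sum_antidiagonal_eq_sum_range_succ_mk,
      Finset.smul_sum]
    refine Finset.sum_congr rfl fun m hm => ?_
    have hm : m ≤ k := Nat.lt_succ_iff.mp (Finset.mem_range.mp hm)
    dsimp only
    rw [mul_smul_comm, mul_smul_comm, smul_mul_assoc, smul_smul, ← Nat.cast_smul_eq_nsmul ℂ,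
      smul_smul]
    congr 1
    rw [Nat.cast_choose ℂ hm]
    have h1 : (k.factorial : ℂ) ≠ 0 := by exact_mod_cast k.factorial_ne_zero
    field_simp

end MultiplicativeWeight

end Exponential

/-! ### Reduction to tuples whose first permutation is the identity -/

section Reduction

variable {n k : ℕ}

/-- A tuple of permutations is determined by its first entry and the quotients by it. -/
def consMulEquiv (n k : ℕ) : Equiv.Perm (Fin k) × (Fin n → Equiv.Perm (Fin k))
    ≃ (Fin (n + 1) → Equiv.Perm (Fin k)) where
  toFun q := Fin.cons q.1 fun c => q.1 * q.2 c
  invFun σ := (σ 0, fun c => (σ 0)⁻¹ * σ c.succ)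
  left_inv q := by
    refine Prod.ext rfl (funext fun c => ?_)
    simp
  right_inv σ := by
    refine funext fun c => ?_
    refine Fin.cases rfl (fun c => ?_) c
    simp

/-- Invariance under a common left factor, that is under relabelling the black vertices, allows the
first permutation to be normalized to `1`; its `k!` values contribute equally. -/
theorem sum_eq_factorial_smul {E : Type} [AddCommMonoid E]
    (F : (Fin (n + 1) → Equiv.Perm (Fin k)) → E)
    (hF : ∀ ρ σ, F (fun c => ρ * σ c) = F σ) :
    ∑ σ, F σ = k.factorial • ∑ τ : Fin n → Equiv.Perm (Fin k), F (Fin.cons 1 τ) := by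
  rw [← Equiv.sum_comp (consMulEquiv n k), Fintype.sum_prod_type]
  have h : ∀ (ρ : Equiv.Perm (Fin k)) (τ : Fin n → Equiv.Perm (Fin k)),
      F (consMulEquiv n k (ρ, τ)) = F (Fin.cons 1 τ) := by
    intro ρ τ
    rw [← hF ρ (Fin.cons 1 τ)]
    congr 1
    refine funext fun c => Fin.cases ?_ (fun c => ?_) c
    · simp [consMulEquiv]
    · simp [consMulEquiv]
  simp only [h, Finset.sum_const, Finset.card_univ, Fintype.card_perm, Fintype.card_fin]

theorem connected_mul_iff (ρ : Equiv.Perm (Fin k)) (σ : Fin (n + 1) → Equiv.Perm (Fin k)) :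
    (coloredGraph fun c => ρ * σ c).Connected ↔ (coloredGraph σ).Connected := by
  have h : whiteSetoid (fun c => ρ * σ c) = whiteSetoid σ := by
    refine le_antisymm (whiteSetoid_le 0 fun c i => ?_) (whiteSetoid_le 0 fun c i => ?_)
    · have := whiteSetoid_rel σ 0 c i
      simpa [mul_inv_rev] using this
    · have := whiteSetoid_rel (fun c => ρ * σ c) 0 c i
      simpa [mul_inv_rev] using this
  rw [coloredGraph_connected_iff _ 0, coloredGraph_connected_iff _ 0, h]

/-- When the first color joins white `i` to black `i`, the two can be identified, and the components
become the orbits of the remaining permutations. -/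
theorem connected_cons_one_iff (τ : Fin n → Equiv.Perm (Fin k)) :
    (coloredGraph (Fin.cons 1 τ : Fin (n + 1) → Equiv.Perm (Fin k))).Connected
      ↔ IsTransitive τ := by
  have h : whiteSetoid (Fin.cons 1 τ : Fin (n + 1) → Equiv.Perm (Fin k)) = orbitSetoid τ := by
    refine le_antisymm (whiteSetoid_le 0 fun c i => ?_) (orbitSetoid_le fun c i => ?_)
    · refine Fin.cases ?_ (fun c => ?_) c
      · simp
      · simpa using orbitSetoid_rel τ c i
    · simpa using whiteSetoid_rel (Fin.cons 1 τ : Fin (n + 1) → Equiv.Perm (Fin k)) 0 c.succ i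
  rw [coloredGraph_connected_iff _ 0, h, IsTransitive]
  refine and_congr_left fun _ => ⟨fun hk => ⟨⟨0, hk⟩⟩, fun ⟨i⟩ => i.pos⟩

theorem sum_connected_eq_factorial_smul {E : Type} [AddCommMonoid E]
    (F : (Fin (n + 1) → Equiv.Perm (Fin k)) → E)
    (hF : ∀ ρ σ, F (fun c => ρ * σ c) = F σ) :
    ∑ σ with (coloredGraph σ).Connected, F σ
      = k.factorial • ∑ τ : Fin n → Equiv.Perm (Fin k) with IsTransitive τ,
          F (Fin.cons 1 τ) := by
  rw [Finset.sum_filter, Finset.sum_filter, sum_eq_factorial_smul]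
  · simp only [connected_cons_one_iff]
  · intro ρ σ
    simp only [hF, connected_mul_iff]

end Reduction

/-! ### Wick's theorem -/

section Wick

variable {M V : Type} [AddCommGroup M] [Module ℂ M] [AddCommGroup V] [Module ℂ V]

/-- The product of a sequence of vectors in the exterior algebra. -/
def wedge {n : ℕ} (v : Fin n → M) : ExteriorAlgebra ℂ M :=
  (List.ofFn fun i => ExteriorAlgebra.ι ℂ (v i)).prod

theorem wedge_zero (v : Fin 0 → M) : wedge v = 1 := by simp [wedge]

theorem wedge_succ {n : ℕ} (v : Fin (n + 1) → M) :
    wedge v = ExteriorAlgebra.ι ℂ (v 0) * wedge fun i => v i.succ := by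
  simp [wedge, List.ofFn_succ]

theorem contractLeft_wedge_mul {n : ℕ} (d : Module.Dual ℂ M) (v : Fin n → M)
    (h : ∀ i, d (v i) = 0) (F : ExteriorAlgebra ℂ M) :
    CliffordAlgebra.contractLeft d (wedge v * F)
      = (-1 : ℂ) ^ n • (wedge v * CliffordAlgebra.contractLeft d F) := by
  induction n with
  | zero => simp [wedge_zero]
  | succ n ih =>
    rw [wedge_succ, mul_assoc]
    refine (CliffordAlgebra.contractLeft_ι_mul (Q := 0) d (v 0) _).trans ?_
    rw [h, zero_smul, zero_sub]
    erw [ih (fun i => v i.succ) fun i => h i.succ]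
    rw [mul_smul_comm, pow_succ, mul_assoc, mul_neg_one, neg_smul]

theorem contractLeft_wedge {n : ℕ} (d : Module.Dual ℂ M) (v : Fin (n + 1) → M) :
    CliffordAlgebra.contractLeft d (wedge v)
      = ∑ j : Fin (n + 1), ((-1 : ℂ) ^ (j : ℕ) * d (v j)) • wedge fun i => v (j.succAbove i) := by
  induction n with
  | zero =>
    rw [wedge_succ, wedge_zero, mul_one]
    refine (CliffordAlgebra.contractLeft_ι (Q := 0) d (v 0)).trans ?_
    rw [Fin.sum_univ_one, wedge_zero]
    simp [Algebra.algebraMap_eq_smul_one]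
  | succ n ih =>
    rw [wedge_succ]
    refine (CliffordAlgebra.contractLeft_ι_mul (Q := 0) d (v 0) _).trans ?_
    erw [ih fun i => v i.succ]
    rw [Fin.sum_univ_succ (n := n + 1), Finset.mul_sum, sub_eq_add_neg, ← Finset.sum_neg_distrib]
    congr 1
    · simp
    · refine Finset.sum_congr rfl fun j _ => ?_
      rw [wedge_succ (fun i => v (j.succ.succAbove i)), mul_smul_comm, ← neg_smul]
      simp only [Fin.succ_succAbove_zero, Fin.succ_succAbove_succ, Fin.val_succ, pow_succ]
      congr 1
      ring

/-- Wick's theorem: integration by parts produces a determinant. -/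
theorem wick_det (I : ExteriorAlgebra ℂ M →ₗ[ℂ] V) {n : ℕ} (v w : Fin n → M)
    (d : Fin n → Module.Dual ℂ M)
    (hI : ∀ i F, I (ExteriorAlgebra.ι ℂ (v i) * F) = I (CliffordAlgebra.contractLeft (d i) F))
    (hd : ∀ i j, d i (v j) = 0) :
    I (wedge (fun i => v i.rev) * wedge w) = (Matrix.of fun i j => d i (w j)).det • I 1 := by
  induction n with
  | zero => simp [wedge_zero]
  | succ n ih =>
    rw [wedge_succ (fun i => v i.rev), mul_assoc, hI]
    erw [contractLeft_wedge_mul _ _ (fun i => hd _ _), contractLeft_wedge]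
    -- The contraction passes the `n` remaining `v`'s and then hits the `j`-th `w`: the sign
    -- `(-1)^(n + j)` is that of the Laplace expansion along the last row. The reversed order of the
    -- `v`'s is what makes the total sign trivial.
    rw [Finset.mul_sum, Finset.smul_sum, map_sum, Matrix.det_succ_row _ (Fin.last n),
      Finset.sum_smul]
    refine Finset.sum_congr rfl fun j _ => ?_
    have h := ih (fun i => v i.castSucc) (fun i => w (j.succAbove i)) (fun i => d i.castSucc)
      (fun i F => hI _ F) (fun i j => hd _ _)
    rw [mul_smul_comm, map_smul, map_smul]
    simp only [Fin.rev_succ, Fin.rev_zero] at h ⊢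
    rw [h, smul_smul, smul_smul]
    congr 1
    simp only [Fin.val_last, pow_add, Fin.succAbove_last]
    rw [← mul_assoc]
    rfl

/-- Each integration by parts removes one `v` and one `w`. Since the numbers differ, vectors of a
single kind eventually remain, and their contractions vanish. -/
theorem wick_eq_zero (I : ExteriorAlgebra ℂ M →ₗ[ℂ] V) {p q : ℕ} (hpq : p ≠ q) (v : Fin p → M)
    (w : Fin q → M) (d : Fin p → Module.Dual ℂ M) (d' : Fin q → Module.Dual ℂ M)
    (hI : ∀ i F, I (ExteriorAlgebra.ι ℂ (v i) * F) = I (CliffordAlgebra.contractLeft (d i) F))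
    (hd : ∀ i j, d i (v j) = 0)
    (hI' : ∀ i F, I (ExteriorAlgebra.ι ℂ (w i) * F) = I (CliffordAlgebra.contractLeft (d' i) F))
    (hd' : ∀ i j, d' i (w j) = 0) :
    I (wedge v * wedge w) = 0 := by
  induction p generalizing q with
  | zero =>
    obtain ⟨q, rfl⟩ := Nat.exists_eq_succ_of_ne_zero hpq.symm
    rw [wedge_zero, one_mul, wedge_succ, hI']
    have := contractLeft_wedge_mul (d' 0) (fun i => w i.succ) (fun i => hd' _ _) 1
    rw [mul_one] at this
    erw [this, CliffordAlgebra.contractLeft_one]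
    simp
  | succ p ih =>
    rw [wedge_succ v, mul_assoc, hI]
    erw [contractLeft_wedge_mul _ _ (fun i => hd _ _)]
    rcases q with _ | q
    · rw [wedge_zero]
      erw [CliffordAlgebra.contractLeft_one]
      simp
    · erw [contractLeft_wedge]
      rw [Finset.mul_sum, map_smul, map_sum]
      rw [Finset.sum_eq_zero, smul_zero]
      intro j _
      rw [mul_smul_comm, map_smul]
      have := ih (q := q) (by omega) (fun i => v i.succ) (fun i => w (j.succAbove i))
        (fun i => d i.succ) (fun i => d' (j.succAbove i)) (fun i F => hI _ F) (fun i j => hd _ _)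
        (fun i F => hI' _ F) (fun i j => hd' _ _)
      rw [this, smul_zero]

end Wick

/-! ### The fermionic integral -/

section FermionIntegral

variable {D N : ℕ} {Y : Type}

/-- The contraction with a fermion. -/
def fermionDual (f : Fermion D N) : Module.Dual ℂ ((Fermion D N ⊕ Y) →₀ ℂ) :=
  Finsupp.linearCombination ℂ fun y => fermionCov (Sum.inl f) y

theorem fermionDual_single (f : Fermion D N) (y : Fermion D N ⊕ Y) :
    fermionDual f (Finsupp.single y 1) = fermionCov (Sum.inl f) y := by
  simp [fermionDual]

/-- The projection onto the Grassmann algebra of the spectators. -/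
def projSpectator (D N : ℕ) (Y : Type) : Grassmann (Fermion D N ⊕ Y) →ₐ[ℂ] Grassmann Y :=
  ExteriorAlgebra.map (Finsupp.linearCombination ℂ
    (Sum.elim (fun _ => 0) (fun y => Finsupp.single y (1 : ℂ))))

theorem fermionIntegral_apply (F : Grassmann (Fermion D N ⊕ Y)) :
    fermionIntegral D N Y F = projSpectator D N Y (wick fermionCov fermionCov_antisymm F) := rfl

theorem projSpectator_inl (f : Fermion D N) : projSpectator D N Y (gen (Sum.inl f)) = 0 := by
  rw [projSpectator, gen, ExteriorAlgebra.map_apply_ι]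
  simp

theorem projSpectator_inr (y : Y) : projSpectator D N Y (gen (Sum.inr y)) = gen y := by
  rw [projSpectator, gen, ExteriorAlgebra.map_apply_ι]
  simp [gen]

theorem wick_gen_mul {X : Type} (G : X → X → ℂ) (hG : ∀ x y, G y x = -G x y) (x : X)
    (F : Grassmann X) :
    wick G hG (gen x * F) = gen x * wick G hG F
      - CliffordAlgebra.contractLeft (covForm G (Finsupp.single x 1)) (wick G hG F) :=
  CliffordAlgebra.changeForm_ι_mul _ _ _

theorem wick_contractLeft {X : Type} (G : X → X → ℂ) (hG : ∀ x y, G y x = -G x y)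
    (d : Module.Dual ℂ (X →₀ ℂ)) (F : Grassmann X) :
    wick G hG (CliffordAlgebra.contractLeft d F)
      = CliffordAlgebra.contractLeft d (wick G hG F) :=
  CliffordAlgebra.changeForm_contractLeft _ _ _

theorem fermionIntegral_one : fermionIntegral D N Y 1 = 1 := by
  rw [fermionIntegral_apply]
  exact (congrArg _ (CliffordAlgebra.changeForm_one _)).trans (map_one _)

theorem covForm_single (f : Fermion D N) :
    covForm (fermionCov (Y := Y)) (Finsupp.single (Sum.inl f) 1) = -fermionDual f := by
  refine Finsupp.lhom_ext' fun y => LinearMap.ext_ring ?_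
  simp [covForm, fermionDual]

/-- Integration by parts: the uncontracted term carries a fermion and is killed by the projection,
and the two minus signs, in `covForm` and in the change of form, cancel. -/
theorem fermionIntegral_gen_mul (f : Fermion D N) (F : Grassmann (Fermion D N ⊕ Y)) :
    fermionIntegral D N Y (gen (Sum.inl f) * F)
      = fermionIntegral D N Y (CliffordAlgebra.contractLeft (fermionDual f) F) := by
  rw [fermionIntegral_apply, fermionIntegral_apply, wick_gen_mul, covForm_single, map_neg,
    LinearMap.neg_apply, sub_neg_eq_add, map_add, map_mul, projSpectator_inl, zero_mul, zero_add,
    wick_contractLeft]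

theorem covForm_single_inr (y : Y) :
    covForm (fermionCov (D := D) (N := N) (Y := Y)) (Finsupp.single (Sum.inr y) 1) = 0 := by
  refine Finsupp.lhom_ext' fun x => LinearMap.ext_ring ?_
  simp [covForm, fermionCov]

theorem spectator_gen (y : Y) : spectator D N Y (gen y) = gen (Sum.inr y) := by
  rw [spectator, gen, ExteriorAlgebra.map_apply_ι]
  simp [gen]

theorem fermionIntegral_gen_inr_mul (y : Y) (F : Grassmann (Fermion D N ⊕ Y)) :
    fermionIntegral D N Y (gen (Sum.inr y) * F) = gen y * fermionIntegral D N Y F := by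
  rw [fermionIntegral_apply, fermionIntegral_apply, wick_gen_mul, covForm_single_inr, map_zero,
    LinearMap.zero_apply, sub_zero, map_mul, projSpectator_inr]

theorem grassmann_induction {X : Type} {p : Grassmann X → Prop}
    (scalar : ∀ r : ℂ, p (algebraMap ℂ _ r)) (gen : ∀ x, p (gen x))
    (mul : ∀ F G, p F → p G → p (F * G)) (add : ∀ F G, p F → p G → p (F + G))
    (F : Grassmann X) : p F := by
  refine ExteriorAlgebra.induction scalar (fun v => ?_) mul add F
  induction v using Finsupp.induction_linear with
  | zero => simpa using scalar 0
  | add f g hf hg =>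
    rw [map_add]
    exact add _ _ hf hg
  | single x r =>
    have h : ExteriorAlgebra.ι ℂ (Finsupp.single x r)
        = algebraMap ℂ (Grassmann X) r * SYK.gen x := by
      rw [SYK.gen, ← Algebra.smul_def, ← map_smul, Finsupp.smul_single, smul_eq_mul, mul_one]
    rw [h]
    exact mul _ _ (scalar r) (gen x)

/-- The covariance vanishes on spectators, so the integral is left linear over the algebra that they
generate. -/
theorem fermionIntegral_spectator_mul (S : Grassmann Y) (F : Grassmann (Fermion D N ⊕ Y)) :
    fermionIntegral D N Y (spectator D N Y S * F) = S * fermionIntegral D N Y F := by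
  induction S using grassmann_induction generalizing F with
  | scalar r =>
    rw [AlgHom.commutes, ← Algebra.smul_def, map_smul, ← Algebra.smul_def]
  | gen y => rw [spectator_gen, fermionIntegral_gen_inr_mul]
  | mul S T hS hT => rw [map_mul (spectator D N Y), mul_assoc, hS, hT, mul_assoc]
  | add S T hS hT => rw [map_add, add_mul, map_add, hS, hT, add_mul]

theorem gen_mul_gen {X : Type} (x y : X) : gen x * gen y = -(gen y * gen x) := by
  rw [eq_neg_iff_add_eq_zero]
  exact ExteriorAlgebra.ι_add_mul_swap _ _

/-- Wick's theorem for a product of `ψ`s followed by a product of `ψ̄`s. -/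
theorem fermionIntegral_psi_psiBar {n : ℕ} (u v : Fin n → Fin D × Fin N × ℝ) :
    fermionIntegral D N Y
      ((List.ofFn fun i => gen (.inl (.psi (u i).1 (u i).2.1 (u i).2.2))).prod
        * (List.ofFn fun j => gen (.inl (.psiBar (v j.rev).1 (v j.rev).2.1 (v j.rev).2.2))).prod)
      = (Matrix.of fun i j => if (u i).1 = (v j).1 ∧ (u i).2.1 = (v j).2.1 then
          (propagator (u i).2.2 (v j).2.2 : ℂ) else 0).det • 1 := by
  have h := wick_det (fermionIntegral D N Y)
    (fun i : Fin n => Finsupp.single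
      (Sum.inl (.psi (u i.rev).1 (u i.rev).2.1 (u i.rev).2.2) : Fermion D N ⊕ Y) (1 : ℂ))
    (fun j => Finsupp.single (.inl (.psiBar (v j.rev).1 (v j.rev).2.1 (v j.rev).2.2)) (1 : ℂ))
    (fun i => fermionDual (.psi (u i.rev).1 (u i.rev).2.1 (u i.rev).2.2))
    (fun i F => fermionIntegral_gen_mul _ F)
    (fun i j => by rw [fermionDual_single]; rfl)
  rw [fermionIntegral_one] at h
  simp only [Fin.rev_rev] at h
  refine h.trans ?_
  congr 1
  -- Rows and columns are reversed together, which does not change the determinant.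
  rw [← Matrix.det_submatrix_equiv_self Fin.revPerm]
  congr 1
  ext i j
  simp [fermionDual_single, fermionCov]

theorem fermionIntegral_eq_zero {p q : ℕ} (hpq : p ≠ q) (u : Fin p → Fin D × Fin N × ℝ)
    (v : Fin q → Fin D × Fin N × ℝ) :
    fermionIntegral D N Y
      ((List.ofFn fun i => gen (.inl (.psi (u i).1 (u i).2.1 (u i).2.2))).prod
        * (List.ofFn fun j => gen (.inl (.psiBar (v j).1 (v j).2.1 (v j).2.2))).prod) = 0 := by
  exact wick_eq_zero (fermionIntegral D N Y) hpq
    (fun i => Finsupp.single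
      (Sum.inl (.psi (u i).1 (u i).2.1 (u i).2.2) : Fermion D N ⊕ Y) (1 : ℂ))
    (fun j => Finsupp.single (.inl (.psiBar (v j).1 (v j).2.1 (v j).2.2)) (1 : ℂ))
    (fun i => fermionDual (.psi (u i).1 (u i).2.1 (u i).2.2))
    (fun i => fermionDual (.psiBar (v i).1 (v i).2.1 (v i).2.2))
    (fun i F => fermionIntegral_gen_mul _ F)
    (fun i j => by rw [fermionDual_single]; rfl)
    (fun i F => fermionIntegral_gen_mul _ F)
    (fun i j => by rw [fermionDual_single]; rfl)

end FermionIntegral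

/-! ### Reordering products of sequences -/

section Reorder

variable {A : Type} [Ring A]

theorem prod_ofFn_sum {n : ℕ} {κ : Type} [Fintype κ] (f : Fin n → κ → A) :
    (List.ofFn fun i => ∑ a, f i a).prod = ∑ a : Fin n → κ, (List.ofFn fun i => f i (a i)).prod := by
  have h := (MultilinearMap.mkPiAlgebraFin ℤ n A).map_sum f
  simpa only [MultilinearMap.mkPiAlgebraFin_apply] using h

theorem prod_ofFn_ofFn {m n : ℕ} (f : Fin m → Fin n → A) :
    (List.ofFn fun i => (List.ofFn fun j => f i j).prod).prod
      = (List.ofFn fun p : Fin (m * n) =>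
          f (finProdFinEquiv.symm p).1 (finProdFinEquiv.symm p).2).prod := by
  rw [List.ofFn_mul, List.prod_flatten, List.map_ofFn]
  congr 2
  funext i
  simp only [Function.comp_apply]
  congr 2
  funext j
  have h : (⟨i * n + j, by
      calc
        (i : ℕ) * n + j < (i + 1) * n :=
          (Nat.add_lt_add_left j.prop _).trans_eq (by rw [Nat.add_mul, Nat.one_mul])
        _ ≤ _ := Nat.mul_le_mul_right _ i.prop⟩ : Fin (m * n)) = finProdFinEquiv (i, j) := by
    ext
    simp [finProdFinEquiv]
    ring
  rw [h, Equiv.symm_apply_apply]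

theorem finProdFinEquiv_rev {m n : ℕ} (i : Fin m) (c : Fin n) :
    (finProdFinEquiv (i, c)).rev = finProdFinEquiv (i.rev, c.rev) := by
  ext
  obtain ⟨r, hr⟩ : ∃ r, m = i + 1 + r := Nat.exists_eq_add_of_le i.2
  obtain ⟨q, hq⟩ : ∃ q, n = c + 1 + q := Nat.exists_eq_add_of_le c.2
  simp only [Fin.val_rev, finProdFinEquiv, Equiv.coe_fn_mk]
  have h1 : n - ((c : ℕ) + 1) = q := by omega
  have h2 : m - ((i : ℕ) + 1) = r := by omega
  rw [h1, h2]
  have h3 : m * n = (c + n * i + 1) + (q + n * r) := by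
    have : m * n = (i + 1 + r) * n := by rw [← hr]
    rw [this, add_mul, add_mul, one_mul]
    nlinarith
  omega

theorem finProdFinEquiv_symm_rev {m n : ℕ} (p : Fin (m * n)) :
    finProdFinEquiv.symm p.rev
      = ((finProdFinEquiv.symm p).1.rev, (finProdFinEquiv.symm p).2.rev) := by
  rw [Equiv.symm_apply_eq, ← finProdFinEquiv_rev, Prod.mk.eta, Equiv.apply_symm_apply]

variable [Algebra ℂ A] {s : ℂ}

theorem mul_prod_ofFn {n : ℕ} (y : A) (x : Fin n → A) (h : ∀ i, y * x i = s • (x i * y)) :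
    y * (List.ofFn x).prod = s ^ n • ((List.ofFn x).prod * y) := by
  induction n with
  | zero => simp
  | succ n ih =>
    rw [List.ofFn_succ, List.prod_cons, ← mul_assoc, h, smul_mul_assoc, mul_assoc,
      ih _ fun i => h i.succ, mul_smul_comm, smul_smul, pow_succ', mul_assoc]

theorem prod_ofFn_mul {n : ℕ} (y : Fin n → A) (x : A) (h : ∀ i, y i * x = s • (x * y i)) :
    (List.ofFn y).prod * x = s ^ n • (x * (List.ofFn y).prod) := by
  induction n with
  | zero => simp
  | succ n ih =>
    rw [List.ofFn_succ, List.prod_cons, mul_assoc, ih _ fun i => h i.succ, mul_smul_comm,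
      ← mul_assoc, h, smul_mul_assoc, smul_smul, pow_succ, mul_assoc]

theorem prod_ofFn_mul_prod_ofFn {m n : ℕ} (y : Fin m → A) (x : Fin n → A)
    (h : ∀ i j, y i * x j = s • (x j * y i)) :
    (List.ofFn y).prod * (List.ofFn x).prod
      = (s ^ n) ^ m • ((List.ofFn x).prod * (List.ofFn y).prod) :=
  prod_ofFn_mul y _ fun i => mul_prod_ofFn (y i) x (h i)

/-- Each `y i` has to pass `x j` for all `j > i`, which gives one factor `s` per pair. -/
theorem prod_ofFn_mul_distrib {n : ℕ} (x y : Fin n → A)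
    (h : ∀ i j, y i * x j = s • (x j * y i)) :
    (List.ofFn fun i => x i * y i).prod
      = s ^ (∑ i ∈ Finset.range n, i) • ((List.ofFn x).prod * (List.ofFn y).prod) := by
  induction n with
  | zero => simp
  | succ n ih =>
    rw [List.ofFn_succ, List.prod_cons, ih _ _ fun i j => h i.succ j.succ, List.ofFn_succ (f := x),
      List.ofFn_succ (f := y), List.prod_cons, List.prod_cons, Finset.sum_range_succ, pow_add,
      mul_smul_comm, ← mul_assoc, mul_assoc (x 0), mul_prod_ofFn _ _ fun j => h 0 j.succ,
      mul_smul_comm, smul_mul_assoc, smul_smul]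
    simp only [mul_assoc]

/-- Reversal exchanges each pair once, so the exponent is the same as in `prod_ofFn_mul_distrib`;
this is why the two signs later cancel. -/
theorem prod_ofFn_rev {n : ℕ} (x : Fin n → A) (h : ∀ i j, x i * x j = s • (x j * x i)) :
    (List.ofFn x).prod
      = s ^ (∑ i ∈ Finset.range n, i) • (List.ofFn fun i => x i.rev).prod := by
  induction n with
  | zero => simp
  | succ n ih =>
    have h1 : (List.ofFn fun i : Fin (n + 1) => x i.rev).prod
        = (List.ofFn fun i : Fin n => x i.rev.succ).prod * x 0 := by
      rw [List.ofFn_succ', List.concat_eq_append, List.prod_append, List.prod_singleton]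
      simp [Fin.rev_castSucc]
    rw [h1, List.ofFn_succ, List.prod_cons, mul_prod_ofFn _ _ fun j => h 0 j.succ,
      ih _ fun i j => h i.succ j.succ, smul_mul_assoc, smul_smul, Finset.sum_range_succ, pow_add,
      mul_comm]

end Reorder

/-! ### The terms of the partition function -/

section Vertices

variable {D N : ℕ} {Y : Type}

/-- The product `ψ¹_{a¹}(τ) ⋯ ψ^D_{a^D}(τ)`. -/
def psiWord (a : Idx D N) (τ : ℝ) : Grassmann (Fermion D N ⊕ Y) :=
  (List.ofFn fun c : Fin D => gen (.inl (.psi c (a c) τ))).prod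

/-- The product `ψ̄^D_{a^D}(τ) ⋯ ψ̄¹_{a¹}(τ)`. -/
def psiBarWord (a : Idx D N) (τ : ℝ) : Grassmann (Fermion D N ⊕ Y) :=
  (List.ofFn fun c : Fin D => gen (.inl (.psiBar c.rev (a c.rev) τ))).prod

/-- The parity sign of a tensor with `D` indices. -/
def tensorSign (D : ℕ) : ℂ := (-1) ^ D

theorem tensorSign_sq (D : ℕ) : tensorSign D * tensorSign D = 1 := by
  rw [tensorSign, ← mul_pow]
  simp

/-- `D²` and `D` have the same parity: passing a word of `D` fermions costs a tensor component the
same sign as passing one fermion. -/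
theorem tensorSign_pow (D : ℕ) : tensorSign D ^ D = tensorSign D := by
  rw [tensorSign, ← pow_mul]
  rcases Nat.even_or_odd D with h | h
  · rw [h.neg_one_pow, (h.mul_left D).neg_one_pow]
  · rw [h.neg_one_pow, (h.mul h).neg_one_pow]

/-- The components of the tensor have the parity of `D`. -/
structure HasTensorParity (T Tbar : Idx D N → Grassmann Y) : Prop where
  gen_mul : ∀ (f : Fermion D N) a, gen (.inl f) * spectator D N Y (T a)
    = tensorSign D • (spectator D N Y (T a) * gen (.inl f))
  gen_mul_bar : ∀ (f : Fermion D N) a, gen (.inl f) * spectator D N Y (Tbar a)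
    = tensorSign D • (spectator D N Y (Tbar a) * gen (.inl f))
  bar_mul : ∀ a b, Tbar b * T a = tensorSign D • (T a * Tbar b)

theorem psiWord_mul {x : Grassmann (Fermion D N ⊕ Y)}
    (h : ∀ f : Fermion D N, gen (.inl f) * x = tensorSign D • (x * gen (.inl f)))
    (a : Idx D N) (τ : ℝ) : psiWord a τ * x = tensorSign D • (x * psiWord a τ) := by
  have := prod_ofFn_mul (fun c : Fin D => gen (.inl (.psi c (a c) τ))) x fun c => h _
  rwa [tensorSign_pow] at this

theorem psiBarWord_mul {x : Grassmann (Fermion D N ⊕ Y)}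
    (h : ∀ f : Fermion D N, gen (.inl f) * x = tensorSign D • (x * gen (.inl f)))
    (a : Idx D N) (τ : ℝ) : psiBarWord a τ * x = tensorSign D • (x * psiBarWord a τ) := by
  have := prod_ofFn_mul (fun c : Fin D => gen (.inl (.psiBar c.rev (a c.rev) τ))) x fun c => h _
  rwa [tensorSign_pow] at this

theorem psiBarWord_mul_psiBarWord (a b : Idx D N) (τ τ' : ℝ) :
    (psiBarWord a τ * psiBarWord b τ' : Grassmann (Fermion D N ⊕ Y))
      = tensorSign D • (psiBarWord b τ' * psiBarWord a τ) := by
  have := prod_ofFn_mul_prod_ofFn (s := -1)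
    (fun c : Fin D => (gen (.inl (.psiBar c.rev (a c.rev) τ)) : Grassmann (Fermion D N ⊕ Y)))
    (fun c : Fin D => (gen (.inl (.psiBar c.rev (b c.rev) τ')) : Grassmann (Fermion D N ⊕ Y)))
    fun i j => by rw [gen_mul_gen, neg_one_smul]
  exact this.trans (by rw [show ((-1 : ℂ) ^ D) ^ D = tensorSign D from tensorSign_pow D]; rfl)

/-- The sign, times the product of propagators, of a complete pairing. -/
def pairing {k : ℕ} (a b : Fin k → Idx D N) (t t' : Fin k → ℝ) : ℂ :=
  ∑ σ : Fin D → Equiv.Perm (Fin k), ∏ c, (((Equiv.Perm.sign (σ c) : ℤˣ) : ℤ) : ℂ)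
    * ∏ i, if a i c = b (σ c i) c then (propagator (t i) (t' (σ c i)) : ℂ) else 0

theorem fermionIntegral_words {k : ℕ} (a b : Fin k → Idx D N) (t t' : Fin k → ℝ) :
    fermionIntegral D N Y ((List.ofFn fun i => psiWord (a i) (t i)).prod
      * (List.ofFn fun j : Fin k => psiBarWord (b j.rev) (t' j.rev)).prod)
      = pairing a b t t' • 1 := by
  have h := fermionIntegral_psi_psiBar (D := D) (N := N) (Y := Y) (n := k * D)
    (fun p => ((finProdFinEquiv.symm p).2, a (finProdFinEquiv.symm p).1 (finProdFinEquiv.symm p).2,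
      t (finProdFinEquiv.symm p).1))
    (fun p => ((finProdFinEquiv.symm p).2, b (finProdFinEquiv.symm p).1 (finProdFinEquiv.symm p).2,
      t' (finProdFinEquiv.symm p).1))
  simp only [finProdFinEquiv_symm_rev] at h
  simp only [psiWord, psiBarWord, prod_ofFn_ofFn]
  refine h.trans ?_
  congr 1
  rw [← Matrix.det_submatrix_equiv_self finProdFinEquiv]
  -- The covariance is diagonal in the color, so the matrix indexed by (vertex, color) splits into
  -- `D` blocks, one determinant and one permutation per color.
  have hM : ((Matrix.of fun p q : Fin (k * D) =>
      if (finProdFinEquiv.symm p).2 = (finProdFinEquiv.symm q).2 ∧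
        a (finProdFinEquiv.symm p).1 (finProdFinEquiv.symm p).2
          = b (finProdFinEquiv.symm q).1 (finProdFinEquiv.symm q).2 then
        (propagator (t (finProdFinEquiv.symm p).1) (t' (finProdFinEquiv.symm q).1) : ℂ)
      else 0).submatrix finProdFinEquiv finProdFinEquiv)
      = Matrix.blockDiagonal fun c : Fin D => Matrix.of fun i j : Fin k =>
        if a i c = b j c then (propagator (t i) (t' j) : ℂ) else 0 := by
    ext ⟨i, c⟩ ⟨j, c'⟩
    simp only [Matrix.submatrix_apply, Matrix.of_apply, Equiv.symm_apply_apply,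
      Matrix.blockDiagonal_apply]
    by_cases hc : c = c'
    · subst hc
      simp
    · simp [hc]
  rw [hM, Matrix.det_blockDiagonal, pairing]
  have hdet : ∀ c : Fin D, (Matrix.of fun i j : Fin k =>
      if a i c = b j c then (propagator (t i) (t' j) : ℂ) else 0).det
      = ∑ σ : Equiv.Perm (Fin k), (((Equiv.Perm.sign σ : ℤˣ) : ℤ) : ℂ)
        * ∏ i, if a i c = b (σ i) c then (propagator (t i) (t' (σ i)) : ℂ) else 0 := by
    intro c
    rw [← Matrix.det_transpose, Matrix.det_apply']
    rfl
  rw [Finset.prod_congr rfl fun c _ => hdet c, Finset.prod_univ_sum, Fintype.piFinset_univ]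

theorem fermionIntegral_words_eq_zero (hD : 1 ≤ D) {m n : ℕ} (hmn : m ≠ n) (a : Fin m → Idx D N)
    (b : Fin n → Idx D N) (t : Fin m → ℝ) (t' : Fin n → ℝ) :
    fermionIntegral D N Y ((List.ofFn fun i => psiWord (a i) (t i)).prod
      * (List.ofFn fun j => psiBarWord (b j) (t' j)).prod) = 0 := by
  simp only [psiWord, psiBarWord, prod_ofFn_ofFn]
  exact fermionIntegral_eq_zero (fun h => hmn (Nat.eq_of_mul_eq_mul_right hD h))
    (fun p => ((finProdFinEquiv.symm p).2, a (finProdFinEquiv.symm p).1 (finProdFinEquiv.symm p).2,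
      t (finProdFinEquiv.symm p).1))
    (fun p => ((finProdFinEquiv.symm p).2.rev,
      b (finProdFinEquiv.symm p).1 (finProdFinEquiv.symm p).2.rev, t' (finProdFinEquiv.symm p).1))

theorem tensorSign_pow_add_self (D n : ℕ) : tensorSign D ^ n * tensorSign D ^ n = 1 := by
  rw [← mul_pow, tensorSign_sq, one_pow]

variable {T Tbar : Idx D N → Grassmann Y}

/-- The spectators can be moved to the left. -/
theorem prod_vertices_eq (hT : HasTensorParity T Tbar) {m n : ℕ} (a : Fin m → Idx D N)
    (b : Fin n → Idx D N) (t : Fin m → ℝ) (t' : Fin n → ℝ) :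
    (List.ofFn fun i => spectator D N Y (T (a i)) * psiWord (a i) (t i)).prod
      * (List.ofFn fun j => psiBarWord (b j) (t' j) * spectator D N Y (Tbar (b j))).prod
      = (tensorSign D ^ (∑ i ∈ Finset.range m, i + ∑ i ∈ Finset.range n, i + n * n + n * m)) •
        (spectator D N Y ((List.ofFn fun i => T (a i)).prod * (List.ofFn fun j => Tbar (b j)).prod)
          * ((List.ofFn fun i => psiWord (a i) (t i)).prod
            * (List.ofFn fun j => psiBarWord (b j) (t' j)).prod)) := by
  -- The four reorderings account for the four summands of the exponent: separating `T` from the `ψ`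
  -- words, separating `T̄` from the `ψ̄` words, moving the `T̄`'s past the `ψ̄` words, then past
  -- the `ψ` words.
  have h1 := prod_ofFn_mul_distrib (s := tensorSign D) (fun i => spectator D N Y (T (a i)))
    (fun i => psiWord (a i) (t i)) fun i j => psiWord_mul (fun f => hT.gen_mul f _) _ _
  have h2 := prod_ofFn_mul_distrib (s := tensorSign D) (fun j => psiBarWord (b j) (t' j))
    (fun j => spectator D N Y (Tbar (b j))) fun i j => by
      rw [psiBarWord_mul (fun f => hT.gen_mul_bar f _), smul_smul, tensorSign_sq, one_smul]
  have h3 := prod_ofFn_mul_prod_ofFn (s := tensorSign D) (fun j => psiBarWord (b j) (t' j))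
    (fun j => spectator D N Y (Tbar (b j)))
    fun i j => psiBarWord_mul (fun f => hT.gen_mul_bar f _) _ _
  have h4 := prod_ofFn_mul_prod_ofFn (s := tensorSign D) (fun i => psiWord (a i) (t i))
    (fun j => spectator D N Y (Tbar (b j)))
    fun i j => psiWord_mul (fun f => hT.gen_mul_bar f _) _ _
  have h5 : spectator D N Y ((List.ofFn fun i => T (a i)).prod * (List.ofFn fun j => Tbar (b j)).prod)
      = (List.ofFn fun i => spectator D N Y (T (a i))).prod
        * (List.ofFn fun j => spectator D N Y (Tbar (b j))).prod := by
    rw [map_mul, map_list_prod, map_list_prod, List.map_ofFn, List.map_ofFn]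
    rfl
  rw [h1, h2, h3, h5]
  simp only [smul_mul_assoc, mul_smul_comm, smul_smul]
  rw [mul_assoc (List.prod _) (List.prod _) (List.prod _ * List.prod _),
    ← mul_assoc (List.ofFn fun i => psiWord (a i) (t i)).prod, h4]
  simp only [smul_mul_assoc, mul_smul_comm, smul_smul, mul_assoc]
  congr 1
  simp only [← pow_mul, ← pow_add]
  congr 1
  ring

end Vertices

/-! ### Weak integrals -/

theorem isWeakIntegral_unique {Ω V : Type} [MeasurableSpace Ω] [AddCommGroup V] [Module ℂ V]
    {μ : Measure Ω} {f : Ω → V} {v w : V} (hv : IsWeakIntegral μ f v)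
    (hw : IsWeakIntegral μ f w) : v = w := by
  refine Module.forall_dual_apply_eq_zero_iff ℂ (v - w) |>.mp (fun l => ?_) |> sub_eq_zero.mp
  rw [map_sub, (hv l).2, (hw l).2, sub_self]

theorem weakIntegral_eq {Ω V : Type} [MeasurableSpace Ω] [AddCommGroup V] [Module ℂ V]
    {μ : Measure Ω} {f : Ω → V} {v : V} (hv : IsWeakIntegral μ f v) : weakIntegral μ f = v := by
  have h : ∃ v, IsWeakIntegral μ f v := ⟨v, hv⟩
  rw [weakIntegral, dif_pos h]
  exact isWeakIntegral_unique h.choose_spec hv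

/-- The time integrands are finite combinations of fixed vectors with scalar coefficients, so no
topology on the Grassmann algebra is required. -/
theorem weakIntegral_sum_smul {Ω V κ : Type} [MeasurableSpace Ω] [AddCommGroup V] [Module ℂ V]
    [Fintype κ] {μ : Measure Ω} (g : κ → Ω → ℂ) (v : κ → V) (hg : ∀ i, Integrable (g i) μ) :
    weakIntegral μ (fun x => ∑ i, g i x • v i) = ∑ i, (∫ x, g i x ∂μ) • v i := by
  refine weakIntegral_eq fun l => ?_
  simp only [map_sum, map_smul, smul_eq_mul]
  refine ⟨integrable_finsetSum _ fun i _ => (hg i).mul_const _, ?_⟩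
  rw [integral_finsetSum _ fun i _ => (hg i).mul_const _]
  exact Finset.sum_congr rfl fun i _ => (integral_mul_const _ _).symm

/-! ### The integrals over the times -/

instance (β : ℝ) (m n : ℕ) : IsFiniteMeasure (timeMeasure β m n) := by
  unfold timeMeasure
  infer_instance

theorem measurable_propagator : Measurable fun q : ℝ × ℝ => propagator q.1 q.2 := by
  have h : Measurable Real.sign := by
    unfold Real.sign
    exact Measurable.ite measurableSet_Iio measurable_const
      (Measurable.ite measurableSet_Ioi measurable_const measurable_const)
  exact (h.comp (measurable_fst.sub measurable_snd)).div_const 2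

theorem abs_propagator_le (τ τ' : ℝ) : |propagator τ τ'| ≤ 1 := by
  rw [propagator]
  rcases Real.sign_apply_eq (τ - τ') with h | h | h <;> rw [h] <;> norm_num

theorem integrable_prod_propagator {D k : ℕ} (β : ℝ) (σ : Fin D → Equiv.Perm (Fin k)) :
    Integrable (fun t : (Fin k → ℝ) × (Fin k → ℝ) =>
      ∏ c : Fin D, ∏ i : Fin k, propagator (t.1 i) (t.2 (σ c i))) (timeMeasure β k k) := by
  refine Integrable.of_bound (C := 1) ?_ (Filter.Eventually.of_forall fun t => ?_)
  · refine Measurable.aestronglyMeasurable ?_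
    refine Finset.measurable_fun_prod _ fun c _ => Finset.measurable_fun_prod _ fun i _ => ?_
    exact measurable_propagator.comp
      (f := fun t : (Fin k → ℝ) × (Fin k → ℝ) => (t.1 i, t.2 (σ c i))) (by fun_prop)
  · rw [norm_prod]
    refine Finset.prod_le_one (fun _ _ => norm_nonneg _) fun c _ => ?_
    rw [norm_prod]
    exact Finset.prod_le_one (fun _ _ => norm_nonneg _) fun i _ => abs_propagator_le _ _

/-! ### The coefficients of the partition function -/

/-- The trace invariant of a colored graph: the indices of the white and black vertices are
identified along the edges. -/
def traceInvariant {D N k : ℕ} {R : Type} [Ring R] (X : Idx D N → Idx D N → R)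
    (σ : Fin D → Equiv.Perm (Fin k)) : R :=
  ∑ a : Fin k → Idx D N, ∑ b : Fin k → Idx D N,
    if ∀ c i, a i c = b (σ c i) c then (List.ofFn fun i => X (a i) (b i)).prod else 0

section Partition

variable {D N : ℕ} {Y : Type}

theorem pairing_eq {k : ℕ} (a b : Fin k → Idx D N) (t t' : Fin k → ℝ) :
    pairing a b t t' = ∑ σ : Fin D → Equiv.Perm (Fin k),
      ((∏ c, ∏ i, propagator (t i) (t' (σ c i)) : ℝ) : ℂ)
        * ((∏ c, (((Equiv.Perm.sign (σ c) : ℤˣ) : ℤ) : ℝ) : ℝ) : ℂ)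
        * if ∀ c i, a i c = b (σ c i) c then 1 else 0 := by
  rw [pairing]
  refine Finset.sum_congr rfl fun σ _ => ?_
  rw [Finset.prod_mul_distrib]
  by_cases h : ∀ c i, a i c = b (σ c i) c
  · simp only [h, if_true, implies_true]
    push_cast
    ring
  · rw [if_neg h, mul_zero]
    push Not at h
    obtain ⟨c, i, h⟩ := h
    have h0 : ∏ c, ∏ i, (if a i c = b (σ c i) c then (propagator (t i) (t' (σ c i)) : ℂ) else 0)
        = 0 :=
      Finset.prod_eq_zero (Finset.mem_univ c)
        (Finset.prod_eq_zero (Finset.mem_univ i) (if_neg h))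
    rw [h0, mul_zero]

variable {T Tbar : Idx D N → Grassmann Y}

theorem vertex_eq (τ : ℝ) :
    vertex T τ = ∑ a, spectator D N Y (T a) * psiWord a τ := rfl

theorem vertexBar_eq (τ : ℝ) :
    vertexBar Tbar τ = ∑ a, psiBarWord a τ * spectator D N Y (Tbar a) := rfl

theorem prod_vertices_expand {m n : ℕ} (t : Fin m → ℝ) (t' : Fin n → ℝ) :
    (List.ofFn fun i => vertex T (t i)).prod * (List.ofFn fun j => vertexBar Tbar (t' j)).prod
      = ∑ a : Fin m → Idx D N, ∑ b : Fin n → Idx D N,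
        (List.ofFn fun i => spectator D N Y (T (a i)) * psiWord (a i) (t i)).prod
        * (List.ofFn fun j => psiBarWord (b j) (t' j) * spectator D N Y (Tbar (b j))).prod := by
  simp only [vertex_eq, vertexBar_eq]
  rw [prod_ofFn_sum, prod_ofFn_sum, Finset.sum_mul_sum]

theorem fermionIntegral_vertices_of_ne (hD : 1 ≤ D) (hT : HasTensorParity T Tbar) {m n : ℕ}
    (hmn : m ≠ n) (t : Fin m → ℝ) (t' : Fin n → ℝ) :
    fermionIntegral D N Y ((List.ofFn fun i => vertex T (t i)).prod
      * (List.ofFn fun j => vertexBar Tbar (t' j)).prod) = 0 := by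
  rw [prod_vertices_expand, map_sum]
  refine Finset.sum_eq_zero fun a _ => ?_
  rw [map_sum]
  refine Finset.sum_eq_zero fun b _ => ?_
  rw [prod_vertices_eq hT, map_smul, fermionIntegral_spectator_mul,
    fermionIntegral_words_eq_zero hD hmn, mul_zero, smul_zero]

/-- All parity signs disappear: those of `prod_vertices_eq` have even total exponent, and the sign
of reversing the `ψ̄` words equals that of interleaving the `T`'s with the `T̄`'s. -/
theorem fermionIntegral_word_pair (hT : HasTensorParity T Tbar) {k : ℕ}
    (a b : Fin k → Idx D N) (t t' : Fin k → ℝ) :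
    fermionIntegral D N Y
      ((List.ofFn fun i => spectator D N Y (T (a i)) * psiWord (a i) (t i)).prod
        * (List.ofFn fun j => psiBarWord (b j) (t' j) * spectator D N Y (Tbar (b j))).prod)
      = pairing a b t t' • (List.ofFn fun i => T (a i) * Tbar (b i)).prod := by
  rw [prod_vertices_eq hT, map_smul, fermionIntegral_spectator_mul,
    prod_ofFn_rev (s := tensorSign D) (fun j => psiBarWord (b j) (t' j))
      fun i j => psiBarWord_mul_psiBarWord _ _ _ _,
    mul_smul_comm, map_smul, fermionIntegral_words,
    prod_ofFn_mul_distrib (s := tensorSign D) (fun i => T (a i)) (fun i => Tbar (b i))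
      fun i j => hT.bar_mul _ _]
  simp only [mul_smul_comm, mul_one, smul_smul]
  congr 1
  set r := ∑ i ∈ Finset.range k, i
  have h1 := tensorSign_pow_add_self D r
  have h2 := tensorSign_pow_add_self D (k * k)
  have h3 : tensorSign D ^ (r + r + k * k + k * k) = 1 := by
    rw [add_assoc, pow_add, pow_add, pow_add, h1, h2, one_mul]
  rw [h3, one_mul, mul_comm]

theorem fermionIntegral_vertices (hT : HasTensorParity T Tbar) {k : ℕ} (t t' : Fin k → ℝ) :
    fermionIntegral D N Y ((List.ofFn fun i => vertex T (t i)).prod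
      * (List.ofFn fun j => vertexBar Tbar (t' j)).prod)
      = ∑ σ : Fin D → Equiv.Perm (Fin k),
        ((∏ c, ∏ i, propagator (t i) (t' (σ c i)) : ℝ) : ℂ)
          • (((∏ c, (((Equiv.Perm.sign (σ c) : ℤˣ) : ℤ) : ℝ) : ℝ) : ℂ)
            • traceInvariant (fun a b => T a * Tbar b) σ) := by
  rw [prod_vertices_expand, map_sum]
  simp only [map_sum, fermionIntegral_word_pair hT, pairing_eq, traceInvariant,
    Finset.smul_sum, Finset.sum_smul]
  rw [Finset.sum_comm' (t' := Finset.univ) (s' := fun _ => Finset.univ) (by simp)]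
  conv_rhs => rw [Finset.sum_comm]
  rw [Finset.sum_comm]
  refine Finset.sum_congr rfl fun a _ => ?_
  rw [Finset.sum_comm]
  refine Finset.sum_congr rfl fun σ _ => Finset.sum_congr rfl fun b _ => ?_
  rw [mul_smul, mul_smul, ite_smul, one_smul, zero_smul]

theorem partitionFunction_eq (hD : 1 ≤ D) (hT : HasTensorParity T Tbar) (β : ℝ) :
    partitionFunction β T Tbar = diagSeries fun k =>
      (1 / (k.factorial * k.factorial : ℂ)) • ∑ σ : Fin D → Equiv.Perm (Fin k),
        (amplitude β σ : ℂ) • traceInvariant (fun a b => T a * Tbar b) σ := by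
  have key : ∀ m n : ℕ, weakIntegral (timeMeasure β m n) (fun t => fermionIntegral D N Y
      ((List.ofFn fun i => vertex T (t.1 i)).prod * (List.ofFn fun j => vertexBar Tbar (t.2 j)).prod))
      = if m = n then ∑ σ : Fin D → Equiv.Perm (Fin m),
        (amplitude β σ : ℂ) • traceInvariant (fun a b => T a * Tbar b) σ else 0 := by
    intro m n
    split_ifs with h
    · subst h
      simp only [fermionIntegral_vertices hT]
      rw [weakIntegral_sum_smul
        (fun (σ : Fin D → Equiv.Perm (Fin m)) (t : (Fin m → ℝ) × (Fin m → ℝ)) =>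
          ((∏ c, ∏ i, propagator (t.1 i) (t.2 (σ c i)) : ℝ) : ℂ)) _
        fun σ => (integrable_prod_propagator β σ).ofReal]
      refine Finset.sum_congr rfl fun σ _ => ?_
      rw [smul_smul, amplitude, integral_complex_ofReal, ← Complex.ofReal_mul, mul_comm]
    · simp only [fermionIntegral_vertices_of_ne hD hT h]
      exact weakIntegral_eq fun l => by simp
  ext d
  rw [coeff_diagSeries]
  have hd : MvPowerSeries.coeff d (partitionFunction β T Tbar)
      = (1 / ((d 0).factorial * (d 1).factorial : ℂ)) •
        weakIntegral (timeMeasure β (d 0) (d 1)) fun t => fermionIntegral D N Y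
          ((List.ofFn fun i => vertex T (t.1 i)).prod
            * (List.ofFn fun j => vertexBar Tbar (t.2 j)).prod) := rfl
  rw [hd, key]
  split_ifs with h
  · rw [← h]
  · rw [smul_zero]

end Partition

/-! ### Multiplicativity of the amplitudes -/

section Amplitude

variable {D : ℕ}

/-- Lebesgue measure on the square `[-β/2, β/2]²`. -/
def squareMeasure (β : ℝ) : Measure (ℝ × ℝ) :=
  (volume.restrict (Set.Icc (-β / 2) (β / 2))).prod (volume.restrict (Set.Icc (-β / 2) (β / 2)))

instance (β : ℝ) : IsFiniteMeasure (squareMeasure β) := by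
  unfold squareMeasure
  infer_instance

/-- The product of the propagators along the edges of a graph with vertices indexed by `α`. -/
def edgeProduct {α : Type} [Fintype α] (σ : Fin D → Equiv.Perm α) (x : α → ℝ × ℝ) : ℝ :=
  ∏ c, ∏ i, propagator (x i).1 (x (σ c i)).2

/-- The amplitude of a graph with vertices indexed by `α`. -/
def graphAmplitude (β : ℝ) {α : Type} [Fintype α] (σ : Fin D → Equiv.Perm α) : ℝ :=
  (∏ c, (((Equiv.Perm.sign (σ c) : ℤˣ) : ℤ) : ℝ)) *
    ∫ x, edgeProduct σ x ∂Measure.pi fun _ : α => squareMeasure β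

/-- Grouping the times in pairs `(τ_i, τ'_i)` makes relabellings and disjoint unions act on a single
index set. -/
theorem amplitude_eq_graphAmplitude {k : ℕ} (β : ℝ) (σ : Fin D → Equiv.Perm (Fin k)) :
    amplitude β σ = graphAmplitude β σ := by
  rw [amplitude, graphAmplitude]
  congr 1
  · refine Finset.prod_congr rfl fun c _ => ?_
    congr!
  · have h := measurePreserving_arrowProdEquivProdArrow ℝ ℝ (Fin k)
      (fun _ => volume.restrict (Set.Icc (-β / 2) (β / 2)))
      (fun _ => volume.restrict (Set.Icc (-β / 2) (β / 2)))
    rw [timeMeasure, ← h.integral_comp']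
    rfl

theorem graphAmplitude_permCongr (β : ℝ) {α α' : Type} [Fintype α] [Fintype α'] (e : α ≃ α')
    (σ : Fin D → Equiv.Perm α) :
    graphAmplitude β (fun c => e.permCongr (σ c)) = graphAmplitude β σ := by
  rw [graphAmplitude, graphAmplitude]
  congr 1
  · simp only [Equiv.Perm.sign_permCongr]
  · have h := measurePreserving_piCongrLeft (fun _ : α' => squareMeasure β) e
    rw [← h.integral_comp']
    congr 1
    funext x
    rw [edgeProduct, edgeProduct]
    refine Finset.prod_congr rfl fun c _ => ?_
    rw [← Equiv.prod_comp e]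
    refine Finset.prod_congr rfl fun i _ => ?_
    have hx : ∀ j, (MeasurableEquiv.piCongrLeft (fun _ : α' => ℝ × ℝ) e) x (e j) = x j :=
      fun j => Equiv.piCongrLeft_apply_apply (fun _ : α' => ℝ × ℝ) e x j
    simp only [Equiv.permCongr_apply, Equiv.symm_apply_apply, hx]

theorem graphAmplitude_sumCongr (β : ℝ) {α α' : Type} [Fintype α] [Fintype α']
    (σ : Fin D → Equiv.Perm α) (σ' : Fin D → Equiv.Perm α') :
    graphAmplitude β (fun c => Equiv.Perm.sumCongr (σ c) (σ' c))
      = graphAmplitude β σ * graphAmplitude β σ' := by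
  rw [graphAmplitude, graphAmplitude, graphAmplitude, mul_mul_mul_comm]
  congr 1
  · rw [← Finset.prod_mul_distrib]
    refine Finset.prod_congr rfl fun c _ => ?_
    refine (congrArg (fun u : ℤˣ => ((u : ℤ) : ℝ))
      (?_ : _ = Equiv.Perm.sign (σ c) * Equiv.Perm.sign (σ' c))).trans ?_
    · convert Equiv.Perm.sign_sumCongr (σ c) (σ' c)
    · push_cast
      rfl
  · have h := measurePreserving_sumPiEquivProdPi (X := fun _ : α ⊕ α' => ℝ × ℝ)
      (fun _ => squareMeasure β)
    rw [← integral_prod_mul, ← h.integral_comp']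
    congr 1
    funext x
    simp only [edgeProduct]
    rw [← Finset.prod_mul_distrib]
    refine Finset.prod_congr rfl fun c _ => ?_
    rw [Fintype.prod_sum_type]
    rfl

/-- The integral is invariant under permuting the times `τ'`, and each of the `D` signatures
contributes a factor `ε(ρ)`. -/
theorem amplitude_mul {k : ℕ} (β : ℝ) (ρ : Equiv.Perm (Fin k)) (σ : Fin D → Equiv.Perm (Fin k)) :
    amplitude β (fun c => ρ * σ c)
      = (((Equiv.Perm.sign ρ : ℤˣ) : ℤ) : ℝ) ^ D * amplitude β σ := by
  rw [amplitude, amplitude, ← mul_assoc]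
  congr 1
  · simp only [Equiv.Perm.sign_mul]
    push_cast
    rw [Finset.prod_mul_distrib, Finset.prod_const, Finset.card_univ, Fintype.card_fin]
  · have h := (MeasurePreserving.id
      (Measure.pi fun _ : Fin k => volume.restrict (Set.Icc (-β / 2) (β / 2)))).prod
      (measurePreserving_piCongrLeft
        (fun _ : Fin k => volume.restrict (Set.Icc (-β / 2) (β / 2))) ρ)
    have he : MeasurableEmbedding (Prod.map id
        (MeasurableEquiv.piCongrLeft (fun _ : Fin k => ℝ) ρ) :
          (Fin k → ℝ) × (Fin k → ℝ) → (Fin k → ℝ) × (Fin k → ℝ)) :=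
      MeasurableEmbedding.id.prodMap (MeasurableEquiv.measurableEmbedding _)
    rw [timeMeasure, ← h.integral_comp he]
    congr 1
    funext x
    refine Finset.prod_congr rfl fun c _ => Finset.prod_congr rfl fun i _ => ?_
    have hx : ∀ j, (MeasurableEquiv.piCongrLeft (fun _ : Fin k => ℝ) ρ) x.2 (ρ j) = x.2 j :=
      fun j => Equiv.piCongrLeft_apply_apply (fun _ : Fin k => ℝ) ρ x.2 j
    exact congrArg (propagator (x.1 i)) (hx (σ c i))

end Amplitude

/-! ### Multiplicativity of the trace invariants -/

section Invariant

variable {D N : ℕ} {E : Type} [CommRing E]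

/-- The trace invariant of a graph with vertices indexed by `α`. -/
def graphInvariant (X : Idx D N → Idx D N → E) {α : Type} [Fintype α]
    (σ : Fin D → Equiv.Perm α) : E :=
  ∑ a : α → Idx D N, ∑ b : α → Idx D N,
    if ∀ c i, a i c = b (σ c i) c then ∏ i, X (a i) (b i) else 0

variable (X : Idx D N → Idx D N → E)

theorem traceInvariant_eq_graphInvariant {k : ℕ} (σ : Fin D → Equiv.Perm (Fin k)) :
    traceInvariant X σ = graphInvariant X σ := by
  rw [traceInvariant, graphInvariant]
  refine Finset.sum_congr ?_ fun a _ => Finset.sum_congr ?_ fun b _ => ?_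
  · congr!
  · congr!
  · rw [List.prod_ofFn]
    congr!

theorem graphInvariant_permCongr {α α' : Type} [Fintype α] [Fintype α'] (e : α ≃ α')
    (σ : Fin D → Equiv.Perm α) :
    graphInvariant X (fun c => e.permCongr (σ c)) = graphInvariant X σ := by
  rw [graphInvariant, graphInvariant]
  refine Fintype.sum_equiv (Equiv.arrowCongr e.symm (Equiv.refl _)) _ _ fun a => ?_
  refine Fintype.sum_equiv (Equiv.arrowCongr e.symm (Equiv.refl _)) _ _ fun b => ?_
  have h1 : (∀ c i, a i c = b (e.permCongr (σ c) i) c)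
      ↔ ∀ c i, a (e i) c = b (e (σ c i)) c := by
    refine forall_congr' fun c => ?_
    rw [← e.forall_congr_right]
    simp
  simp only [h1]
  rw [← Equiv.prod_comp e]
  rfl

theorem sum_arrow_sum {α α' I F : Type} [AddCommMonoid F] {_ : Fintype (α ⊕ α' → I)}
    {_ : Fintype (α → I)} {_ : Fintype (α' → I)} (f : (α ⊕ α' → I) → F) :
    ∑ x, f x = ∑ a, ∑ a', f (Sum.elim a a') := by
  rw [← Equiv.sum_comp (Equiv.sumArrowEquivProdArrow α α' I).symm, Fintype.sum_prod_type]
  rfl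

theorem graphInvariant_sumCongr {α α' : Type} [Fintype α] [Fintype α']
    (σ : Fin D → Equiv.Perm α) (σ' : Fin D → Equiv.Perm α') :
    graphInvariant X (fun c => Equiv.Perm.sumCongr (σ c) (σ' c))
      = graphInvariant X σ * graphInvariant X σ' := by
  rw [graphInvariant, graphInvariant, graphInvariant, Finset.sum_mul_sum, sum_arrow_sum]
  refine Finset.sum_congr rfl fun a _ => Finset.sum_congr rfl fun a' _ => ?_
  rw [Finset.sum_mul_sum, sum_arrow_sum]
  refine Finset.sum_congr rfl fun b _ => Finset.sum_congr rfl fun b' _ => ?_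
  simp only [Sum.forall, Fintype.prod_sum_type, Equiv.Perm.sumCongr_apply, Sum.map_inl,
    Sum.map_inr, Sum.elim_inl, Sum.elim_inr,
    forall_and]
  by_cases h : ∀ c i, a i c = b (σ c i) c
  · by_cases h' : ∀ c i, a' i c = b' (σ' c i) c
    · simp [h, h']
    · simp only [if_neg h', mul_zero]
      rw [if_neg fun hh => h' hh.2]
  · simp only [if_neg h, zero_mul]
    rw [if_neg fun hh => h hh.1]

variable [Algebra ℂ E] {X}

theorem prod_swap (hX : ∀ a b a' b', X a b * X a' b' = tensorSign D • (X a b' * X a' b)) {k : ℕ}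
    (a b : Fin k → Idx D N) {x y : Fin k} (hxy : x ≠ y) :
    ∏ i, X (a i) (b (Equiv.swap x y i)) = tensorSign D • ∏ i, X (a i) (b i) := by
  rw [← Finset.prod_mul_prod_compl {x, y}, ← Finset.prod_mul_prod_compl {x, y},
    Finset.prod_pair hxy, Finset.prod_pair hxy, Equiv.swap_apply_left, Equiv.swap_apply_right, hX,
    smul_mul_assoc]
  congr 2
  refine Finset.prod_congr rfl fun i hi => ?_
  simp only [Finset.mem_compl, Finset.mem_insert, Finset.mem_singleton, not_or] at hi
  rw [Equiv.swap_apply_of_ne_of_ne hi.1 hi.2]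

/-- By induction on transpositions: each exchange of two `T̄` labels costs `(-1)^D`. The hypothesis
`hX` treats bosonic and Grassmann tensors uniformly. -/
theorem prod_perm (hX : ∀ a b a' b', X a b * X a' b' = tensorSign D • (X a b' * X a' b)) {k : ℕ}
    (a b : Fin k → Idx D N) (ρ : Equiv.Perm (Fin k)) :
    ∏ i, X (a i) (b (ρ i))
      = (((Equiv.Perm.sign ρ : ℤˣ) : ℤ) : ℂ) ^ D • ∏ i, X (a i) (b i) := by
  induction ρ using Equiv.Perm.swap_induction_on generalizing b with
  | one => simp
  | swap_mul f x y hxy ih =>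
    have h := ih fun i => b (Equiv.swap x y i)
    simp only [Equiv.Perm.mul_apply]
    rw [h, prod_swap hX a b hxy, smul_smul, Equiv.Perm.sign_mul, Equiv.Perm.sign_swap hxy]
    congr 1
    push_cast
    rw [mul_pow, mul_comm, tensorSign]

theorem traceInvariant_mul
    (hX : ∀ a b a' b', X a b * X a' b' = tensorSign D • (X a b' * X a' b)) {k : ℕ}
    (ρ : Equiv.Perm (Fin k)) (σ : Fin D → Equiv.Perm (Fin k)) :
    traceInvariant X (fun c => ρ * σ c)
      = (((Equiv.Perm.sign ρ : ℤˣ) : ℤ) : ℂ) ^ D • traceInvariant X σ := by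
  rw [traceInvariant, traceInvariant, Finset.smul_sum]
  refine Finset.sum_congr rfl fun a _ => ?_
  rw [Finset.smul_sum, ← Equiv.sum_comp (Equiv.arrowCongr ρ (Equiv.refl (Idx D N)))]
  refine Finset.sum_congr rfl fun b _ => ?_
  simp only [Equiv.arrowCongr_apply, Equiv.coe_refl, Function.comp_apply, id_eq,
    Equiv.Perm.mul_apply, Equiv.symm_apply_apply, List.prod_ofFn]
  rw [smul_ite, smul_zero, ← prod_perm hX a b ρ]
  have h := prod_perm hX a (fun i => b (ρ.symm i)) ρ
  simp only [Equiv.symm_apply_apply] at h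
  have h' := prod_perm hX a b ρ
  have h'' := prod_perm hX a b ρ⁻¹
  rw [Equiv.Perm.sign_inv, ← h'] at h''
  rw [← h'']
  rfl

end Invariant

/-! ### The logarithm of the partition function -/

section Log

variable {D N : ℕ} {E : Type} [CommRing E] [Algebra ℂ E]

/-- The weight of a graph: the product of its amplitude and its trace invariant. -/
def graphWeight (β : ℝ) (X : Idx D N → Idx D N → E) : MultiplicativeWeight (Fin D) E where
  toFun α _ σ := (graphAmplitude β σ : ℂ) • graphInvariant X σ
  map_permCongr α α' _ _ e σ := by
    rw [graphAmplitude_permCongr, graphInvariant_permCongr]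
  map_sumCongr α α' _ _ σ σ' := by
    rw [graphAmplitude_sumCongr, graphInvariant_sumCongr, smul_mul_smul_comm]
    push_cast
    rfl

/-- The restriction of a weight to the tuples whose first permutation is the identity. -/
def MultiplicativeWeight.tail {n : ℕ} (W : MultiplicativeWeight (Fin (n + 1)) E) :
    MultiplicativeWeight (Fin n) E where
  toFun α _ τ := W.toFun α (Fin.cons 1 τ)
  map_permCongr α α' _ _ e τ := by
    rw [← W.map_permCongr α α' e]
    congr 1
    funext c
    refine Fin.cases ?_ (fun c => ?_) c
    · ext x
      simp
    · rfl
  map_sumCongr α α' _ _ τ τ' := by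
    rw [← W.map_sumCongr]
    congr 1
    funext c
    refine Fin.cases ?_ (fun c => ?_) c
    · ext x
      rcases x with x | x <;> simp
    · rfl

theorem graphWeight_apply (β : ℝ) (X : Idx D N → Idx D N → E) {k : ℕ}
    (σ : Fin D → Equiv.Perm (Fin k)) :
    (graphWeight β X).toFun (Fin k) σ = (amplitude β σ : ℂ) • traceInvariant X σ := by
  rw [amplitude_eq_graphAmplitude, traceInvariant_eq_graphInvariant]
  rfl

theorem amplitude_zero (β : ℝ) (σ : Fin D → Equiv.Perm (Fin 0)) : amplitude β σ = 1 := by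
  rw [amplitude, timeMeasure, Measure.pi_of_empty _ (fun i => i.elim0), Measure.dirac_prod_dirac]
  simp only [Finset.univ_eq_empty, Finset.prod_empty, Finset.prod_const_one, integral_const,
    probReal_univ, smul_eq_mul, mul_one]
  refine Finset.prod_eq_one fun c _ => ?_
  rw [Subsingleton.elim (σ c) 1]
  simp

theorem traceInvariant_zero (X : Idx D N → Idx D N → E) (σ : Fin D → Equiv.Perm (Fin 0)) :
    traceInvariant X σ = 1 := by
  rw [traceInvariant]
  simp

/-- The amplitude and the trace invariant both acquire `ε(ρ)^D`, and these signs square to `1`. -/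
theorem amplitude_smul_traceInvariant_mul (β : ℝ) {X : Idx D N → Idx D N → E}
    (hX : ∀ a b a' b', X a b * X a' b' = tensorSign D • (X a b' * X a' b)) {k : ℕ}
    (ρ : Equiv.Perm (Fin k)) (σ : Fin D → Equiv.Perm (Fin k)) :
    (amplitude β (fun c => ρ * σ c) : ℂ) • traceInvariant X (fun c => ρ * σ c)
      = (amplitude β σ : ℂ) • traceInvariant X σ := by
  rw [amplitude_mul, traceInvariant_mul hX, smul_smul]
  congr 1
  push_cast
  have h : ((((Equiv.Perm.sign ρ : ℤˣ) : ℤ) : ℂ) ^ D) * (((Equiv.Perm.sign ρ : ℤˣ) : ℤ) : ℂ) ^ D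
      = 1 := by
    rw [← mul_pow]
    have : (((Equiv.Perm.sign ρ : ℤˣ) : ℤ) : ℂ) * (((Equiv.Perm.sign ρ : ℤˣ) : ℤ) : ℂ) = 1 := by
      rcases Int.units_eq_one_or (Equiv.Perm.sign ρ) with h | h <;> rw [h] <;> simp
    rw [this, one_pow]
  rw [mul_right_comm, h, one_mul]

theorem MultiplicativeWeight.tail_apply {n : ℕ} (W : MultiplicativeWeight (Fin (n + 1)) E)
    {α : Type} [Fintype α] (τ : Fin n → Equiv.Perm α) :
    W.tail.toFun α τ = W.toFun α (Fin.cons 1 τ) := rfl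

theorem tail_graphWeight_total {n : ℕ} (β : ℝ) (X : Idx (n + 1) N → Idx (n + 1) N → E) (k : ℕ) :
    (graphWeight β X).tail.total (Fin k) = ∑ τ : Fin n → Equiv.Perm (Fin k),
      (amplitude β (Fin.cons 1 τ : Fin (n + 1) → Equiv.Perm (Fin k)) : ℂ)
        • traceInvariant X (Fin.cons 1 τ : Fin (n + 1) → Equiv.Perm (Fin k)) := by
  rw [MultiplicativeWeight.total]
  refine Finset.sum_congr (by ext τ; simp) fun τ _ => ?_
  rw [MultiplicativeWeight.tail_apply, graphWeight_apply]

theorem tail_graphWeight_transitiveTotal {n : ℕ} (β : ℝ)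
    (X : Idx (n + 1) N → Idx (n + 1) N → E) (k : ℕ) :
    (graphWeight β X).tail.transitiveTotal (Fin k)
      = ∑ τ : Fin n → Equiv.Perm (Fin k) with IsTransitive τ,
      (amplitude β (Fin.cons 1 τ : Fin (n + 1) → Equiv.Perm (Fin k)) : ℂ)
        • traceInvariant X (Fin.cons 1 τ : Fin (n + 1) → Equiv.Perm (Fin k)) := by
  rw [MultiplicativeWeight.transitiveTotal]
  refine Finset.sum_congr (by ext τ; simp) fun τ _ => ?_
  rw [MultiplicativeWeight.tail_apply, graphWeight_apply]

theorem factorial_smul_factorial (k : ℕ) (e : E) :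
    (1 / (k.factorial * k.factorial : ℂ)) • k.factorial • e = (1 / (k.factorial : ℂ)) • e := by
  rw [← Nat.cast_smul_eq_nsmul ℂ, smul_smul]
  congr 1
  have : (k.factorial : ℂ) ≠ 0 := by exact_mod_cast k.factorial_ne_zero
  field_simp

theorem sum_graphs_eq_total {n : ℕ} (β : ℝ) {X : Idx (n + 1) N → Idx (n + 1) N → E}
    (hX : ∀ a b a' b', X a b * X a' b' = tensorSign (n + 1) • (X a b' * X a' b)) (k : ℕ) :
    (1 / (k.factorial * k.factorial : ℂ)) •
      ∑ σ : Fin (n + 1) → Equiv.Perm (Fin k), (amplitude β σ : ℂ) • traceInvariant X σ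
      = (1 / (k.factorial : ℂ)) • (graphWeight β X).tail.total (Fin k) := by
  rw [sum_eq_factorial_smul (fun σ => (amplitude β σ : ℂ) • traceInvariant X σ)
    (amplitude_smul_traceInvariant_mul β hX), factorial_smul_factorial, tail_graphWeight_total]

theorem sum_connected_graphs_eq_transitiveTotal {n : ℕ} (β : ℝ)
    {X : Idx (n + 1) N → Idx (n + 1) N → E}
    (hX : ∀ a b a' b', X a b * X a' b' = tensorSign (n + 1) • (X a b' * X a' b)) (k : ℕ) :
    (1 / (k.factorial * k.factorial : ℂ)) •
      ∑ σ : Fin (n + 1) → Equiv.Perm (Fin k) with (coloredGraph σ).Connected,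
        (amplitude β σ : ℂ) • traceInvariant X σ
      = (1 / (k.factorial : ℂ)) • (graphWeight β X).tail.transitiveTotal (Fin k) := by
  rw [sum_connected_eq_factorial_smul (fun σ => (amplitude β σ : ℂ) • traceInvariant X σ)
    (amplitude_smul_traceInvariant_mul β hX), factorial_smul_factorial,
    tail_graphWeight_transitiveTotal]

/-- The logarithm of the partition function is the sum over the connected graphs. -/
theorem formalLog_sum_graphs (hD : 1 ≤ D) (β : ℝ) {X : Idx D N → Idx D N → E}
    (hX : ∀ a b a' b', X a b * X a' b' = tensorSign D • (X a b' * X a' b)) :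
    formalLog (diagSeries fun k => (1 / (k.factorial * k.factorial : ℂ)) •
        ∑ σ : Fin D → Equiv.Perm (Fin k), (amplitude β σ : ℂ) • traceInvariant X σ)
      = diagSeries fun k => (1 / (k.factorial * k.factorial : ℂ)) •
        ∑ σ : Fin D → Equiv.Perm (Fin k) with (coloredGraph σ).Connected,
          (amplitude β σ : ℂ) • traceInvariant X σ := by
  obtain ⟨n, rfl⟩ := Nat.exists_eq_add_of_le' hD
  have h0 : (graphWeight β X).tail.total (Fin 0) = 1 := by
    simp [tail_graphWeight_total, amplitude_zero, traceInvariant_zero]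
  rw [funext (sum_graphs_eq_total β hX), funext (sum_connected_graphs_eq_transitiveTotal β hX)]
  exact (graphWeight β X).tail.formalLog_total h0

end Log

/-! ### Counting the free indices -/

section Counting

variable {D N k : ℕ}

theorem sameCycle_eq {γ : Type} {p : Equiv.Perm (Fin k)} {x : Fin k → γ} (h : ∀ i, x i = x (p i))
    {i j : Fin k} (hij : Equiv.Perm.SameCycle p i j) : x i = x j :=
  sameCycle_le (S := Setoid.ker x) (fun z => h z) hij

/-- The tuples of indices which are constant along the cycles of permutations. -/
def invariantIndexEquiv (p : Fin D → Equiv.Perm (Fin k)) :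
    {a : Fin k → Idx D N // ∀ c i, a i c = a (p c i) c}
      ≃ ∀ c : Fin D, Quotient (Equiv.Perm.SameCycle.setoid (p c)) → Fin N where
  toFun a c := Quotient.lift (fun i => a.1 i c) fun _ _ h =>
    sameCycle_eq (x := fun i => a.1 i c) (a.2 c) h
  invFun f := ⟨fun i c => f c ⟦i⟧, fun c i =>
    congrArg (f c) (Quotient.sound (sameCycle_rel (p c) i))⟩
  left_inv a := rfl
  right_inv f := by
    funext c q
    induction q using Quotient.ind
    rfl

theorem card_invariantIndex (p : Fin D → Equiv.Perm (Fin k)) :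
    (Finset.univ.filter fun a : Fin k → Idx D N => ∀ c i, a i c = a (p c i) c).card
      = ∏ c, N ^ cycleCount (p c) := by
  rw [← Fintype.card_subtype, ← Nat.card_eq_fintype_card, Nat.card_congr (invariantIndexEquiv p),
    Nat.card_pi]
  refine Finset.prod_congr rfl fun c _ => ?_
  rw [Nat.card_fun, Nat.card_fin]
  rfl

/-- The edges of color `0` force `b = a ∘ σ₀⁻¹`; the index `a^c` is then constant on the cycles of
`σ₀⁻¹ σ_c`, which leaves one free value in `Fin N` per face `0c`. -/
theorem sum_index_indicator (σ₀ : Equiv.Perm (Fin k)) (σ : Fin D → Equiv.Perm (Fin k)) :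
    (∑ a : Fin k → Idx D N, ∑ b : Fin k → Idx D N, if ∀ c i, a i c = b (σ c i) c then
      (if ∀ i, a i = b (σ₀ i) then 1 else 0) else 0 : ℂ)
      = ∏ c : Fin D, (N : ℂ) ^ numFaces (withColorZero σ₀ σ) 0 c.succ := by
  have h1 : ∀ a : Fin k → Idx D N, (∑ b : Fin k → Idx D N, if ∀ c i, a i c = b (σ c i) c then
      (if ∀ i, a i = b (σ₀ i) then 1 else 0) else 0 : ℂ)
      = if ∀ c i, a i c = a ((σ₀⁻¹ * σ c) i) c then 1 else 0 := by
    intro a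
    rw [Finset.sum_eq_single fun i => a (σ₀⁻¹ i)]
    · have : ∀ i, a i = a (σ₀⁻¹ (σ₀ i)) := fun i => by simp
      simp only [Equiv.Perm.mul_apply]
      rw [if_pos this]
      congr!
    · intro b _ hb
      have : ¬∀ i, a i = b (σ₀ i) := fun h => hb (funext fun i => by rw [h]; simp)
      rw [if_neg this, ite_self]
    · simp
  rw [Finset.sum_congr rfl fun a _ => h1 a, Finset.sum_boole, card_invariantIndex]
  push_cast
  refine Finset.prod_congr rfl fun c _ => ?_
  rw [numFaces_eq']
  rfl

/-- The factor `N^{-(D-1)k + ∑_c F^{0c}}`. -/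
def faceFactor (N : ℕ) (σ₀ : Equiv.Perm (Fin k)) (σ : Fin D → Equiv.Perm (Fin k)) : ℝ :=
  (((N : ℝ) ^ (D - 1)) ^ k)⁻¹ * ∏ c : Fin D, (N : ℝ) ^ numFaces (withColorZero σ₀ σ) 0 c.succ

/-- The Gaussian moment of a product of `k` components `T_{a_i}` and `k` components `T̄_{b_i}`. -/
def gaussianMoment (a b : Fin k → Idx D N) : ℂ :=
  (((N : ℂ) ^ (D - 1)) ^ k)⁻¹ * ∑ σ₀ : Equiv.Perm (Fin k),
    (((Equiv.Perm.sign σ₀ : ℤˣ) : ℤ) : ℂ) ^ D * if ∀ i, a i = b (σ₀ i) then 1 else 0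

theorem sum_gaussianMoment (σ : Fin D → Equiv.Perm (Fin k)) :
    (∑ a : Fin k → Idx D N, ∑ b : Fin k → Idx D N,
      if ∀ c i, a i c = b (σ c i) c then gaussianMoment a b else 0)
      = ∑ σ₀ : Equiv.Perm (Fin k),
        (((Equiv.Perm.sign σ₀ : ℤˣ) : ℤ) : ℂ) ^ D * (faceFactor N σ₀ σ : ℂ) := by
  have h : ∀ a b : Fin k → Idx D N,
      (if ∀ c i, a i c = b (σ c i) c then gaussianMoment a b else 0)
      = ∑ σ₀ : Equiv.Perm (Fin k), (((N : ℂ) ^ (D - 1)) ^ k)⁻¹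
        * (((Equiv.Perm.sign σ₀ : ℤˣ) : ℤ) : ℂ) ^ D
        * (if ∀ c i, a i c = b (σ c i) c then (if ∀ i, a i = b (σ₀ i) then 1 else 0) else 0) := by
    intro a b
    split_ifs with hab
    · rw [gaussianMoment, Finset.mul_sum]
      exact Finset.sum_congr rfl fun _ _ => by ring
    · simp
  simp only [h]
  rw [Finset.sum_congr rfl fun a _ => Finset.sum_comm, Finset.sum_comm]
  refine Finset.sum_congr rfl fun σ₀ _ => ?_
  rw [faceFactor]
  push_cast
  rw [← sum_index_indicator σ₀ σ]
  simp only [Finset.mul_sum]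
  exact Finset.sum_congr rfl fun _ _ => Finset.sum_congr rfl fun _ _ => by ring

theorem faceFactor_mul (ρ σ₀ : Equiv.Perm (Fin k)) (σ : Fin D → Equiv.Perm (Fin k)) :
    faceFactor N (ρ * σ₀) (fun c => ρ * σ c) = faceFactor N σ₀ σ := by
  rw [faceFactor, faceFactor]
  congr 1
  refine Finset.prod_congr rfl fun c _ => ?_
  congr 1
  rw [numFaces_eq', numFaces_eq']
  change cycleCount ((ρ * σ₀)⁻¹ * (ρ * σ c)) = cycleCount (σ₀⁻¹ * σ c)
  congr 1
  group

end Counting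

/-! ### The annealed free energy -/

section Annealed

variable {D : ℕ}

/-- The contribution of a graph with colors `0, …, D` to the averaged partition function. -/
def annealedWeight (N : ℕ) (β : ℝ) {k : ℕ} (σ : Fin (D + 1) → Equiv.Perm (Fin k)) : ℂ :=
  (amplitude β (Fin.tail σ) : ℂ) * ((((Equiv.Perm.sign (σ 0) : ℤˣ) : ℤ) : ℂ) ^ D
    * (faceFactor N (σ 0) (Fin.tail σ) : ℂ))

theorem sign_mul_self_cast {k : ℕ} (ρ : Equiv.Perm (Fin k)) :
    (((Equiv.Perm.sign ρ : ℤˣ) : ℤ) : ℂ) * (((Equiv.Perm.sign ρ : ℤˣ) : ℤ) : ℂ) = 1 := by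
  rcases Int.units_eq_one_or (Equiv.Perm.sign ρ) with h | h <;> rw [h] <;> simp

theorem annealedWeight_mul (N : ℕ) (β : ℝ) {k : ℕ} (ρ : Equiv.Perm (Fin k))
    (σ : Fin (D + 1) → Equiv.Perm (Fin k)) :
    annealedWeight N β (fun c => ρ * σ c) = annealedWeight N β σ := by
  have h1 : Fin.tail (fun c => ρ * σ c) = fun c => ρ * Fin.tail σ c := rfl
  rw [annealedWeight, annealedWeight, h1, amplitude_mul, faceFactor_mul, Equiv.Perm.sign_mul]
  push_cast
  have h2 : ((((Equiv.Perm.sign ρ : ℤˣ) : ℤ) : ℂ)) ^ D * (((Equiv.Perm.sign ρ : ℤˣ) : ℤ) : ℂ) ^ D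
      = 1 := by rw [← mul_pow, sign_mul_self_cast, one_pow]
  rw [mul_pow]
  linear_combination (amplitude β (Fin.tail σ) : ℂ) * ((((Equiv.Perm.sign (σ 0) : ℤˣ) : ℤ) : ℂ) ^ D
    * (faceFactor N (σ 0) (Fin.tail σ) : ℂ)) * h2

/-- The covariance of the random tensor. -/
def tensorCov (D N : ℕ) (a b : Idx D N) : ℂ := if a = b then ((N : ℂ) ^ (D - 1))⁻¹ else 0

/-- With `σ⁽⁰⁾ = 1` the average only pairs `T_{a_i}` with `T̄_{b_i}`. The face factor is therefore
itself a trace invariant, and its multiplicativity comes for free. -/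
theorem traceInvariant_tensorCov {N k : ℕ} (σ : Fin D → Equiv.Perm (Fin k)) :
    traceInvariant (tensorCov D N) σ = (faceFactor N 1 σ : ℂ) := by
  rw [traceInvariant, faceFactor]
  push_cast
  rw [← sum_index_indicator 1 σ, Finset.mul_sum]
  refine Finset.sum_congr rfl fun a _ => ?_
  rw [Finset.mul_sum]
  refine Finset.sum_congr rfl fun b _ => ?_
  rw [mul_ite, mul_zero, List.prod_ofFn]
  congr 1
  by_cases h : ∀ i, a i = b i
  · have h' : ∀ i, a i = b ((1 : Equiv.Perm (Fin k)) i) := h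
    rw [if_pos h']
    simp [tensorCov, h]
  · have h' : ¬∀ i, a i = b ((1 : Equiv.Perm (Fin k)) i) := h
    rw [if_neg h', mul_zero]
    push Not at h
    obtain ⟨i, hi⟩ := h
    exact Finset.prod_eq_zero (Finset.mem_univ i) (if_neg hi)

theorem annealedWeight_cons_one (N : ℕ) (β : ℝ) {k : ℕ} (τ : Fin D → Equiv.Perm (Fin k)) :
    annealedWeight N β (Fin.cons 1 τ : Fin (D + 1) → Equiv.Perm (Fin k))
      = (graphWeight β (tensorCov D N)).toFun (Fin k) τ := by
  rw [graphWeight_apply, traceInvariant_tensorCov, annealedWeight]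
  simp

/-- The normalized permutation is that of color `0`, so the exponential formula is applied to the
`D` remaining colors directly. -/
theorem formalLog_annealed (N : ℕ) (β : ℝ) :
    formalLog (diagSeries fun k => (1 / (k.factorial * k.factorial : ℂ)) •
        ∑ σ : Fin (D + 1) → Equiv.Perm (Fin k), annealedWeight N β σ)
      = diagSeries fun k => (1 / (k.factorial * k.factorial : ℂ)) •
        ∑ σ : Fin (D + 1) → Equiv.Perm (Fin k) with (coloredGraph σ).Connected,
          annealedWeight N β σ := by
  have h1 : ∀ k : ℕ, (1 / (k.factorial * k.factorial : ℂ)) •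
      ∑ σ : Fin (D + 1) → Equiv.Perm (Fin k), annealedWeight N β σ
      = (1 / (k.factorial : ℂ)) • (graphWeight β (tensorCov D N)).total (Fin k) := by
    intro k
    rw [sum_eq_factorial_smul _ (annealedWeight_mul N β), factorial_smul_factorial,
      MultiplicativeWeight.total]
    refine congrArg ((1 / (k.factorial : ℂ)) • ·) ?_
    exact Finset.sum_congr (by ext τ; simp) fun τ _ => annealedWeight_cons_one N β τ
  have h2 : ∀ k : ℕ, (1 / (k.factorial * k.factorial : ℂ)) •
      ∑ σ : Fin (D + 1) → Equiv.Perm (Fin k) with (coloredGraph σ).Connected, annealedWeight N β σ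
      = (1 / (k.factorial : ℂ)) • (graphWeight β (tensorCov D N)).transitiveTotal (Fin k) := by
    intro k
    rw [sum_connected_eq_factorial_smul _ (annealedWeight_mul N β), factorial_smul_factorial,
      MultiplicativeWeight.transitiveTotal]
    refine congrArg ((1 / (k.factorial : ℂ)) • ·) ?_
    exact Finset.sum_congr (by ext τ; simp) fun τ _ => annealedWeight_cons_one N β τ
  rw [funext h1, funext h2]
  refine (graphWeight β (tensorCov D N)).formalLog_total ?_
  rw [MultiplicativeWeight.total]
  have h3 : ∀ τ : Fin D → Equiv.Perm (Fin 0),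
      (graphWeight β (tensorCov D N)).toFun (Fin 0) τ = 1 := by
    intro τ
    rw [graphWeight_apply, amplitude_zero, traceInvariant_zero, Complex.ofReal_one, one_smul]
  simp only [h3]
  simp

theorem not_connected_of_zero {m : ℕ} (σ : Fin m → Equiv.Perm (Fin 0)) :
    ¬(coloredGraph σ).Connected := fun h => by
  obtain ⟨i | i⟩ := h.nonempty <;> exact i.elim0

theorem couplingSeries_eq {u v : ℕ → ℂ} (h0 : v 0 = 0) (h : ∀ k, 1 ≤ k → v k = u k) :
    diagSeries v = couplingSeries u := by
  ext d
  rw [coeff_diagSeries]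
  change _ = if d 0 = d 1 ∧ 1 ≤ d 0 then u (d 0) else 0
  by_cases hd : d 0 = d 1
  · by_cases h1 : 1 ≤ d 0
    · rw [if_pos hd, if_pos ⟨hd, h1⟩, h _ h1]
    · rw [if_pos hd, if_neg fun hh => h1 hh.2, show d 0 = 0 by omega, h0]
  · rw [if_neg hd, if_neg fun hh => hd hh.1]

theorem sum_annealedWeight (N : ℕ) (β : ℝ) (k : ℕ) :
    ∑ σ : Fin (D + 1) → Equiv.Perm (Fin k), annealedWeight N β σ
      = ∑ σ : Fin D → Equiv.Perm (Fin k), (amplitude β σ : ℂ) * ∑ σ₀ : Equiv.Perm (Fin k),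
        (((Equiv.Perm.sign σ₀ : ℤˣ) : ℤ) : ℂ) ^ D * (faceFactor N σ₀ σ : ℂ) := by
  rw [← Equiv.sum_comp (Fin.consEquiv fun _ : Fin (D + 1) => Equiv.Perm (Fin k)),
    Fintype.sum_prod_type, Finset.sum_comm]
  simp only [Finset.mul_sum]
  rfl

theorem graphTerm_annealed {N k : ℕ} (hD : 2 ≤ D) (hN : 1 ≤ N) (β : ℝ) (σ₀ : Equiv.Perm (Fin k))
    (σ : Fin D → Equiv.Perm (Fin k)) (h : (coloredGraph (withColorZero σ₀ σ)).Connected) :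
    (graphTerm N β σ₀ σ (annealedExponent σ₀ σ) : ℂ) = annealedWeight N β (withColorZero σ₀ σ) := by
  rw [graphTerm, rpow_annealedExponent hD hN σ₀ σ h]
  rw [annealedWeight, ← faceFactor]
  push_cast
  exact mul_assoc _ _ _

end Annealed

/-! ### Moments of the complex Gaussian tensor -/

/-- The density of the complex Gaussian distribution with covariance `1 / l`. -/
def complexGaussianDensity (l : ℝ) (z : ℂ) : ℝ := l / Real.pi * Real.exp (-l * ‖z‖ ^ 2)

theorem integral_norm_pow_mul_density {l : ℝ} (hl : 0 < l) (n : ℕ) :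
    ∫ z : ℂ, complexGaussianDensity l z * ‖z‖ ^ n
      = l * (l ^ (-((n : ℝ) + 2) / 2) * Real.Gamma (((n : ℝ) + 2) / 2)) := by
  have h := Complex.integral_rpow_mul_exp_neg_mul_rpow (p := 2) (q := n) (b := l) (by norm_num)
    (by have := Nat.cast_nonneg (α := ℝ) n; linarith) hl
  have h1 : ∀ z : ℂ, complexGaussianDensity l z * ‖z‖ ^ n
      = l / Real.pi * (‖z‖ ^ (n : ℝ) * Real.exp (-l * ‖z‖ ^ (2 : ℝ))) := by
    intro z
    rw [complexGaussianDensity, Real.rpow_natCast, Real.rpow_two]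
    ring
  simp only [h1]
  rw [integral_const_mul, h]
  have := Real.pi_ne_zero
  field_simp

/-- A non-integrable function has Bochner integral `0`, whereas the value found is positive. -/
theorem integrable_norm_pow_mul_density {l : ℝ} (hl : 0 < l) (n : ℕ) :
    Integrable fun z : ℂ => complexGaussianDensity l z * ‖z‖ ^ n := by
  by_contra h
  have h1 := integral_norm_pow_mul_density hl n
  rw [integral_undef h] at h1
  have h2 : 0 < Real.Gamma (((n : ℝ) + 2) / 2) := Real.Gamma_pos_of_pos (by positivity)
  have h3 : 0 < l ^ (-((n : ℝ) + 2) / 2) := Real.rpow_pos_of_pos hl _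
  exact absurd h1 (by positivity)

theorem continuous_complexGaussianDensity (l : ℝ) : Continuous (complexGaussianDensity l) := by
  unfold complexGaussianDensity
  fun_prop

theorem complexGaussianDensity_nonneg {l : ℝ} (hl : 0 < l) (z : ℂ) :
    0 ≤ complexGaussianDensity l z := by
  unfold complexGaussianDensity
  positivity

theorem integrable_monomial {l : ℝ} (hl : 0 < l) (n m : ℕ) :
    Integrable fun z : ℂ =>
      (complexGaussianDensity l z : ℂ) * (z ^ n * (starRingEnd ℂ z) ^ m) := by
  refine (integrable_norm_pow_mul_density hl (n + m)).mono' ?_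
    (Filter.Eventually.of_forall fun z => ?_)
  · refine Continuous.aestronglyMeasurable ?_
    have h1 := Complex.continuous_ofReal.comp (continuous_complexGaussianDensity l)
    have h2 := Complex.continuous_conj
    exact h1.mul ((continuous_id.pow n).mul (h2.pow m))
  · rw [norm_mul, norm_mul, norm_pow, norm_pow, RCLike.norm_conj, ← pow_add, Complex.norm_real,
      Real.norm_of_nonneg (complexGaussianDensity_nonneg hl z)]

/-- Rotation by the angle `π / (n - m)` preserves the Gaussian measure and changes the sign of the
monomial. -/
theorem integral_monomial_of_ne (l : ℝ) {n m : ℕ} (h : n ≠ m) :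
    ∫ z : ℂ, (complexGaussianDensity l z : ℂ) * (z ^ n * (starRingEnd ℂ z) ^ m) = 0 := by
  have hnm : (n : ℝ) - m ≠ 0 := sub_ne_zero.mpr (by exact_mod_cast h)
  set u : Circle := Circle.exp (Real.pi / (n - m)) with hu
  have hrot := (rotation u).measurePreserving.integral_comp'
    (f := (rotation u).toHomeomorph.toMeasurableEquiv)
    (fun z : ℂ => (complexGaussianDensity l z : ℂ) * (z ^ n * (starRingEnd ℂ z) ^ m))
  have hu1 : (u : ℂ) ^ n * (starRingEnd ℂ (u : ℂ)) ^ m = -1 := by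
    rw [hu, Circle.coe_exp, ← Complex.exp_conj, ← Complex.exp_nat_mul, ← Complex.exp_nat_mul,
      ← Complex.exp_add, ← Complex.exp_pi_mul_I]
    congr 1
    have hnm' : (n : ℂ) - m ≠ 0 := by exact_mod_cast hnm
    simp only [map_mul, Complex.conj_I, Complex.conj_ofReal]
    push_cast
    field_simp
    ring
  have h1 : ∀ z : ℂ, (complexGaussianDensity l (rotation u z) : ℂ)
      * ((rotation u z) ^ n * (starRingEnd ℂ (rotation u z)) ^ m)
      = -((complexGaussianDensity l z : ℂ) * (z ^ n * (starRingEnd ℂ z) ^ m)) := by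
    intro z
    rw [complexGaussianDensity, LinearIsometryEquiv.norm_map, ← complexGaussianDensity,
      rotation_apply, map_mul, mul_pow, mul_pow]
    linear_combination (complexGaussianDensity l z : ℂ) * (z ^ n * (starRingEnd ℂ z) ^ m) * hu1
  have h2 : ∫ z : ℂ, -((complexGaussianDensity l z : ℂ) * (z ^ n * (starRingEnd ℂ z) ^ m))
      = ∫ z : ℂ, (complexGaussianDensity l z : ℂ) * (z ^ n * (starRingEnd ℂ z) ^ m) := by
    rw [← hrot]
    exact integral_congr_ae (Filter.Eventually.of_forall fun z => (h1 z).symm)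
  rw [integral_neg] at h2
  exact self_eq_neg.mp h2.symm

theorem integral_monomial_self {l : ℝ} (hl : 0 < l) (n : ℕ) :
    ∫ z : ℂ, (complexGaussianDensity l z : ℂ) * (z ^ n * (starRingEnd ℂ z) ^ n)
      = (n.factorial : ℂ) * ((l : ℂ) ^ n)⁻¹ := by
  have h1 : ∀ z : ℂ, (complexGaussianDensity l z : ℂ) * (z ^ n * (starRingEnd ℂ z) ^ n)
      = ((complexGaussianDensity l z * ‖z‖ ^ (2 * n) : ℝ) : ℂ) := by
    intro z
    rw [← mul_pow, Complex.mul_conj, Complex.normSq_eq_norm_sq, pow_mul]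
    push_cast
    rfl
  simp only [h1]
  rw [integral_complex_ofReal, integral_norm_pow_mul_density hl]
  have h2 : ((2 * n : ℕ) + 2 : ℝ) / 2 = n + 1 := by push_cast; ring
  have h3 : -((2 * n : ℕ) + 2 : ℝ) / 2 = -((n + 1 : ℕ) : ℝ) := by push_cast; ring
  rw [h2, h3, Real.Gamma_nat_eq_factorial, Real.rpow_neg hl.le, Real.rpow_natCast, pow_succ]
  have : (l : ℂ) ≠ 0 := by exact_mod_cast hl.ne'
  push_cast
  field_simp

/-! ### Permutations matching two sequences of indices -/

section Permutations

variable {k : ℕ} {I : Type} [Fintype I]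

/-- The multiplicity of an index. -/
def multiplicity (a : Fin k → I) (x : I) : ℕ := (Finset.univ.filter fun i => a i = x).card

theorem prod_eq_prod_pow {M : Type} [CommMonoid M] (a : Fin k → I) (f : I → M) :
    ∏ i, f (a i) = ∏ x, f x ^ multiplicity a x := by
  rw [← Finset.prod_fiberwise_of_maps_to (s := Finset.univ) (t := Finset.univ) (g := a)
    fun _ _ => Finset.mem_univ _]
  refine Finset.prod_congr rfl fun x _ => ?_
  rw [multiplicity, ← Finset.prod_const]
  exact Finset.prod_congr rfl fun i hi => by rw [(Finset.mem_filter.mp hi).2]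

theorem sum_multiplicity (a : Fin k → I) : ∑ x, multiplicity a x = k := by
  have := Finset.card_eq_sum_card_fiberwise (f := a) (s := Finset.univ) (t := Finset.univ)
    fun _ _ => Finset.mem_univ _
  rw [Finset.card_univ, Fintype.card_fin] at this
  exact this.symm

/-- If the multiplicities agree, the matchings form a coset of the stabilizer of `a`, a product of
symmetric groups of the fibers; otherwise there are none. -/
theorem card_matchings (a b : Fin k → I) :
    (Finset.univ.filter fun σ : Equiv.Perm (Fin k) => ∀ i, a i = b (σ i)).card
      = ∏ x, if multiplicity a x = multiplicity b x then (multiplicity a x).factorial else 0 := by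
  have hcard : ∀ (a : Fin k → I) x, Fintype.card {i // a i = x} = multiplicity a x := by
    intro a x
    rw [Fintype.card_subtype, multiplicity]
  by_cases h : ∀ x, multiplicity a x = multiplicity b x
  · have e : ∀ x, {i // a i = x} ≃ {i // b i = x} := fun x =>
      Fintype.equivOfCardEq (by rw [hcard, hcard, h])
    set σ₀ : Equiv.Perm (Fin k) := Equiv.ofFiberEquiv e
    have hσ₀ : ∀ i, b (σ₀ i) = a i := fun i => Equiv.ofFiberEquiv_map e i
    have h1 : (Finset.univ.filter fun σ : Equiv.Perm (Fin k) => ∀ i, a i = b (σ i)).card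
        = Fintype.card {g : Equiv.Perm (Fin k) // a ∘ g = a} := by
      rw [Fintype.card_subtype]
      refine Finset.card_bij' (fun σ _ => σ₀⁻¹ * σ) (fun g _ => σ₀ * g) ?_ ?_ ?_ ?_
      · intro σ hσ
        simp only [Finset.mem_filter, Finset.mem_univ, true_and] at hσ ⊢
        funext i
        rw [Function.comp_apply, ← hσ₀, hσ]
        simp
      · intro g hg
        simp only [Finset.mem_filter, Finset.mem_univ, true_and] at hg ⊢
        intro i
        rw [Equiv.Perm.mul_apply, hσ₀]
        exact (congrFun hg i).symm
      · intro σ _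
        simp
      · intro g _
        simp
    rw [h1, DomMulAct.stabilizer_card]
    refine Finset.prod_congr rfl fun x _ => ?_
    rw [if_pos (h x), hcard]
  · push Not at h
    obtain ⟨x, hx⟩ := h
    rw [Finset.prod_eq_zero (Finset.mem_univ x) (if_neg hx), Finset.card_eq_zero,
      Finset.filter_eq_empty_iff]
    intro σ _ hσ
    apply hx
    rw [multiplicity, multiplicity]
    refine Finset.card_bij' (fun i _ => σ i) (fun i _ => σ⁻¹ i) ?_ ?_ ?_ ?_
    · intro i hi
      simp only [Finset.mem_filter, Finset.mem_univ, true_and] at hi ⊢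
      rw [← hσ, hi]
    · intro i hi
      simp only [Finset.mem_filter, Finset.mem_univ, true_and] at hi ⊢
      rw [hσ]
      simpa using hi
    · intro i _
      simp
    · intro i _
      simp

end Permutations

/-! ### Gaussian moments of the bosonic tensor -/

section Bosonic

variable {D N : ℕ}

/-- The density of the Gaussian measure on tensors. -/
def tensorDensity (D N : ℕ) (T : Idx D N → ℂ) : ℝ :=
  ∏ a, complexGaussianDensity ((N : ℝ) ^ (D - 1)) (T a)

theorem tensorMeasure_eq : tensorMeasure D N
    = volume.withDensity fun T => ENNReal.ofReal (tensorDensity D N T) := rfl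

theorem measurable_tensorDensity : Measurable (tensorDensity D N) :=
  Finset.measurable_fun_prod _ fun a _ =>
    (continuous_complexGaussianDensity _).measurable.comp (measurable_pi_apply a)

theorem tensorDensity_nonneg (hN : 1 ≤ N) (T : Idx D N → ℂ) : 0 ≤ tensorDensity D N T := by
  have : (0 : ℝ) < N := by exact_mod_cast hN
  exact Finset.prod_nonneg fun a _ => complexGaussianDensity_nonneg (by positivity) _

theorem integrable_tensorMeasure_iff (hN : 1 ≤ N) (F : (Idx D N → ℂ) → ℂ) :
    Integrable F (tensorMeasure D N) ↔ Integrable fun T => (tensorDensity D N T : ℂ) * F T := by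
  rw [tensorMeasure_eq, integrable_withDensity_iff_integrable_smul'
    measurable_tensorDensity.ennreal_ofReal (Filter.Eventually.of_forall fun _ =>
      ENNReal.ofReal_lt_top)]
  simp only [ENNReal.toReal_ofReal (tensorDensity_nonneg hN _), Complex.real_smul]

theorem integral_tensorMeasure (hN : 1 ≤ N) (F : (Idx D N → ℂ) → ℂ) :
    ∫ T, F T ∂tensorMeasure D N = ∫ T, (tensorDensity D N T : ℂ) * F T := by
  rw [tensorMeasure_eq, integral_withDensity_eq_integral_toReal_smul
    measurable_tensorDensity.ennreal_ofReal (Filter.Eventually.of_forall fun _ =>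
      ENNReal.ofReal_lt_top)]
  simp only [ENNReal.toReal_ofReal (tensorDensity_nonneg hN _), Complex.real_smul]

theorem tensorDensity_mul_prod {k : ℕ} (a b : Fin k → Idx D N) (T : Idx D N → ℂ) :
    (tensorDensity D N T : ℂ) * ∏ i, T (a i) * starRingEnd ℂ (T (b i))
      = ∏ x, (complexGaussianDensity ((N : ℝ) ^ (D - 1)) (T x) : ℂ)
        * (T x ^ multiplicity a x * (starRingEnd ℂ (T x)) ^ multiplicity b x) := by
  rw [Finset.prod_mul_distrib, Finset.prod_mul_distrib, Finset.prod_mul_distrib,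
    prod_eq_prod_pow a, prod_eq_prod_pow b fun x => starRingEnd ℂ (T x), tensorDensity]
  push_cast
  rfl

theorem integrable_prod_tensor (hN : 1 ≤ N) {k : ℕ} (a b : Fin k → Idx D N) :
    Integrable (fun T : Idx D N → ℂ => ∏ i, T (a i) * starRingEnd ℂ (T (b i)))
      (tensorMeasure D N) := by
  have : (0 : ℝ) < N := by exact_mod_cast hN
  rw [integrable_tensorMeasure_iff hN]
  simp only [tensorDensity_mul_prod]
  exact Integrable.fintype_prod (f := fun x z =>
    (complexGaussianDensity ((N : ℝ) ^ (D - 1)) z : ℂ)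
      * (z ^ multiplicity a x * (starRingEnd ℂ z) ^ multiplicity b x))
    fun x => integrable_monomial (by positivity) _ _

/-- Wick's theorem for the complex Gaussian tensor. -/
theorem integral_prod_tensor (hD : Even D) (hN : 1 ≤ N) {k : ℕ} (a b : Fin k → Idx D N) :
    ∫ T, ∏ i, T (a i) * starRingEnd ℂ (T (b i)) ∂tensorMeasure D N = gaussianMoment a b := by
  have hl : (0 : ℝ) < (N : ℝ) ^ (D - 1) := by
    have : (0 : ℝ) < N := by exact_mod_cast hN
    positivity
  rw [integral_tensorMeasure hN]
  simp only [tensorDensity_mul_prod]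
  rw [integral_fintype_prod_volume_eq_prod (fun x z =>
    (complexGaussianDensity ((N : ℝ) ^ (D - 1)) z : ℂ)
      * (z ^ multiplicity a x * (starRingEnd ℂ z) ^ multiplicity b x))]
  have h1 : ∀ x, ∫ z : ℂ, (complexGaussianDensity ((N : ℝ) ^ (D - 1)) z : ℂ)
      * (z ^ multiplicity a x * (starRingEnd ℂ z) ^ multiplicity b x)
      = (((N : ℂ) ^ (D - 1))⁻¹) ^ multiplicity a x
        * ((if multiplicity a x = multiplicity b x then (multiplicity a x).factorial else 0 : ℕ) :
          ℂ) := by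
    intro x
    split_ifs with h
    · rw [← h, integral_monomial_self hl]
      push_cast
      rw [inv_pow, mul_comm]
    · rw [integral_monomial_of_ne _ h, Nat.cast_zero, mul_zero]
  rw [Finset.prod_congr rfl fun x _ => h1 x, Finset.prod_mul_distrib, Finset.prod_pow_eq_pow_sum,
    sum_multiplicity, ← Nat.cast_prod, ← card_matchings, gaussianMoment, inv_pow]
  congr 1
  rw [Finset.card_filter]
  push_cast
  refine Finset.sum_congr rfl fun σ _ => ?_
  -- For `D` even the factor `ε(σ)^D` is `1`, so the sum over `σ` only counts matchings.
  rcases Int.units_eq_one_or (Equiv.Perm.sign σ) with h | h <;> rw [h] <;> simp [hD.neg_one_pow]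

end Bosonic

/-! ### Berezin integration -/

section LeftDeriv

variable {X : Type}

theorem leftDeriv_gen_mul (x y : X) (F : Grassmann X) :
    leftDeriv x (gen y * F) = (if y = x then 1 else 0 : ℂ) • F - gen y * leftDeriv x F := by
  refine (CliffordAlgebra.contractLeft_ι_mul (Q := 0) _ _ _).trans ?_
  rw [Finsupp.lapply_apply, Finsupp.single_apply]
  rfl

theorem leftDeriv_one (x : X) : leftDeriv x (1 : Grassmann X) = 0 :=
  CliffordAlgebra.contractLeft_one (Q := 0) _

theorem leftDeriv_leftDeriv (x y : X) (F : Grassmann X) :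
    leftDeriv x (leftDeriv y F) = -leftDeriv y (leftDeriv x F) :=
  CliffordAlgebra.contractLeft_comm (Q := 0) _ _ F

theorem leftDeriv_mul_self (x : X) : leftDeriv x * leftDeriv x = 0 :=
  LinearMap.ext fun F => CliffordAlgebra.contractLeft_contractLeft (Q := 0) _ F

/-- Here `y` behaves as an even element with derivative `u`; commutation of the two gives the usual
power rule. -/
theorem leftDeriv_pow_mul {x : X} {y u : Grassmann X} (hu : Commute y u)
    (h : ∀ F, leftDeriv x (y * F) = u * F + y * leftDeriv x F) (n : ℕ) (F : Grassmann X) :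
    leftDeriv x (y ^ n * F) = (n : ℂ) • (u * y ^ (n - 1) * F) + y ^ n * leftDeriv x F := by
  induction n with
  | zero => simp
  | succ n ih =>
    rw [pow_succ', mul_assoc, h, ih, mul_add, ← mul_assoc, ← add_assoc, mul_smul_comm]
    congr 1
    · rcases n with _ | n
      · simp
      · have : y * (u * y ^ n * F) = u * y ^ (n + 1) * F := by
          rw [pow_succ', ← mul_assoc, ← mul_assoc, hu.eq]
          simp only [mul_assoc]
        simp only [Nat.add_sub_cancel, this]
        push_cast
        module
    · rw [mul_assoc]

theorem leftDeriv_exp_mul {x : X} {y u : Grassmann X} (hy : IsNilpotent y) (hu : Commute y u)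
    (h : ∀ F, leftDeriv x (y * F) = u * F + y * leftDeriv x F) (F : Grassmann X) :
    leftDeriv x (IsNilpotent.exp y * F)
      = u * IsNilpotent.exp y * F + IsNilpotent.exp y * leftDeriv x F := by
  obtain ⟨n, hn⟩ := hy
  have e1 : IsNilpotent.exp y = ∑ i ∈ Finset.range n, ((i.factorial : ℂ)⁻¹) • y ^ i := by
    rw [IsNilpotent.exp_eq_sum hn]
    refine Finset.sum_congr rfl fun i _ => ?_
    rw [← Rat.cast_smul_eq_qsmul ℂ]
    simp
  -- One additional, vanishing term is kept so that the derivative, which lowers powers by one,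
  -- again yields the full sum.
  have e2 : IsNilpotent.exp y = ∑ i ∈ Finset.range (n + 1), ((i.factorial : ℂ)⁻¹) • y ^ i := by
    rw [Finset.sum_range_succ, hn, smul_zero, add_zero, e1]
  conv_lhs => rw [e2]
  rw [Finset.sum_mul, map_sum]
  simp only [smul_mul_assoc, map_smul, leftDeriv_pow_mul hu h, smul_add, Finset.sum_add_distrib]
  congr 1
  · rw [Finset.sum_range_succ', e1]
    simp only [Nat.cast_zero, zero_smul, smul_zero, add_zero, Nat.add_sub_cancel, Finset.mul_sum,
      Finset.sum_mul, mul_smul_comm, smul_mul_assoc]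
    refine Finset.sum_congr rfl fun i _ => ?_
    rw [smul_smul]
    congr 1
    rw [Nat.factorial_succ]
    have : ((i : ℂ) + 1) ≠ 0 := by exact_mod_cast Nat.succ_ne_zero i
    push_cast
    field_simp
  · rw [e2, Finset.sum_mul]
    simp only [smul_mul_assoc]

theorem gen_mul_self (x : X) : gen x * gen x = (0 : Grassmann X) :=
  ExteriorAlgebra.ι_sq_zero _

theorem gen_mul_gen_mul (x y : X) (F : Grassmann X) :
    gen x * (gen y * F) = -(gen y * (gen x * F)) := by
  rw [← mul_assoc, gen_mul_gen, neg_mul, mul_assoc]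

theorem commute_gen_mul_gen (x y z : X) : Commute (gen x * gen y : Grassmann X) (gen z) := by
  change gen x * gen y * gen z = gen z * (gen x * gen y)
  rw [mul_assoc, gen_mul_gen y z, mul_neg, gen_mul_gen_mul, neg_neg]

theorem leftDeriv_gen_mul_gen_mul (x y z : X) (F : Grassmann X) :
    leftDeriv x (gen y * gen z * F)
      = ((if y = x then 1 else 0 : ℂ) • gen z - (if z = x then 1 else 0 : ℂ) • gen y) * F
        + gen y * gen z * leftDeriv x F := by
  rw [mul_assoc, leftDeriv_gen_mul, leftDeriv_gen_mul, mul_sub, sub_mul, smul_mul_assoc,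
    smul_mul_assoc, mul_smul_comm, mul_assoc]
  abel

theorem body_one : body (1 : Grassmann X) = 1 := map_one _

theorem body_gen_mul (x : X) (F : Grassmann X) : body (gen x * F) = 0 := by
  have : body (gen x) = 0 := by
    simp [body, gen, ExteriorAlgebra.algebraMapInv]
  rw [body, map_mul]
  rw [body] at this
  rw [this, zero_mul]

end LeftDeriv

/-! ### Gaussian Berezin integral over the Grassmann tensor -/

section Berezin

variable {D N : ℕ}

/-- The exponent of the Gaussian weight. -/
def berezinAction (D N : ℕ) : Grassmann (Idx D N ⊕ Idx D N) :=
  -((N : ℂ) ^ (D - 1)) • ∑ a : Idx D N, genTbar a * genT a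

theorem commute_berezinAction (x : Idx D N ⊕ Idx D N) : Commute (berezinAction D N) (gen x) :=
  (Commute.sum_left _ _ _ fun _ _ => commute_gen_mul_gen _ _ _).smul_left _

theorem isNilpotent_berezinAction : IsNilpotent (berezinAction D N) := by
  refine IsNilpotent.smul (Commute.isNilpotent_sum (fun a _ => ⟨2, ?_⟩) fun a b _ _ => ?_) _
  · rw [pow_two, ← mul_assoc, genTbar, genT, (commute_gen_mul_gen _ _ _).eq, ← mul_assoc,
      gen_mul_self, zero_mul, zero_mul]
  · exact (commute_gen_mul_gen _ _ _).mul_right (commute_gen_mul_gen _ _ _)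

theorem commute_berezinWeight (x : Idx D N ⊕ Idx D N) : Commute (berezinWeight D N) (gen x) := by
  have h : berezinWeight D N = IsNilpotent.exp (berezinAction D N) := rfl
  rw [h, IsNilpotent.exp]
  exact Commute.sum_left _ _ _ fun i _ => ((commute_berezinAction x).pow_left i).smul_left _

theorem leftDeriv_berezinAction_mul (x : Idx D N ⊕ Idx D N) (F : Grassmann (Idx D N ⊕ Idx D N)) :
    leftDeriv x (berezinAction D N * F)
      = x.elim (fun a => (N : ℂ) ^ (D - 1) • genTbar a) (fun a => -((N : ℂ) ^ (D - 1)) • genT a) * F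
        + berezinAction D N * leftDeriv x F := by
  simp only [berezinAction, Finset.smul_sum, Finset.sum_mul, map_sum, smul_mul_assoc, map_smul,
    genTbar, genT, leftDeriv_gen_mul_gen_mul, smul_add, Finset.sum_add_distrib]
  congr 1
  rcases x with a | a
  · rw [Finset.sum_eq_single a]
    · simp
    · intro b _ hb
      simp [hb]
    · simp
  · rw [Finset.sum_eq_single a]
    · simp
    · intro b _ hb
      simp [hb]
    · simp

theorem leftDeriv_berezinWeight_mul (x : Idx D N ⊕ Idx D N) (F : Grassmann (Idx D N ⊕ Idx D N)) :
    leftDeriv x (berezinWeight D N * F)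
      = x.elim (fun a => (N : ℂ) ^ (D - 1) • genTbar a) (fun a => -((N : ℂ) ^ (D - 1)) • genT a)
          * berezinWeight D N * F
        + berezinWeight D N * leftDeriv x F := by
  refine leftDeriv_exp_mul isNilpotent_berezinAction ?_ (leftDeriv_berezinAction_mul x) F
  rcases x with a | a
  · exact (commute_berezinAction (Sum.inr a)).smul_right _
  · exact (commute_berezinAction (Sum.inl a)).smul_right _

/-- The Berezin integral over one pair of variables. -/
def pairDeriv (a : Idx D N) : Module.End ℂ (Grassmann (Idx D N ⊕ Idx D N)) :=
  leftDeriv (Sum.inr a) * leftDeriv (Sum.inl a)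

theorem pairDeriv_mul_leftDeriv (a : Idx D N) (x : Idx D N ⊕ Idx D N) :
    pairDeriv a * leftDeriv x = leftDeriv x * pairDeriv a := by
  refine LinearMap.ext fun F => ?_
  simp only [pairDeriv, Module.End.mul_apply]
  rw [leftDeriv_leftDeriv (Sum.inl a) x, map_neg, leftDeriv_leftDeriv (Sum.inr a) x, neg_neg]

theorem pairDeriv_mul_leftDeriv_self (x : Idx D N ⊕ Idx D N) :
    pairDeriv (x.elim id id) * leftDeriv x = 0 := by
  rcases x with a | a
  · rw [Sum.elim_inl, id, pairDeriv, mul_assoc, leftDeriv_mul_self, mul_zero]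
  · rw [Sum.elim_inr, id, pairDeriv_mul_leftDeriv, pairDeriv, ← mul_assoc, leftDeriv_mul_self,
      zero_mul]

/-- Derivatives square to zero, and pairs of them commute with every derivative, so the factor
carrying the same variable annihilates the product. -/
theorem prod_pairDeriv_mul_leftDeriv (x : Idx D N ⊕ Idx D N) (l : List (Idx D N))
    (h : x.elim id id ∈ l) : (l.map pairDeriv).prod * leftDeriv x = 0 := by
  induction l with
  | nil => simp at h
  | cons b l ih =>
    rw [List.map_cons, List.prod_cons]
    by_cases hb : x.elim id id ∈ l
    · rw [mul_assoc, ih hb, mul_zero]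
    · have hx : x.elim id id = b := by simpa [hb] using h
      have : Commute (l.map pairDeriv).prod (leftDeriv x) := by
        refine Commute.list_prod_left _ _ fun p hp => ?_
        obtain ⟨a, -, rfl⟩ := List.mem_map.1 hp
        exact pairDeriv_mul_leftDeriv a x
      rw [mul_assoc, this.eq, ← mul_assoc, ← hx, pairDeriv_mul_leftDeriv_self, zero_mul]

/-- The Berezin integral as a linear form. -/
def berezinLinear (D N : ℕ) : Grassmann (Idx D N ⊕ Idx D N) →ₗ[ℂ] ℂ :=
  ExteriorAlgebra.algebraMapInv.toLinearMap
    ∘ₗ ((Finset.univ : Finset (Idx D N)).toList.map pairDeriv).prod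

theorem berezinLinear_apply (F : Grassmann (Idx D N ⊕ Idx D N)) :
    berezinLinear D N F = berezin D N F := rfl

theorem berezin_leftDeriv (x : Idx D N ⊕ Idx D N) (F : Grassmann (Idx D N ⊕ Idx D N)) :
    berezin D N (leftDeriv x F) = 0 := by
  have h := prod_pairDeriv_mul_leftDeriv x (Finset.univ : Finset (Idx D N)).toList (by simp)
  change body (((((Finset.univ : Finset (Idx D N)).toList.map pairDeriv).prod) * leftDeriv x) F) = 0
  rw [h]
  exact map_zero _

/-- Integration by parts: the integral of a total derivative with respect to `T̄_a` vanishes, and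
the derivative of the weight brings down `-N^{D-1} T_a`. -/
theorem berezin_weight_genT_mul (hN : 1 ≤ N) (a : Idx D N) (F : Grassmann (Idx D N ⊕ Idx D N)) :
    berezin D N (berezinWeight D N * (genT a * F))
      = ((N : ℂ) ^ (D - 1))⁻¹ * berezin D N (berezinWeight D N * leftDeriv (Sum.inr a) F) := by
  have h := berezin_leftDeriv (Sum.inr a) (berezinWeight D N * F)
  have hc : genT a * berezinWeight D N = berezinWeight D N * genT a :=
    (commute_berezinWeight (Sum.inl a)).eq.symm
  rw [leftDeriv_berezinWeight_mul, Sum.elim_inr, smul_mul_assoc, smul_mul_assoc, hc, mul_assoc]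
    at h
  simp only [← berezinLinear_apply, map_add, map_smul, smul_eq_mul] at h ⊢
  have hN' : ((N : ℂ) ^ (D - 1)) ≠ 0 := pow_ne_zero _ (Nat.cast_ne_zero.2 (by omega))
  field_simp
  linear_combination -h

/-- Each pair of derivatives turns `G` into `r G + r² T̄_a T_a G`, where `r = N^{D-1}`, and thus
multiplies the body by `r`. That `G` does not involve the variables still to be integrated keeps the
induction going; the outcome is a nonzero normalization. -/
theorem prod_pairDeriv_berezinWeight (l : List (Idx D N)) (hl : l.Nodup) :
    ∃ G : Grassmann (Idx D N ⊕ Idx D N),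
      (l.map pairDeriv).prod (berezinWeight D N) = berezinWeight D N * G ∧
      body G = ((N : ℂ) ^ (D - 1)) ^ l.length ∧
      ∀ x : Idx D N ⊕ Idx D N, x.elim id id ∉ l → leftDeriv x G = 0 := by
  induction l with
  | nil => exact ⟨1, by simp, by simp [body_one], fun x _ => leftDeriv_one x⟩
  | cons a l ih =>
    obtain ⟨ha, hl⟩ := List.nodup_cons.1 hl
    obtain ⟨G, h1, h2, h3⟩ := ih hl
    set r : ℂ := (N : ℂ) ^ (D - 1) with hr
    refine ⟨r • G + r ^ 2 • (genTbar a * genT a * G), ?_, ?_, fun x hx => ?_⟩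
    · rw [List.map_cons, List.prod_cons, Module.End.mul_apply, h1, pairDeriv, Module.End.mul_apply,
        leftDeriv_berezinWeight_mul, h3 (Sum.inl a) (by simpa using ha), mul_zero, add_zero,
        Sum.elim_inl, smul_mul_assoc, smul_mul_assoc, map_smul, mul_assoc, genTbar,
        leftDeriv_gen_mul, leftDeriv_berezinWeight_mul, h3 (Sum.inr a) (by simpa using ha),
        mul_zero, add_zero, Sum.elim_inr, if_pos rfl, one_smul, mul_add, mul_smul_comm,
        mul_smul_comm]
      have hc : (gen (Sum.inr a) * genT a) * berezinWeight D N
          = berezinWeight D N * (gen (Sum.inr a) * genT a) :=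
        ((commute_berezinWeight (Sum.inr a)).mul_right (commute_berezinWeight (Sum.inl a))).eq.symm
      rw [smul_mul_assoc, smul_mul_assoc, mul_smul_comm, ← mul_assoc, ← mul_assoc, hc, neg_smul,
        sub_neg_eq_add, smul_add, smul_smul, ← pow_two, mul_assoc]
    · have e1 : body (genTbar a * genT a * G) = 0 := by
        rw [mul_assoc]
        exact body_gen_mul _ _
      have e2 : body (r • G + r ^ 2 • (genTbar a * genT a * G))
          = r * body G + r ^ 2 * body (genTbar a * genT a * G) := by
        simp only [body, map_add, map_smul, smul_eq_mul]
      rw [e2, e1, h2, List.length_cons, mul_zero, add_zero]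
      exact (pow_succ' r _).symm
    · obtain ⟨hxa, hxl⟩ : x.elim id id ≠ a ∧ x.elim id id ∉ l := by simpa using hx
      have e1 : (Sum.inr a : Idx D N ⊕ Idx D N) ≠ x := by
        rintro rfl
        exact hxa rfl
      have e2 : (Sum.inl a : Idx D N ⊕ Idx D N) ≠ x := by
        rintro rfl
        exact hxa rfl
      rw [map_add, map_smul, map_smul, genTbar, genT, leftDeriv_gen_mul_gen_mul, h3 x hxl]
      simp [e1, e2]

theorem body_berezinWeight : body (berezinWeight D N) = 1 := by
  have h : berezinWeight D N = IsNilpotent.exp (berezinAction D N) := rfl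
  obtain ⟨n, hn⟩ := isNilpotent_berezinAction (D := D) (N := N)
  have hb : ExteriorAlgebra.algebraMapInv (berezinAction D N) = 0 := by
    simp only [berezinAction, map_smul, map_sum]
    have h0 : ∀ a : Idx D N, ExteriorAlgebra.algebraMapInv (genTbar a * genT a) = 0 :=
      fun a => body_gen_mul _ _
    simp only [h0, Finset.sum_const_zero, smul_zero]
  have hn' : berezinAction D N ^ (n + 1) = 0 := by rw [pow_succ, hn, zero_mul]
  rw [h, IsNilpotent.exp_eq_sum hn', body, map_sum, Finset.sum_range_succ',
    Finset.sum_eq_zero]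
  · simp
  · intro i _
    rw [← Rat.cast_smul_eq_qsmul ℂ, map_smul, map_pow, hb]
    simp

theorem berezin_weight_ne_zero (hN : 1 ≤ N) : berezin D N (berezinWeight D N) ≠ 0 := by
  obtain ⟨G, h1, h2, -⟩ := prod_pairDeriv_berezinWeight (Finset.univ : Finset (Idx D N)).toList
    (Finset.nodup_toList _)
  have h : berezin D N (berezinWeight D N)
      = body (((Finset.univ : Finset (Idx D N)).toList.map pairDeriv).prod (berezinWeight D N)) :=
    rfl
  have hm : body (berezinWeight D N * G) = body (berezinWeight D N) * body G := map_mul _ _ _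
  rw [h, h1, hm, body_berezinWeight, one_mul, h2]
  exact pow_ne_zero _ (pow_ne_zero _ (Nat.cast_ne_zero.2 (by omega)))

/-- The normalized Gaussian Berezin integral as a linear form. -/
def berezinAverageLinear (D N : ℕ) : Grassmann (Idx D N ⊕ Idx D N) →ₗ[ℂ] ℂ :=
  (berezin D N (berezinWeight D N))⁻¹ •
    (berezinLinear D N ∘ₗ LinearMap.mulLeft ℂ (berezinWeight D N))

theorem berezinAverageLinear_apply (F : Grassmann (Idx D N ⊕ Idx D N)) :
    berezinAverageLinear D N F = berezinAverage D N F := by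
  rw [berezinAverage, div_eq_inv_mul]
  rfl

theorem berezinAverage_one (hN : 1 ≤ N) : berezinAverage D N 1 = 1 := by
  rw [berezinAverage, mul_one, div_self (berezin_weight_ne_zero hN)]

theorem berezinAverage_genT_mul (hN : 1 ≤ N) (a : Idx D N) (F : Grassmann (Idx D N ⊕ Idx D N)) :
    berezinAverage D N (genT a * F)
      = berezinAverage D N (((N : ℂ) ^ (D - 1))⁻¹ • leftDeriv (Sum.inr a) F) := by
  simp only [← berezinAverageLinear_apply, map_smul]
  simp only [berezinAverageLinear_apply, berezinAverage, berezin_weight_genT_mul hN, smul_eq_mul]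
  ring

theorem berezinAverage_det (hN : 1 ≤ N) {k : ℕ} (a b : Fin k → Idx D N) :
    berezinAverage D N ((List.ofFn fun i => genT (a i.rev)).prod
        * (List.ofFn fun i => genTbar (b i)).prod)
      = (Matrix.of fun i j => ((N : ℂ) ^ (D - 1))⁻¹ * if a i = b j then 1 else 0).det := by
  have h := wick_det (berezinAverageLinear D N)
    (fun i => Finsupp.single (Sum.inl (a i)) (1 : ℂ)) (fun i => Finsupp.single (Sum.inr (b i)) 1)
    (fun i => ((N : ℂ) ^ (D - 1))⁻¹ • Finsupp.lapply (Sum.inr (a i))) (fun i F => ?_) ?_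
  · rw [berezinAverageLinear_apply, berezinAverageLinear_apply, berezinAverage_one hN,
      smul_eq_mul, mul_one] at h
    refine h.trans ?_
    congr 1
    ext i j
    simp [Finsupp.single_apply, eq_comm]
  · have := berezinAverage_genT_mul hN (a i) F
    rw [← berezinAverageLinear_apply, ← berezinAverageLinear_apply] at this
    refine this.trans ?_
    rw [map_smul CliffordAlgebra.contractLeft]
    rfl
  · intro i j
    simp

/-- Separating the `T`'s from the `T̄`'s and reversing the `T`'s cost the same sign, so the
determinant appears without sign; for `D` odd, `ε = ε^D`. -/
theorem berezinAverage_prod (hD : ¬ Even D) (hN : 1 ≤ N) {k : ℕ} (a b : Fin k → Idx D N) :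
    berezinAverage D N (List.ofFn fun i => genT (a i) * genTbar (b i)).prod
      = gaussianMoment a b := by
  have h1 := prod_ofFn_mul_distrib (s := -1) (fun i => genT (a i)) (fun i => genTbar (b i))
    fun i j => by rw [neg_one_smul]; exact gen_mul_gen _ _
  have h2 := prod_ofFn_rev (s := -1) (fun i => genT (a i))
    fun i j => by rw [neg_one_smul]; exact gen_mul_gen _ _
  rw [h1, h2, smul_mul_assoc, smul_smul, ← pow_add, Even.neg_one_pow ⟨_, rfl⟩, one_smul,
    berezinAverage_det hN, ← Matrix.det_transpose, Matrix.det_apply, gaussianMoment,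
    Finset.mul_sum]
  refine Finset.sum_congr (by ext; simp) fun σ₀ _ => ?_
  have hs : (((Equiv.Perm.sign σ₀ : ℤˣ) : ℤ) : ℂ) ^ D = (((Equiv.Perm.sign σ₀ : ℤˣ) : ℤ) : ℂ) := by
    rcases Int.units_eq_one_or (Equiv.Perm.sign σ₀) with h | h
    · simp [h]
    · simpa [h] using (Nat.not_even_iff_odd.1 hD).neg_one_pow
  simp only [Matrix.transpose_apply, Matrix.of_apply]
  rw [hs, Finset.prod_mul_distrib, Finset.prod_const, Finset.card_univ, Fintype.card_fin,
    Units.smul_def, zsmul_eq_mul, inv_pow, Finset.prod_ite_zero]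
  simp only [Finset.prod_const_one, Finset.mem_univ, true_imp_iff]
  rw [← mul_assoc, ← mul_assoc, mul_comm ((_ : ℂ)⁻¹)]

end Berezin

/-! ### The averages of sums over graphs -/

section GraphSum

variable {D N : ℕ}

/-- The sum over a family of graphs with `2 k` vertices of the amplitudes times the trace
invariants. -/
def graphSum {R : Type} [Ring R] [Algebra ℂ R] (β : ℝ) (X : Idx D N → Idx D N → R)
    (s : ∀ k : ℕ, Finset (Fin D → Equiv.Perm (Fin k))) (k : ℕ) : R :=
  (1 / (k.factorial * k.factorial : ℂ)) • ∑ σ ∈ s k, (amplitude β σ : ℂ) • traceInvariant X σ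

/-- The sum over a family of graphs with `2 k` vertices of the amplitudes times the averages of the
trace invariants. -/
def averagedGraphSum (N : ℕ) (β : ℝ) (s : ∀ k : ℕ, Finset (Fin D → Equiv.Perm (Fin k))) (k : ℕ) :
    ℂ :=
  (1 / (k.factorial * k.factorial : ℂ)) • ∑ σ ∈ s k, (amplitude β σ : ℂ)
    * ∑ σ₀ : Equiv.Perm (Fin k), (((Equiv.Perm.sign σ₀ : ℤˣ) : ℤ) : ℂ) ^ D * (faceFactor N σ₀ σ : ℂ)

/-- All graphs. -/
abbrev allGraphs (D k : ℕ) : Finset (Fin D → Equiv.Perm (Fin k)) := Finset.univ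

/-- The connected graphs. -/
abbrev connectedGraphs (D k : ℕ) : Finset (Fin D → Equiv.Perm (Fin k)) :=
  Finset.univ.filter fun σ => (coloredGraph σ).Connected

theorem map_traceInvariant {R S : Type} [Ring R] [Algebra ℂ R] [Ring S] [Algebra ℂ S]
    (φ : R →ₐ[ℂ] S) (X : Idx D N → Idx D N → R) {k : ℕ} (σ : Fin D → Equiv.Perm (Fin k)) :
    φ (traceInvariant X σ) = traceInvariant (fun a b => φ (X a b)) σ := by
  rw [traceInvariant, traceInvariant, map_sum]
  refine Finset.sum_congr rfl fun a _ => ?_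
  rw [map_sum]
  refine Finset.sum_congr rfl fun b _ => ?_
  rw [apply_ite φ, map_zero, map_list_prod, List.map_ofFn]
  rfl

theorem map_graphSum {R S : Type} [Ring R] [Algebra ℂ R] [Ring S] [Algebra ℂ S]
    (φ : R →ₐ[ℂ] S) (β : ℝ) (X : Idx D N → Idx D N → R)
    (s : ∀ k : ℕ, Finset (Fin D → Equiv.Perm (Fin k))) (k : ℕ) :
    φ (graphSum β X s k) = graphSum β (fun a b => φ (X a b)) s k := by
  simp only [graphSum, map_smul, map_sum, map_traceInvariant]

theorem map_diagSeries {R S : Type} [Ring R] [Algebra ℂ R] [Ring S] [Algebra ℂ S]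
    (φ : R →ₐ[ℂ] S) (u : ℕ → R) :
    MvPowerSeries.map (σ := Fin 2) φ.toRingHom (diagSeries u) = diagSeries fun k => φ (u k) := by
  ext d
  rw [MvPowerSeries.coeff_map, coeff_diagSeries, coeff_diagSeries]
  exact (apply_ite φ _ _ _).trans (by rw [map_zero φ])

theorem formalLog_graphSum (hD : 1 ≤ D) (β : ℝ) {E : Type} [CommRing E] [Algebra ℂ E]
    {X : Idx D N → Idx D N → E}
    (hX : ∀ a b a' b', X a b * X a' b' = tensorSign D • (X a b' * X a' b)) :
    formalLog (diagSeries (graphSum β X (allGraphs D)))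
      = diagSeries (graphSum β X (connectedGraphs D)) :=
  formalLog_sum_graphs hD β hX

/-- The ambient algebra need not commute, but the elements `X a b` do. The logarithm is computed in
the commutative subalgebra that they generate and mapped back. -/
theorem formalLog_graphSum_of_commute (hD : 1 ≤ D) (β : ℝ) {A : Type} [Ring A] [Algebra ℂ A]
    {X : Idx D N → Idx D N → A} (hc : ∀ a b a' b', X a b * X a' b' = X a' b' * X a b)
    (hX : ∀ a b a' b', X a b * X a' b' = tensorSign D • (X a b' * X a' b)) :
    formalLog (diagSeries (graphSum β X (allGraphs D)))
      = diagSeries (graphSum β X (connectedGraphs D)) := by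
  set s : Set A := Set.range fun p : Idx D N × Idx D N => X p.1 p.2 with hs
  have hcomm : ∀ x ∈ s, ∀ y ∈ s, x * y = y * x := by
    rintro _ ⟨p, rfl⟩ _ ⟨q, rfl⟩
    exact hc _ _ _ _
  have hadj := Algebra.isMulCommutative_adjoin ℂ hcomm
  let _ : CommRing (Algebra.adjoin ℂ s) :=
    { (inferInstance : Ring (Algebra.adjoin ℂ s)) with mul_comm := hadj.is_comm.comm }
  set X' : Idx D N → Idx D N → Algebra.adjoin ℂ s :=
    fun a b => ⟨X a b, Algebra.subset_adjoin ⟨(a, b), rfl⟩⟩ with hX'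
  have h := formalLog_graphSum (E := Algebra.adjoin ℂ s) (X := X') hD β
    fun a b a' b' => Subtype.ext (hX a b a' b')
  have h2 : ∀ t : ∀ k : ℕ, Finset (Fin D → Equiv.Perm (Fin k)),
      diagSeries (graphSum β X t)
        = MvPowerSeries.map (Algebra.adjoin ℂ s).val.toRingHom (diagSeries (graphSum β X' t)) := by
    intro t
    rw [map_diagSeries]
    congr 1
    funext k
    rw [map_graphSum]
    rfl
  rw [h2, formalLog_map, h2]
  exact congrArg _ h

end GraphSum

/-! ### Even `D`: partition function and its averages -/

section Bosonic

variable {D N : ℕ}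

theorem hasTensorParity_algebraMap (hD : Even D) {Y : Type} (T Tbar : Idx D N → ℂ) :
    HasTensorParity (Y := Y) (fun a => algebraMap ℂ _ (T a)) (fun a => algebraMap ℂ _ (Tbar a)) := by
  have h1 : tensorSign D = 1 := hD.neg_one_pow
  refine ⟨fun f a => ?_, fun f a => ?_, fun a b => ?_⟩
  · rw [AlgHom.commutes, h1, one_smul, Algebra.commutes]
  · rw [AlgHom.commutes, h1, one_smul, Algebra.commutes]
  · rw [h1, one_smul, Algebra.commutes]

theorem partitionBosonic_eq (hD : Even D) (hD1 : 1 ≤ D) (β : ℝ) (T : Idx D N → ℂ) :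
    partitionBosonic D N β T
      = diagSeries (graphSum β (fun a b => T a * starRingEnd ℂ (T b)) (allGraphs D)) := by
  have h := partitionFunction_eq hD1 (hasTensorParity_algebraMap (Y := Empty) hD T
    fun a => starRingEnd ℂ (T a)) β
  ext d
  have h2 := congrArg (MvPowerSeries.map (σ := Fin 2)
    (ExteriorAlgebra.algebraMapInv (R := ℂ) (M := Empty →₀ ℂ)).toRingHom) h
  have h3 := map_diagSeries (ExteriorAlgebra.algebraMapInv (R := ℂ) (M := Empty →₀ ℂ))
    (graphSum β (fun a b : Idx D N => algebraMap ℂ (Grassmann Empty) (T a)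
      * algebraMap ℂ (Grassmann Empty) (starRingEnd ℂ (T b))) (allGraphs D))
  have h4 := h2.trans h3
  refine (congrArg (MvPowerSeries.coeff d) h4).trans ?_
  congr 2
  funext k
  rw [map_graphSum]
  congr 1
  funext a b
  rw [map_mul, ExteriorAlgebra.algebraMap_leftInverse, ExteriorAlgebra.algebraMap_leftInverse]

theorem formalLog_partitionBosonic (hD : Even D) (hD1 : 1 ≤ D) (β : ℝ) (T : Idx D N → ℂ) :
    formalLog (partitionBosonic D N β T)
      = diagSeries (graphSum β (fun a b => T a * starRingEnd ℂ (T b)) (connectedGraphs D)) := by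
  rw [partitionBosonic_eq hD hD1]
  refine formalLog_graphSum hD1 β fun a b a' b' => ?_
  have h1 : tensorSign D = 1 := hD.neg_one_pow
  rw [h1, one_smul]
  ring

theorem integrable_traceInvariant (hN : 1 ≤ N) {k : ℕ} (σ : Fin D → Equiv.Perm (Fin k)) :
    Integrable (fun T : Idx D N → ℂ => traceInvariant (fun a b => T a * starRingEnd ℂ (T b)) σ)
      (tensorMeasure D N) := by
  unfold traceInvariant
  refine integrable_finsetSum _ fun a _ => integrable_finsetSum _ fun b _ => ?_
  split_ifs
  · simp only [List.prod_ofFn]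
    exact integrable_prod_tensor hN a b
  · exact integrable_zero _ _ _

theorem integral_traceInvariant (hD : Even D) (hN : 1 ≤ N) {k : ℕ}
    (σ : Fin D → Equiv.Perm (Fin k)) :
    ∫ T : Idx D N → ℂ, traceInvariant (fun a b => T a * starRingEnd ℂ (T b)) σ ∂tensorMeasure D N
      = ∑ σ₀ : Equiv.Perm (Fin k),
        (((Equiv.Perm.sign σ₀ : ℤˣ) : ℤ) : ℂ) ^ D * (faceFactor N σ₀ σ : ℂ) := by
  have hi : ∀ a b : Fin k → Idx D N, Integrable (fun T : Idx D N → ℂ =>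
      if ∀ c i, a i c = b (σ c i) c then
        (List.ofFn fun i => T (a i) * starRingEnd ℂ (T (b i))).prod else 0)
      (tensorMeasure D N) := by
    intro a b
    split_ifs
    · simp only [List.prod_ofFn]
      exact integrable_prod_tensor hN a b
    · exact integrable_zero _ _ _
  rw [← sum_gaussianMoment]
  unfold traceInvariant
  rw [integral_finsetSum _ fun a _ => integrable_finsetSum _ fun b _ => hi a b]
  refine Finset.sum_congr rfl fun a _ => ?_
  rw [integral_finsetSum _ fun b _ => hi a b]
  refine Finset.sum_congr rfl fun b _ => ?_
  split_ifs
  · simp only [List.prod_ofFn]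
    exact integral_prod_tensor hD hN a b
  · exact integral_zero _ _

/-- Every coefficient is a polynomial in the components of `T` and their conjugates. -/
theorem integrable_coeff_graphSum (hN : 1 ≤ N) (β : ℝ)
    (s : ∀ k : ℕ, Finset (Fin D → Equiv.Perm (Fin k))) (d : Fin 2 →₀ ℕ) :
    Integrable (fun T : Idx D N → ℂ => MvPowerSeries.coeff d
      (diagSeries (graphSum β (fun a b => T a * starRingEnd ℂ (T b)) s))) (tensorMeasure D N) := by
  simp only [coeff_diagSeries]
  split_ifs
  · exact (integrable_finsetSum _ fun σ _ =>
      (integrable_traceInvariant hN σ).smul (amplitude β σ : ℂ)).smul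
        (1 / ((d 0).factorial * (d 0).factorial : ℂ))
  · exact integrable_zero _ _ _

theorem averageBosonic_graphSum (hD : Even D) (hN : 1 ≤ N) (β : ℝ)
    (s : ∀ k : ℕ, Finset (Fin D → Equiv.Perm (Fin k))) :
    averageBosonic D N (fun T => diagSeries (graphSum β (fun a b => T a * starRingEnd ℂ (T b)) s))
      = diagSeries (averagedGraphSum N β s) := by
  ext d
  change ∫ T, MvPowerSeries.coeff d _ ∂tensorMeasure D N = _
  simp only [coeff_diagSeries]
  split_ifs
  · have hi : ∀ σ ∈ s (d 0), Integrable (fun T : Idx D N → ℂ => (amplitude β σ : ℂ)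
        * traceInvariant (fun a b => T a * starRingEnd ℂ (T b)) σ) (tensorMeasure D N) :=
      fun σ _ => (integrable_traceInvariant hN σ).const_mul _
    simp only [graphSum, averagedGraphSum, smul_eq_mul]
    rw [integral_const_mul, integral_finsetSum _ hi]
    refine congrArg _ (Finset.sum_congr rfl fun σ _ => ?_)
    rw [integral_const_mul, integral_traceInvariant hD hN]
  · exact integral_zero _ _

end Bosonic

/-! ### Odd `D`: partition function and its averages -/

section Fermionic

variable {D N : ℕ}

theorem hasTensorParity_gen (hD : ¬ Even D) :
    HasTensorParity (D := D) (N := N) genT genTbar := by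
  have h1 : tensorSign D = -1 := (Nat.not_even_iff_odd.1 hD).neg_one_pow
  refine ⟨fun f a => ?_, fun f a => ?_, fun a b => ?_⟩
  · rw [genT, spectator_gen, h1, neg_one_smul, gen_mul_gen]
  · rw [genTbar, spectator_gen, h1, neg_one_smul, gen_mul_gen]
  · rw [genT, genTbar, h1, neg_one_smul, gen_mul_gen]

theorem partitionFermionic_eq (hD : ¬ Even D) (hD1 : 1 ≤ D) (β : ℝ) :
    partitionFermionic D N β
      = diagSeries (graphSum β (fun a b => genT a * genTbar b) (allGraphs D)) :=
  partitionFunction_eq hD1 (hasTensorParity_gen hD) β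

theorem formalLog_partitionFermionic (hD : ¬ Even D) (hD1 : 1 ≤ D) (β : ℝ) :
    formalLog (partitionFermionic D N β)
      = diagSeries (graphSum β (fun a b => genT a * genTbar b) (connectedGraphs D)) := by
  rw [partitionFermionic_eq hD hD1]
  refine formalLog_graphSum_of_commute hD1 β (fun a b a' b' => ?_) fun a b a' b' => ?_
  · exact ((commute_gen_mul_gen _ _ _).mul_right (commute_gen_mul_gen _ _ _)).eq
  · have h1 : tensorSign D = -1 := (Nat.not_even_iff_odd.1 hD).neg_one_pow
    rw [h1, neg_one_smul, genT, genT, genTbar, genTbar, mul_assoc, mul_assoc,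
      gen_mul_gen_mul (Sum.inr b), gen_mul_gen (Sum.inr b), mul_neg, mul_neg,
      gen_mul_gen_mul (Sum.inr b')]

theorem berezinAverage_traceInvariant (hD : ¬ Even D) (hN : 1 ≤ N) {k : ℕ}
    (σ : Fin D → Equiv.Perm (Fin k)) :
    berezinAverage D N (traceInvariant (fun a b => genT a * genTbar b) σ)
      = ∑ σ₀ : Equiv.Perm (Fin k),
        (((Equiv.Perm.sign σ₀ : ℤˣ) : ℤ) : ℂ) ^ D * (faceFactor N σ₀ σ : ℂ) := by
  rw [← sum_gaussianMoment, ← berezinAverageLinear_apply, traceInvariant, map_sum]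
  refine Finset.sum_congr rfl fun a _ => ?_
  rw [map_sum]
  refine Finset.sum_congr rfl fun b _ => ?_
  rw [apply_ite (berezinAverageLinear D N), map_zero, berezinAverageLinear_apply,
    berezinAverage_prod hD hN]

theorem averageFermionic_graphSum (hD : ¬ Even D) (hN : 1 ≤ N) (β : ℝ)
    (s : ∀ k : ℕ, Finset (Fin D → Equiv.Perm (Fin k))) :
    averageFermionic D N (diagSeries (graphSum β (fun a b => genT a * genTbar b) s))
      = diagSeries (averagedGraphSum N β s) := by
  ext d
  change berezinAverage D N (MvPowerSeries.coeff d _) = _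
  rw [coeff_diagSeries, coeff_diagSeries, ← berezinAverageLinear_apply]
  split_ifs
  · rw [graphSum, averagedGraphSum, map_smul, map_sum]
    congr 1
    refine Finset.sum_congr rfl fun σ _ => ?_
    rw [map_smul, berezinAverageLinear_apply, berezinAverage_traceInvariant hD hN, smul_eq_mul]
  · exact map_zero _

end Fermionic

/-! ### The two expansions -/

section Expansions

variable {D N : ℕ}

theorem quenchedFreeEnergy_eq (hD : 1 ≤ D) (hN : 1 ≤ N) (β : ℝ) :
    quenchedFreeEnergy D N β = diagSeries (averagedGraphSum N β (connectedGraphs D)) := by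
  rw [quenchedFreeEnergy]
  split_ifs with h
  · simp only [formalLog_partitionBosonic h hD]
    exact averageBosonic_graphSum h hN β _
  · rw [formalLog_partitionFermionic h hD, averageFermionic_graphSum h hN]

theorem averagedPartitionFunction_eq (hD : 1 ≤ D) (hN : 1 ≤ N) (β : ℝ) :
    averagedPartitionFunction D N β = diagSeries (averagedGraphSum N β (allGraphs D)) := by
  rw [averagedPartitionFunction]
  split_ifs with h
  · simp only [partitionBosonic_eq h hD]
    exact averageBosonic_graphSum h hN β _
  · rw [partitionFermionic_eq h hD, averageFermionic_graphSum h hN]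

theorem annealedFreeEnergy_eq (hD : 1 ≤ D) (hN : 1 ≤ N) (β : ℝ) :
    annealedFreeEnergy D N β = diagSeries fun k => (1 / (k.factorial * k.factorial : ℂ)) •
      ∑ σ : Fin (D + 1) → Equiv.Perm (Fin k) with (coloredGraph σ).Connected,
        annealedWeight N β σ := by
  rw [annealedFreeEnergy, averagedPartitionFunction_eq hD hN, ← formalLog_annealed]
  congr 2
  funext k
  rw [sum_annealedWeight]
  rfl

theorem graphTerm_quenched (hD : 2 ≤ D) (hN : 1 ≤ N) (β : ℝ) {k : ℕ} (σ₀ : Equiv.Perm (Fin k))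
    (σ : Fin D → Equiv.Perm (Fin k)) (h : (coloredGraph σ).Connected) :
    (graphTerm N β σ₀ σ (quenchedExponent σ₀ σ) : ℂ)
      = (amplitude β σ : ℂ) * ((((Equiv.Perm.sign σ₀ : ℤˣ) : ℤ) : ℂ) ^ D
        * (faceFactor N σ₀ σ : ℂ)) := by
  rw [graphTerm, rpow_quenchedExponent hD hN σ₀ σ h, ← faceFactor]
  push_cast
  exact mul_assoc _ _ _

theorem quenched_expansion (hD : 2 ≤ D) (hN : 1 ≤ N) (β : ℝ) :
    quenchedFreeEnergy D N β = couplingSeries fun k =>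
      ((1 / ((k.factorial : ℝ) * (k.factorial : ℝ)) *
        ∑ σ : Fin D → Equiv.Perm (Fin k) with (coloredGraph σ).Connected,
          ∑ σ₀ : Equiv.Perm (Fin k), graphTerm N β σ₀ σ (quenchedExponent σ₀ σ) : ℝ) : ℂ) := by
  rw [quenchedFreeEnergy_eq (by omega) hN]
  refine couplingSeries_eq ?_ fun k _ => ?_
  · rw [averagedGraphSum, connectedGraphs,
      Finset.filter_false_of_mem fun σ _ => not_connected_of_zero σ, Finset.sum_empty, smul_zero]
  · rw [averagedGraphSum, smul_eq_mul]
    push_cast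
    congr 1
    refine Finset.sum_congr rfl fun σ hσ => ?_
    rw [Finset.mul_sum]
    exact Finset.sum_congr rfl fun σ₀ _ =>
      (graphTerm_quenched hD hN β σ₀ σ (Finset.mem_filter.1 hσ).2).symm

theorem annealed_expansion (hD : 2 ≤ D) (hN : 1 ≤ N) (β : ℝ) :
    annealedFreeEnergy D N β = couplingSeries fun k =>
      ((1 / ((k.factorial : ℝ) * (k.factorial : ℝ)) *
        ∑ p : Equiv.Perm (Fin k) × (Fin D → Equiv.Perm (Fin k)) with
            (coloredGraph (withColorZero p.1 p.2)).Connected,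
          graphTerm N β p.1 p.2 (annealedExponent p.1 p.2) : ℝ) : ℂ) := by
  rw [annealedFreeEnergy_eq (by omega) hN]
  refine couplingSeries_eq ?_ fun k _ => ?_
  · rw [Finset.filter_false_of_mem fun σ _ => not_connected_of_zero σ, Finset.sum_empty, smul_zero]
  · rw [smul_eq_mul]
    push_cast
    congr 1
    symm
    refine Finset.sum_equiv (Fin.consEquiv fun _ : Fin (D + 1) => Equiv.Perm (Fin k))
      (fun p => ?_) fun p hp => graphTerm_annealed hD hN β p.1 p.2 (Finset.mem_filter.1 hp).2
    simp only [Finset.mem_filter, Finset.mem_univ, true_and]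
    exact Iff.rfl

end Expansions

end SYK

end

theorem mainTheorem2 (D N : ℕ) (hD : 2 ≤ D) (hN : 1 ≤ N) (β : ℝ) (hβ : 0 < β) :
    -- for a bosonic tensor, the averages are over integrable functions
    (Even D → ∀ d : Fin 2 →₀ ℕ,
      MeasureTheory.Integrable
        (fun T => MvPowerSeries.coeff d (SYK.partitionBosonic D N β T))
        (SYK.tensorMeasure D N) ∧
      MeasureTheory.Integrable
        (fun T => MvPowerSeries.coeff d (SYK.formalLog (SYK.partitionBosonic D N β T)))
        (SYK.tensorMeasure D N)) ∧
    -- the quenched expansion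
    SYK.quenchedFreeEnergy D N β = SYK.couplingSeries (fun k =>
      ((1 / ((k.factorial : ℝ) * (k.factorial : ℝ)) *
        ∑ σ : Fin D → Equiv.Perm (Fin k) with (SYK.coloredGraph σ).Connected,
          ∑ σ₀ : Equiv.Perm (Fin k),
            SYK.graphTerm N β σ₀ σ (SYK.quenchedExponent σ₀ σ) : ℝ) : ℂ)) ∧
    -- the annealed expansion
    SYK.annealedFreeEnergy D N β = SYK.couplingSeries (fun k =>
      ((1 / ((k.factorial : ℝ) * (k.factorial : ℝ)) *
        ∑ p : Equiv.Perm (Fin k) × (Fin D → Equiv.Perm (Fin k)) with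
            (SYK.coloredGraph (SYK.withColorZero p.1 p.2)).Connected,
          SYK.graphTerm N β p.1 p.2 (SYK.annealedExponent p.1 p.2) : ℝ) : ℂ)) ∧
    -- non-negativity of the degree, its monotonicity, and the bound on the exponents
    (∀ k : ℕ, 1 ≤ k → ∀ (σ₀ : Equiv.Perm (Fin k)) (σ : Fin D → Equiv.Perm (Fin k)),
      0 ≤ SYK.degree σ ∧
      0 ≤ SYK.degree (SYK.withColorZero σ₀ σ) ∧
      (D : ℚ) * SYK.degree σ ≤ SYK.degree (SYK.withColorZero σ₀ σ) ∧
      SYK.quenchedExponent σ₀ σ ≤ 1 ∧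
      SYK.annealedExponent σ₀ σ ≤ 1) := by
  refine ⟨fun h d => ⟨?_, ?_⟩, SYK.quenched_expansion hD hN β, SYK.annealed_expansion hD hN β,
    fun k hk σ₀ σ => SYK.degree_bounds hD hk σ₀ σ⟩
  · simp only [SYK.partitionBosonic_eq h (by omega : 1 ≤ D)]
    exact SYK.integrable_coeff_graphSum hN β _ d
  · simp only [SYK.formalLog_partitionBosonic h (by omega : 1 ≤ D)]
    exact SYK.integrable_coeff_graphSum hN β _ d
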